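/- All logarithms are base $2$. For integers $k,m\ge 0$ and a $k$-partite graph $G$ with blocks $V_i=\{v_{i,1},\dots,v_{i,m}\}$, $i\in[k]$, the *unary block clique formula with extension variables* of $G$ has the variables $x_v$ for the vertices $v$ and $z_{i,0},\dots,z_{i,m}$ for $i\in[k]$, and the clauses - $\bar x_u\vee\bar x_v$ for all pairs of distinct vertices $u,v$ with $\{u,v\}\notin E(G)$, - $\bar z_{i,0}$, $\;z_{i,j-1}\vee x_{v_{i,j}}\vee\bar z_{i,j}$ for $j\in[m]$, and $z_{i,m}$, for every $i\in[k]$ (these express the clause $\bigvee_{v\in V_i}x_v$). For $n\in\mathbb N$ let $m=m(n)$ be the largest integer $m \le n$ such that, for $k=\lceil 4\log m\rceil$ (with $k=0$ if $m=0$), these formulas have at most $n$ variables, that is, $k(2m+1)\le n$. Let $\mathcal A_n$ be the set of these formulas for all $k$-partite graphs $G$ with $k$ blocks of size $m$, viewed as formulas over $n$ variables (the remaining variables do not occur). For a set $\mathcal F$ of Boolean functions $f\colon\{0,1\}^n\to\{0,1\}$, a $\mathrm{Sem}(\mathcal F)$ refutation of length $t$ of an $n$-variate CNF formula $A$ is a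 sequence $f_1,\dots,f_t$ of Boolean functions such that $f_t$ is the constant $1$ function and each $f_i$ either is the indicator of the assignments falsifying some clause of $A$, or belongs to $\mathcal F$ and is derived from some $f_j,f_l$ with $j,l<i$ (possibly $j=l$) such that $f_i(\alpha)=1$ implies $f_j(\alpha)=1$ or $f_l(\alpha)=1$ for all $\alpha\in\{0,1\}^n$. It is tree-like if every line is used in at most one derivation step. **Theorem.** Every formula in $\mathcal A_n$ is an $n$-variate $3$-CNF formula (all clauses have at most three literals, over distinct variables). For every $\varepsilon>0$ there is a $c>0$ such that for every sequence $(\mathcal F_n)_{n\in\mathbb N}$ of sets of $n$-variate Boolean functions with $|\mathcal F_n|\le\exp(n^{2-\varepsilon})$ the following holds: if $A$ is chosen uniformly at random from $\mathcal A_n$, then with probability tending to $1$ as $n\to\infty$, the formula $A$ is unsatisfiable and every tree-like $\mathrm{Sem}(\mathcal F_n)$ refutation of $A$ has length at least $n^{c\log n}$, which is superpolynomial in $n$. -/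

import Mathlib

open Filter Topology

/-! ## CNF formulas -/

/-- A literal: a variable together with the Boolean value that satisfies it. -/
abbrev Literal (V : Type) : Type := V × Bool

/-- A clause, as the set of its literals. -/
abbrev Clause (V : Type) : Type := Finset (Literal V)

/-- A CNF formula, as the set of its clauses. -/
abbrev CNF (V : Type) : Type := Finset (Clause V)

/-- The Boolean functions over the variables `V`. -/
abbrev BoolFun (V : Type) : Type := (V → Bool) → Bool

/-- The positive literal `v`. -/
def posLit {V : Type} (v : V) : Literal V := (v, true)

/-- The negative literal `¬ v`. -/
def negLit {V : Type} (v : V) : Literal V := (v, false)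

/-- The assignment `α` satisfies the clause `C`. -/
def Clause.Sat {V : Type} (C : Clause V) (α : V → Bool) : Prop :=
  ∃ l ∈ C, α l.1 = l.2

/-- The assignment `α` satisfies the formula `A`. -/
def CNF.Sat {V : Type} (A : CNF V) (α : V → Bool) : Prop :=
  ∀ C ∈ A, Clause.Sat C α

/-- The formula `A` is unsatisfiable. -/
def CNF.Unsat {V : Type} (A : CNF V) : Prop :=
  ∀ α : V → Bool, ¬ A.Sat α

/-- Every clause of `A` is a disjunction of at most three literals over distinct variables. -/
def CNF.IsThreeCNF {V : Type} (A : CNF V) : Prop :=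
  ∀ C ∈ A, C.card ≤ 3 ∧ Set.InjOn Prod.fst (C : Set (Literal V))

/-- Renaming of the variables of a formula along an injection. -/
def CNF.rename {V W : Type} (f : V ↪ W) (A : CNF V) : CNF W :=
  A.map (Finset.mapEmbedding (f.prodMap (Function.Embedding.refl Bool))).toEmbedding

/-! ## Semantic proof systems -/

/-- A refutation of `A` in the semantic proof system over the set of lines `F`. A line is viewed
as the indicator of the assignments that it rules out. A line without recorded premises is the
indicator of the assignments falsifying some clause of `A`; any other line belongs to `F` and is
covered by the union of its two (possibly equal) premises, which are earlier lines. -/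
structure SemRefutation {V : Type} (F : Finset (BoolFun V)) (A : CNF V) where
  /-- the number of lines -/
  length : ℕ
  length_pos : 0 < length
  line : Fin length → BoolFun V
  premises : Fin length → Option (Fin length × Fin length)
  valid_input : ∀ i, premises i = none →
    ∃ C ∈ A, ∀ α, line i α = true ↔ ¬ Clause.Sat C α
  valid_infer : ∀ i j k, premises i = some (j, k) →
    line i ∈ F ∧ j < i ∧ k < i ∧
      ∀ α, line i α = true → line j α = true ∨ line k α = true
  last_line : line ⟨length - 1, Nat.sub_lt length_pos Nat.one_pos⟩ = fun _ => true

/-- The line `j` is a premise of the inference by which the line `i` is derived. -/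
def SemRefutation.UsedBy {V : Type} {F : Finset (BoolFun V)} {A : CNF V}
    (π : SemRefutation F A) (j i : Fin π.length) : Prop :=
  ∃ p, π.premises i = some p ∧ (p.1 = j ∨ p.2 = j)

/-- Every line is a premise of at most one inference. -/
def SemRefutation.TreeLike {V : Type} {F : Finset (BoolFun V)} {A : CNF V}
    (π : SemRefutation F A) : Prop :=
  ∀ j i i', π.UsedBy j i → π.UsedBy j i' → i = i'

/-! ## The unary block clique formula with extension variables -/

/-- The vertices of a `k`-partite graph with blocks of size `m`; the first component of a vertex
is the block that it lies in. -/
abbrev BlockVertex (k m : ℕ) : Type := Fin k × Fin m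

/-- The variables: `x v` for a vertex `v` and, for each block `i`, extension variables
`z i 0, …, z i m`. -/
abbrev CliqueVar (k m : ℕ) : Type := BlockVertex k m ⊕ (Fin k × Fin (m + 1))

/-- The variable stating that the vertex `v` is a member of the clique. -/
def xVar {k m : ℕ} (v : BlockVertex k m) : CliqueVar k m := Sum.inl v

/-- The extension variable stating that one of the first `j` vertices of the block `i` is a member
of the clique. -/
def zVar {k m : ℕ} (i : Fin k) (j : Fin (m + 1)) : CliqueVar k m := Sum.inr (i, j)

/-- The clauses of the unary block clique formula of the graph `G`: the edge axioms, for all pairs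
of distinct non-adjacent vertices, and for each block `i` the width-three clauses
`¬ z i 0`, `z i j ∨ x (i, j) ∨ ¬ z i (j + 1)` and `z i m`, which replace the wide clause
`⋁ j, x (i, j)`. -/
inductive IsCliqueClause {k m : ℕ} (G : SimpleGraph (BlockVertex k m)) :
    Clause (CliqueVar k m) → Prop
  | edge (u v : BlockVertex k m) (hne : u ≠ v) (hadj : ¬ G.Adj u v) :
      IsCliqueClause G {negLit (xVar u), negLit (xVar v)}
  | first (i : Fin k) : IsCliqueClause G {negLit (zVar i 0)}
  | next (i : Fin k) (j : Fin m) :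
      IsCliqueClause G
        {posLit (zVar i j.castSucc), posLit (xVar (i, j)), negLit (zVar i j.succ)}
  | last (i : Fin k) : IsCliqueClause G {posLit (zVar i (Fin.last m))}

open Classical in
/-- The unary block clique formula of `G`, as a formula with clauses of width at most three. -/
noncomputable def cliqueFormula {k m : ℕ} (G : SimpleGraph (BlockVertex k m)) :
    CNF (CliqueVar k m) :=
  Finset.univ.filter (IsCliqueClause G)

/-! ## The family of `n`-variate formulas -/

/-- The clique size `⌈4 log₂ m⌉` used for blocks of size `m`. -/
noncomputable def cliqueSize (m : ℕ) : ℕ := ⌈4 * Real.logb 2 (m : ℝ)⌉₊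

/-- The number of variables of the formula with blocks of size `m`. -/
noncomputable def numVars (m : ℕ) : ℕ := cliqueSize m * m + cliqueSize m * (m + 1)

/-- The largest block size `m ≤ n` for which the formula has at most `n` variables. -/
noncomputable def blockSize (n : ℕ) : ℕ := Nat.findGreatest (fun m => numVars m ≤ n) n

theorem numVars_blockSize_le (n : ℕ) : numVars (blockSize n) ≤ n := by
  have h : numVars 0 ≤ n := by simp [numVars, cliqueSize]
  exact Nat.findGreatest_spec (P := fun m => numVars m ≤ n) (Nat.zero_le n) h

/-- The numbering of the variables: first the vertices, block by block, then the extension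
variables, block by block. The remaining ones among the `n` variables do not occur in the
formulas. -/
noncomputable def varIndex (n : ℕ) :
    CliqueVar (cliqueSize (blockSize n)) (blockSize n) ↪ Fin n :=
  ((Equiv.sumCongr finProdFinEquiv finProdFinEquiv).trans finSumFinEquiv).toEmbedding.trans
    (Fin.castLEEmb (numVars_blockSize_le n))

open Classical in
/-- The family of the `n`-variate formulas of all `k`-partite graphs with `k` blocks of size `m`,
where `m` is the block size belonging to `n` and `k` the clique size belonging to `m`. -/
noncomputable def cliqueFamily (n : ℕ) : Finset (CNF (Fin n)) :=
  (Finset.univ.filter fun G : SimpleGraph (BlockVertex (cliqueSize (blockSize n)) (blockSize n)) =>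
      G ≤ SimpleGraph.completeEquipartiteGraph (cliqueSize (blockSize n)) (blockSize n)).image
    fun G => (cliqueFormula G).rename (varIndex n)

open Classical in
/-- The probability that a uniformly random element of `S` satisfies `P`. -/
noncomputable def uniformProb {α : Type} (S : Finset α) (P : α → Prop) : ℝ :=
  ((S.filter P).card : ℝ) / (S.card : ℝ)

/-! A refutation is tested only on the assignments `encode t`, where `t` chooses one vertex per
block. On these only edge axioms can fail, namely at tuples containing both ends of a non-edge. A
tree-like refutation thus becomes a `QueryTree` whose root label holds at every tuple. Querying the
label of a subtree of between an eighth and a half of the current size (`QueryTree.exists_split`)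
shrinks the tree by a factor 7/8 whatever the answer. So a refutation of length at most (8/7)^h
yields a search with `h` queries that ends with a non-edge lying in every tuple consistent with the
answers.

An adversary prevents this by maintaining a `CliqueState`: a clique `a` of the graph on few blocks
`I`, and a large set `S` of consistent tuples extending `a` by common neighbors that is spread,
meaning that fixing r further coordinates leaves at most a θ^r fraction, with θ = y^4/m and y a
small power of m. Since θ < 1, the only vertices common to all tuples of `S` are those of the
clique, so no non-edge is forced (`CliqueState.not_nonEdge`).

Queries are answered by majority. If the surviving half of `S` is not essentially spread, much of it
splits into spread pieces given by fixing some blocks `J` (`exists_spread_or_pieces`), and one of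
these pieces is used to enlarge the clique by `J` (`CliqueState.step`). Each fixed block raises the
density of `S`, relative to the expected number of extensions, by a factor of at least y, and each
query loses at most a factor 16. As degrees are regular, this density never exceeds 4^k. Hence at
most `d` blocks are ever fixed provided 4^(k+1) 16^h < y^(d+1). With k, d and log y all of order log
m, this permits h of order (log m)^2, which is the source of the bound n^(c log n).

Enlarging the clique requires a piece whose vertices in `J` form a clique of the random graph and
whose restriction to their common neighborhood has the expected size and remains spread. This must
hold simultaneously for all answer sets, of which there are about |F|^h, so the failure probability
has to be exp(-m^2/poly(y)). It has two sources (`pr_no_good_clique_le`). A single piece is bad with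
probability exp(-m/poly(y)), and half of them being bad requires m/poly(y) independent failures. The
edges inside `J` are independent of these events, and Janson's inequality, where only tuples
agreeing in two blocks are correlated, gives an exponent of order m^2 again. Finally, a first moment
bound excludes cliques meeting all blocks, so the formula is unsatisfiable. -/

/-! ## Uniform averages over the Boolean cube -/

/-- The average of `f` over the Boolean cube. -/
noncomputable def avg {E : Type} [Fintype E] [DecidableEq E] (f : (E → Bool) → ℝ) : ℝ :=
  (∑ g, f g) / (2 : ℝ) ^ Fintype.card E

open Classical in
/-- The indicator function of a predicate. -/
noncomputable def ind {Ω : Type} (p : Ω → Prop) (g : Ω) : ℝ := if p g then 1 else 0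

/-- The probability of `p` for a uniformly random point of the Boolean cube. -/
noncomputable def pr {E : Type} [Fintype E] [DecidableEq E] (p : (E → Bool) → Prop) : ℝ :=
  avg (ind p)

section Indicator

variable {Ω : Type}

theorem ind_nonneg (p : Ω → Prop) (g : Ω) : 0 ≤ ind p g := by
  unfold ind; split_ifs <;> norm_num

theorem ind_le_one (p : Ω → Prop) (g : Ω) : ind p g ≤ 1 := by
  unfold ind; split_ifs <;> norm_num

theorem ind_of_true {p : Ω → Prop} {g : Ω} (h : p g) : ind p g = 1 := by simp [ind, h]

theorem ind_of_false {p : Ω → Prop} {g : Ω} (h : ¬ p g) : ind p g = 0 := by simp [ind, h]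

theorem ind_congr {Ω' : Type} {p : Ω → Prop} {q : Ω' → Prop} {g : Ω} {g' : Ω'}
    (h : p g ↔ q g') : ind p g = ind q g' := by
  unfold ind; by_cases hq : q g' <;> simp [h, hq]

theorem ind_and (p q : Ω → Prop) (g : Ω) : ind (fun g => p g ∧ q g) g = ind p g * ind q g := by
  unfold ind; by_cases h1 : p g <;> by_cases h2 : q g <;> simp [h1, h2]

theorem ind_le_ind {p q : Ω → Prop} {g : Ω} (h : p g → q g) : ind p g ≤ ind q g := by
  by_cases hp : p g
  · rw [ind_of_true hp, ind_of_true (h hp)]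
  · rw [ind_of_false hp]; exact ind_nonneg q g

theorem sum_ind {ι : Type} (T : Finset ι) (B : ι → Ω → Prop) (g : Ω)
    [DecidablePred fun t => B t g] : ∑ t ∈ T, ind (B t) g = (T.filter fun t => B t g).card := by
  rw [Finset.natCast_card_filter]
  refine Finset.sum_congr rfl fun t _ => ?_
  unfold ind
  split_ifs <;> rfl

end Indicator

section Present

variable {E : Type}

/-- All coordinates in `D` are set. -/
def Present (D : Finset E) (g : E → Bool) : Prop := ∀ e ∈ D, g e = true

theorem dependsOn_ind {p : (E → Bool) → Prop} {s : Set E} (hp : DependsOn p s) :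
    DependsOn (ind p) s := by
  intro g g' hg
  exact ind_congr (iff_of_eq (hp hg))

theorem dependsOn_present (D : Finset E) : DependsOn (Present D) (D : Set E) := by
  intro g g' h
  unfold Present
  refine propext (forall₂_congr fun e he => ?_)
  rw [h e he]

theorem present_union [DecidableEq E] (D D' : Finset E) (g : E → Bool) :
    Present (D ∪ D') g ↔ Present D g ∧ Present D' g := by
  simp only [Present, Finset.mem_union, or_imp, forall_and]

theorem monotone_ind_present (D : Finset E) : Monotone (ind (Present D)) := by
  intro g g' h
  refine ind_le_ind (p := Present D) (q := fun _ => Present D g') (g := g) fun hg e he => ?_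
  have := h e
  rw [hg e he] at this
  exact top_le_iff.1 this

end Present

section Cube

variable {E : Type} [Fintype E] [DecidableEq E]

theorem avg_mono {f h : (E → Bool) → ℝ} (H : ∀ g, f g ≤ h g) : avg f ≤ avg h := by
  unfold avg
  gcongr
  exact H _

theorem avg_add (f h : (E → Bool) → ℝ) : avg (fun g => f g + h g) = avg f + avg h := by
  unfold avg
  rw [Finset.sum_add_distrib, add_div]

theorem avg_sub (f h : (E → Bool) → ℝ) : avg (fun g => f g - h g) = avg f - avg h := by
  unfold avg
  rw [Finset.sum_sub_distrib, sub_div]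

theorem avg_mul_left (c : ℝ) (f : (E → Bool) → ℝ) : avg (fun g => c * f g) = c * avg f := by
  unfold avg
  rw [← Finset.mul_sum, mul_div_assoc]

theorem avg_sum {ι : Type} (s : Finset ι) (f : ι → (E → Bool) → ℝ) :
    avg (fun g => ∑ i ∈ s, f i g) = ∑ i ∈ s, avg (f i) := by
  unfold avg
  rw [Finset.sum_comm, Finset.sum_div]

theorem avg_const (c : ℝ) : avg (fun _ : E → Bool => c) = c := by
  unfold avg
  simp

theorem avg_nonneg {f : (E → Bool) → ℝ} (H : ∀ g, 0 ≤ f g) : 0 ≤ avg f := by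
  have := avg_mono (f := fun _ => 0) H
  rwa [avg_const] at this

theorem pr_mono {p q : (E → Bool) → Prop} (h : ∀ g, p g → q g) : pr p ≤ pr q :=
  avg_mono fun g => ind_le_ind (h g)

theorem pr_nonneg (p : (E → Bool) → Prop) : 0 ≤ pr p := avg_nonneg (ind_nonneg p)

theorem pr_false : pr (fun _ : E → Bool => False) = 0 := by
  have : ind (fun _ : E → Bool => False) = fun _ => 0 := by
    funext g; exact ind_of_false (fun h => h)
  rw [pr, this, avg_const]

theorem pr_not (p : (E → Bool) → Prop) : pr (fun g => ¬ p g) = 1 - pr p := by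
  have : ind (fun g => ¬ p g) = fun g => 1 - ind p g := by
    funext g
    by_cases h : p g
    · simp [ind, h]
    · simp [ind, h]
  rw [pr, this, avg_sub, avg_const, pr]

theorem pr_or_le (p q : (E → Bool) → Prop) : pr (fun g => p g ∨ q g) ≤ pr p + pr q := by
  unfold pr
  rw [← avg_add]
  refine avg_mono fun g => ?_
  by_cases hp : p g <;> by_cases hq : q g <;> simp [ind, hp, hq]

theorem pr_exists_le {ι : Type} (s : Finset ι) (p : ι → (E → Bool) → Prop) :
    pr (fun g => ∃ i ∈ s, p i g) ≤ ∑ i ∈ s, pr (p i) := by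
  unfold pr
  rw [← avg_sum]
  refine avg_mono fun g => ?_
  by_cases h : ∃ i ∈ s, p i g
  · rw [ind_of_true (p := fun g => ∃ i ∈ s, p i g) h]
    obtain ⟨i, hi, hp⟩ := h
    rw [← ind_of_true (p := p i) hp]
    exact Finset.single_le_sum (f := fun i => ind (p i) g) (fun i _ => ind_nonneg _ _) hi
  · rw [ind_of_false (p := fun g => ∃ i ∈ s, p i g) h]
    exact Finset.sum_nonneg fun i _ => ind_nonneg _ _

theorem pr_exists_le_card_mul {ι : Type} (s : Finset ι) (p : ι → (E → Bool) → Prop) (r : ℝ)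
    (h : ∀ i ∈ s, pr (p i) ≤ r) : pr (fun g => ∃ i ∈ s, p i g) ≤ s.card * r := by
  refine (pr_exists_le s p).trans ?_
  rw [← nsmul_eq_mul]
  exact Finset.sum_le_card_nsmul _ _ _ h

/-- Markov's inequality. -/
theorem pr_le_avg_div {p : (E → Bool) → Prop} {f : (E → Bool) → ℝ} {c : ℝ} (hc : 0 < c)
    (hf : ∀ g, 0 ≤ f g) (h : ∀ g, p g → c ≤ f g) : pr p ≤ avg f / c := by
  rw [le_div_iff₀ hc, mul_comm, pr, ← avg_mul_left]
  refine avg_mono fun g => ?_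
  by_cases hp : p g
  · rw [ind_of_true hp, mul_one]; exact h g hp
  · rw [ind_of_false hp, mul_zero]; exact hf g

/-! ### Independence -/

/-- Functions of disjoint sets of coordinates are uncorrelated. -/
theorem avg_mul_of_dependsOn {f h : (E → Bool) → ℝ} {s t : Set E} (hf : DependsOn f s)
    (hh : DependsOn h t) (hst : Disjoint s t) :
    avg (fun g => f g * h g) = avg f * avg h := by
  classical
  -- Exchanging the coordinates outside `s` between two independent points permutes the pairs of
  -- points and decouples `f` from `h`.
  let mix : (E → Bool) × (E → Bool) → (E → Bool) × (E → Bool) := fun p =>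
    (fun e => if e ∈ s then p.1 e else p.2 e, fun e => if e ∈ s then p.2 e else p.1 e)
  have hmix : Function.Involutive mix := by
    intro p
    ext e <;> simp only [mix] <;> split_ifs <;> rfl
  have h1 : ∀ p : (E → Bool) × (E → Bool), f (mix p).1 * h (mix p).1 = f p.1 * h p.2 := by
    intro p
    congr 1
    · exact hf fun e he => by simp [mix, he]
    · exact hh fun e he => by simp [mix, Set.disjoint_right.1 hst he]
  have h2 : ∑ p : (E → Bool) × (E → Bool), f p.1 * h p.1 =
      ∑ p : (E → Bool) × (E → Bool), f p.1 * h p.2 := by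
    rw [← Equiv.sum_comp hmix.toPerm]
    exact Finset.sum_congr rfl fun p _ => h1 p
  rw [Fintype.sum_prod_type, Fintype.sum_prod_type] at h2
  simp only [Finset.sum_const, ← Finset.mul_sum] at h2
  rw [← Finset.sum_mul, ← Finset.smul_sum] at h2
  have hcard : ((Finset.univ : Finset (E → Bool)).card : ℝ) = 2 ^ Fintype.card E := by simp
  rw [nsmul_eq_mul, hcard] at h2
  unfold avg
  rw [div_mul_div_comm, ← h2]
  have : (2 : ℝ) ^ Fintype.card E ≠ 0 := by positivity
  field_simp

theorem pr_and_of_dependsOn {p q : (E → Bool) → Prop} {s t : Set E} (hp : DependsOn p s)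
    (hq : DependsOn q t) (hst : Disjoint s t) : pr (fun g => p g ∧ q g) = pr p * pr q := by
  unfold pr
  rw [← avg_mul_of_dependsOn (dependsOn_ind hp) (dependsOn_ind hq) hst]
  congr 1
  funext g
  exact ind_and p q g

theorem pr_coordinate (e : E) : pr (fun g => g e = true) = 1 / 2 := by
  classical
  have h : pr (fun g : E → Bool => g e = true) = pr (fun g : E → Bool => ¬ g e = true) := by
    unfold pr avg
    congr 1
    let flip : (E → Bool) → (E → Bool) := fun g => Function.update g e (!(g e))
    have hflip : Function.Involutive flip := by
      intro g
      simp [flip]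
    rw [← Equiv.sum_comp hflip.toPerm]
    refine Finset.sum_congr rfl fun g _ => ?_
    simp [ind, flip]
  rw [pr_not] at h
  linarith

theorem pr_present (D : Finset E) : pr (Present D) = (1 / 2 : ℝ) ^ D.card := by
  classical
  induction D using Finset.induction_on with
  | empty =>
    have : pr (Present (∅ : Finset E)) = pr (fun _ : E → Bool => ¬ False) := by
      congr 1; funext g; simp [Present]
    rw [this, pr_not, pr_false]; simp
  | insert e D he ih =>
    have h1 : Present (insert e D) = fun g => g e = true ∧ Present D g := by
      funext g; simp [Present]
    have h2 : DependsOn (fun g : E → Bool => g e = true) ({e} : Set E) := by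
      intro g g' h; simp [h e rfl]
    rw [h1, pr_and_of_dependsOn h2 (dependsOn_present D) (by simpa using he), pr_coordinate, ih,
      Finset.card_insert_of_notMem he, pow_succ]
    ring

/-! ### Janson's inequality -/

/-- The Harris inequality for an increasing and a decreasing function. -/
theorem avg_mul_le_of_monotone_antitone {f h : (E → Bool) → ℝ} (hf0 : 0 ≤ f) (hf : Monotone f)
    (hh : Antitone h) (hh1 : h ≤ 1) : avg (fun g => f g * h g) ≤ avg f * avg h := by
  -- The decreasing `h` enters as the increasing function `1 - h`, which is nonnegative because `h ≤
  -- 1`.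
  have key := fkg (μ := fun _ : E → Bool => (1 : ℝ)) (f := f) (g := fun g => 1 - h g)
    (fun _ => zero_le_one) hf0 (fun g => sub_nonneg.2 (hh1 g)) hf (fun a b hab => sub_le_sub_left (hh hab) 1)
    (fun _ _ => le_rfl)
  simp only [one_mul, Finset.sum_const, nsmul_eq_mul, mul_one] at key
  have hcard : ((Finset.univ : Finset (E → Bool)).card : ℝ) = 2 ^ Fintype.card E := by simp
  rw [hcard] at key
  have e1 : ∑ g : E → Bool, (1 - h g) = 2 ^ Fintype.card E - ∑ g, h g := by
    rw [Finset.sum_sub_distrib]; simp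
  have e2 : ∑ g : E → Bool, f g * (1 - h g) = ∑ g, f g - ∑ g, f g * h g := by
    rw [← Finset.sum_sub_distrib]; exact Finset.sum_congr rfl fun g _ => by ring
  rw [e1, e2] at key
  unfold avg
  have hpos : (0 : ℝ) < 2 ^ Fintype.card E := by positivity
  rw [div_mul_div_comm, div_le_div_iff₀ hpos (by positivity)]
  nlinarith [key, hpos]

theorem one_sub_sum_le_prod {ι : Type} (s : Finset ι) (x : ι → ℝ) (h0 : ∀ i ∈ s, 0 ≤ x i)
    (h1 : ∀ i ∈ s, x i ≤ 1) : 1 - ∑ i ∈ s, x i ≤ ∏ i ∈ s, (1 - x i) := by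
  classical
  induction s using Finset.induction_on with
  | empty => simp
  | insert a s ha ih =>
    rw [Finset.sum_insert ha, Finset.prod_insert ha]
    have ih' := ih (fun i hi => h0 i (Finset.mem_insert_of_mem hi))
      (fun i hi => h1 i (Finset.mem_insert_of_mem hi))
    have ha0 := h0 a (Finset.mem_insert_self a s)
    have ha1 := h1 a (Finset.mem_insert_self a s)
    have hs : 0 ≤ ∑ i ∈ s, x i :=
      Finset.sum_nonneg fun i hi => h0 i (Finset.mem_insert_of_mem hi)
    nlinarith [mul_le_mul_of_nonneg_left ih' (sub_nonneg.2 ha1), mul_nonneg ha0 hs]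

/-- The moment generating function bound behind Janson's inequality. -/
theorem avg_prod_le_exp {ι : Type} [DecidableEq ι] (P : Finset ι) (D : ι → Finset E) {p : ℝ}
    (hp0 : 0 ≤ p) (hp1 : p ≤ 1) :
    avg (fun g => ∏ t ∈ P, (1 - p * ind (Present (D t)) g)) ≤
      Real.exp (-(p * ∑ t ∈ P, (1 / 2 : ℝ) ^ (D t).card) +
        p ^ 2 * ∑ t ∈ P, ∑ t' ∈ P with ¬ Disjoint (D t) (D t'),
          (1 / 2 : ℝ) ^ (D t ∪ D t').card) := by
  induction P using Finset.induction_on with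
  | empty => simp [avg_const]
  | insert a P ha ih =>
    have hx0 : ∀ t g, 0 ≤ p * ind (Present (D t)) g := fun t g => mul_nonneg hp0 (ind_nonneg _ _)
    have hx1 : ∀ t g, p * ind (Present (D t)) g ≤ 1 := fun t g =>
      mul_le_one₀ hp1 (ind_nonneg _ _) (ind_le_one _ _)
    have hf0 : ∀ t g, 0 ≤ 1 - p * ind (Present (D t)) g := fun t g => sub_nonneg.2 (hx1 t g)
    have hf1 : ∀ t g, 1 - p * ind (Present (D t)) g ≤ 1 := fun t g => sub_le_self 1 (hx0 t g)
    -- `Z s g` is the probability that no set of `s` present in `g` survives if each is kept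
    -- independently with probability `p`. When `a` is added, the factors with `D t` disjoint from
    -- `D a` are independent of the presence of `D a`. The others are bounded below linearly, and
    -- Harris' inequality separates the resulting correlations from `Z non`.
    set Z : Finset ι → (E → Bool) → ℝ := fun s g => ∏ t ∈ s, (1 - p * ind (Present (D t)) g)
      with hZ
    set adj := P.filter fun t => ¬ Disjoint (D a) (D t) with hadj
    set non := P.filter fun t => Disjoint (D a) (D t) with hnon
    have hZ0 : ∀ s g, 0 ≤ Z s g := fun s g => Finset.prod_nonneg fun t _ => hf0 t g
    have hZ1 : ∀ s g, Z s g ≤ 1 := fun s g => Finset.prod_le_one (fun t _ => hf0 t g)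
      fun t _ => hf1 t g
    have hsplit : ∀ g, Z P g = Z non g * Z adj g := fun g =>
      (Finset.prod_filter_mul_prod_filter_not P _ _).symm
    have hAN : avg (Z P) ≤ avg (Z non) := avg_mono fun g => by
      rw [hsplit]; exact mul_le_of_le_one_right (hZ0 _ _) (hZ1 _ _)
    have hanti : Antitone (Z non) := by
      intro g g' h
      refine Finset.prod_le_prod (fun t _ => hf0 t g') fun t _ => ?_
      have := monotone_ind_present (D t) h
      nlinarith
    have hdep : DependsOn (Z non) ((D a : Set E)ᶜ) := by
      intro g g' h
      refine Finset.prod_congr rfl fun t ht => ?_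
      rw [dependsOn_ind (dependsOn_present (D t)) fun e he => h e ?_]
      exact fun hea => Finset.disjoint_left.1 (Finset.mem_filter.1 ht).2 hea he
    have hind : avg (fun g => ind (Present (D a)) g * Z non g) =
        (1 / 2 : ℝ) ^ (D a).card * avg (Z non) := by
      rw [avg_mul_of_dependsOn (dependsOn_ind (dependsOn_present (D a))) hdep disjoint_compl_right,
        ← pr_present, pr]
    have hcorr : ∀ t, avg (fun g => ind (Present (D a ∪ D t)) g * Z non g) ≤
        (1 / 2 : ℝ) ^ (D a ∪ D t).card * avg (Z non) := by
      intro t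
      rw [← pr_present, pr]
      exact avg_mul_le_of_monotone_antitone (fun g => ind_nonneg _ _) (monotone_ind_present _)
        hanti (hZ1 non)
    set S := ∑ t ∈ adj, (1 / 2 : ℝ) ^ (D a ∪ D t).card with hS
    have hlow : ((1 / 2 : ℝ) ^ (D a).card - p * S) * avg (Z non) ≤
        avg (fun g => ind (Present (D a)) g * Z P g) := by
      calc ((1 / 2 : ℝ) ^ (D a).card - p * S) * avg (Z non)
          = avg (fun g => ind (Present (D a)) g * Z non g) -
              p * ∑ t ∈ adj, (1 / 2 : ℝ) ^ (D a ∪ D t).card * avg (Z non) := by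
            rw [hind, hS, ← Finset.sum_mul]; ring
        _ ≤ avg (fun g => ind (Present (D a)) g * Z non g) -
              p * ∑ t ∈ adj, avg (fun g => ind (Present (D a ∪ D t)) g * Z non g) := by
            gcongr with t _
            exact hcorr t
        _ = avg (fun g => ind (Present (D a)) g * Z non g -
              p * ∑ t ∈ adj, ind (Present (D a ∪ D t)) g * Z non g) := by
            rw [avg_sub, avg_mul_left, avg_sum]
        _ ≤ _ := by
            refine avg_mono fun g => ?_
            have h1 := one_sub_sum_le_prod adj (fun t => p * ind (Present (D t)) g)
              (fun t _ => hx0 t g) (fun t _ => hx1 t g)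
            have h2 : ∀ t, ind (Present (D a ∪ D t)) g =
                ind (Present (D a)) g * ind (Present (D t)) g := by
              intro t
              rw [← ind_and]
              exact ind_congr (present_union _ _ g)
            simp only [h2]
            rw [hsplit, ← Finset.mul_sum] at *
            have h3 := mul_le_mul_of_nonneg_left h1
              (mul_nonneg (ind_nonneg (Present (D a)) g) (hZ0 non g))
            have h4 : p * ∑ t ∈ adj, ind (Present (D a)) g * ind (Present (D t)) g * Z non g =
                ind (Present (D a)) g * Z non g * (p * ∑ t ∈ adj, ind (Present (D t)) g) := by
              simp only [Finset.mul_sum]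
              exact Finset.sum_congr rfl fun t _ => by ring
            rw [h4]
            simp only [hZ] at *
            linarith
    have hA0 : 0 ≤ avg (Z P) := avg_nonneg (hZ0 P)
    have hrec : avg (Z (insert a P)) = avg (Z P) - p * avg (fun g => ind (Present (D a)) g * Z P g) := by
      rw [← avg_mul_left, ← avg_sub]
      congr 1
      funext g
      simp only [hZ, Finset.prod_insert ha]
      ring
    have hstep : avg (Z (insert a P)) ≤
        Real.exp (-(p * (1 / 2 : ℝ) ^ (D a).card) + p ^ 2 * S) * avg (Z P) := by
      rw [hrec]
      -- If this coefficient is negative, the exponent in the claim is nonnegative and the trivial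
      -- bound suffices.
      rcases le_total 0 ((1 / 2 : ℝ) ^ (D a).card - p * S) with hc | hc
      · have h1 := mul_le_mul_of_nonneg_left hAN hc
        have h2 := Real.add_one_le_exp (-(p * (1 / 2 : ℝ) ^ (D a).card) + p ^ 2 * S)
        have h3 := mul_le_mul_of_nonneg_right h2 hA0
        have h4 := mul_le_mul_of_nonneg_left (h1.trans hlow) hp0
        nlinarith
      · have h1 : 0 ≤ avg (fun g => ind (Present (D a)) g * Z P g) :=
          avg_nonneg fun g => mul_nonneg (ind_nonneg _ _) (hZ0 _ _)
        have h2 := Real.one_le_exp (x := -(p * (1 / 2 : ℝ) ^ (D a).card) + p ^ 2 * S) (by nlinarith)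
        nlinarith [mul_nonneg hp0 h1, mul_le_mul_of_nonneg_right h2 hA0]
    refine hstep.trans ?_
    refine (mul_le_mul_of_nonneg_left ih (Real.exp_pos _).le).trans ?_
    rw [← Real.exp_add]
    apply Real.exp_le_exp.2
    have hdouble : S + ∑ t ∈ P, ∑ t' ∈ P with ¬ Disjoint (D t) (D t'),
          (1 / 2 : ℝ) ^ (D t ∪ D t').card ≤
        ∑ t ∈ insert a P, ∑ t' ∈ insert a P with ¬ Disjoint (D t) (D t'),
          (1 / 2 : ℝ) ^ (D t ∪ D t').card := by
      rw [Finset.sum_insert ha]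
      refine add_le_add ?_ (Finset.sum_le_sum fun t _ => ?_)
      · exact Finset.sum_le_sum_of_subset_of_nonneg
          (Finset.filter_subset_filter _ (Finset.subset_insert a P)) fun _ _ _ => by positivity
      · exact Finset.sum_le_sum_of_subset_of_nonneg
          (Finset.filter_subset_filter _ (Finset.subset_insert a P)) fun _ _ _ => by positivity
    rw [Finset.sum_insert ha]
    nlinarith [mul_le_mul_of_nonneg_left hdouble (sq_nonneg p)]

/-- Janson's inequality for the lower tail. -/
theorem pr_card_present_le {ι : Type} [DecidableEq ι] {P : Finset ι} (hP : P.Nonempty)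
    (D : ι → Finset E) {e : ℕ} (hD : ∀ t ∈ P, (D t).card = e) {κ : ℝ} (hκ : 0 < κ)
    (hov : ∀ t ∈ P, ∑ t' ∈ P with ¬ Disjoint (D t) (D t'), (2 : ℝ) ^ (D t ∩ D t').card ≤
      P.card * κ) :
    pr (fun g => 4 * (2 : ℝ) ^ e * ∑ t ∈ P, ind (Present (D t)) g ≤ P.card) ≤
      Real.exp (-(1 / (16 * κ))) := by
  have hPpos : (0 : ℝ) < P.card := by exact_mod_cast hP.card_pos
  -- Empty sets are always present, so the event is impossible. The case is separate because an
  -- empty set is disjoint from itself, and then `hov` does not bound `κ` from below.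
  rcases Nat.eq_zero_or_pos e with he | he
  · subst he
    have h : ∀ g, ¬ (4 * (2 : ℝ) ^ 0 * ∑ t ∈ P, ind (Present (D t)) g ≤ P.card) := by
      intro g
      have : ∑ t ∈ P, ind (Present (D t)) g = P.card := by
        rw [Finset.sum_congr rfl fun t ht => ind_of_true (p := Present (D t)) (g := g) ?_]
        · simp
        · rw [Finset.card_eq_zero.1 (hD t ht)]; simp [Present]
      rw [this]
      linarith
    calc _ ≤ pr (fun _ : E → Bool => False) := pr_mono fun g hg => h g hg
      _ = 0 := pr_false
      _ ≤ _ := (Real.exp_pos _).le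
  obtain ⟨t0, ht0⟩ := hP
  have hκ1 : (2 : ℝ) ^ e ≤ P.card * κ := by
    refine le_trans ?_ (hov t0 ht0)
    have hmem : t0 ∈ P.filter fun t' => ¬ Disjoint (D t0) (D t') := by
      refine Finset.mem_filter.2 ⟨ht0, fun h => ?_⟩
      rw [disjoint_self] at h
      have := hD t0 ht0
      rw [h] at this
      simp at this
      omega
    have := Finset.single_le_sum (f := fun t' => (2 : ℝ) ^ (D t0 ∩ D t').card)
      (fun _ _ => by positivity) hmem
    simpa [hD t0 ht0] using this
  -- With this `p` the mean of the product is at most exp(-3/(16κ)), while on the event the product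
  -- is at least exp(-1/(8κ)), since 1 - p ≥ exp(-2p). The choice optimizes the quotient of these
  -- bounds.
  set p : ℝ := (2 : ℝ) ^ e / (4 * (P.card * κ)) with hp
  have hp0 : 0 ≤ p := by positivity
  have hp1 : p ≤ 1 / 4 := by
    rw [hp, div_le_div_iff₀ (by positivity) (by norm_num)]
    linarith
  have hmu : ∑ t ∈ P, (1 / 2 : ℝ) ^ (D t).card = P.card / 2 ^ e := by
    rw [Finset.sum_congr rfl fun t ht => by rw [hD t ht]]
    simp [div_eq_mul_inv]
  have hpair : ∀ t ∈ P, ∀ t' ∈ P, (1 / 2 : ℝ) ^ (D t ∪ D t').card =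
      (2 : ℝ) ^ (D t ∩ D t').card / (2 ^ e) ^ 2 := by
    intro t ht t' ht'
    have h1 := Finset.card_union_add_card_inter (D t) (D t')
    rw [hD t ht, hD t' ht'] at h1
    rw [one_div, inv_pow, ← pow_mul, eq_div_iff (by positivity), inv_mul_eq_div,
      div_eq_iff (by positivity), ← pow_add]
    congr 1
    omega
  have hdelta : ∑ t ∈ P, ∑ t' ∈ P with ¬ Disjoint (D t) (D t'),
      (1 / 2 : ℝ) ^ (D t ∪ D t').card ≤ P.card * (P.card * κ) / (2 ^ e) ^ 2 := by
    calc _ ≤ ∑ t ∈ P, (P.card * κ) / ((2 : ℝ) ^ e) ^ 2 := by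
          refine Finset.sum_le_sum fun t ht => ?_
          rw [Finset.sum_congr rfl fun t' ht' => hpair t ht t' (Finset.mem_filter.1 ht').1,
            ← Finset.sum_div]
          gcongr
          exact hov t ht
      _ = _ := by simp; ring
  have havg := avg_prod_le_exp P D hp0 (hp1.trans (by norm_num))
  rw [hmu] at havg
  have hexp : -(p * (P.card / 2 ^ e)) + p ^ 2 * ∑ t ∈ P, ∑ t' ∈ P with ¬ Disjoint (D t) (D t'),
      (1 / 2 : ℝ) ^ (D t ∪ D t').card ≤ -(3 / (16 * κ)) := by
    have h1 := mul_le_mul_of_nonneg_left hdelta (sq_nonneg p)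
    have h2 : p * (P.card / 2 ^ e) = 1 / (4 * κ) := by rw [hp]; field_simp
    have h3 : p ^ 2 * (P.card * (P.card * κ) / (2 ^ e) ^ 2) = 1 / (16 * κ) := by
      rw [hp]; field_simp; norm_num
    rw [h2]
    rw [h3] at h1
    have h4 : -(3 / (16 * κ)) = -(1 / (4 * κ)) + 1 / (16 * κ) := by field_simp; norm_num
    linarith
  have hexp2 := havg.trans (Real.exp_le_exp.2 hexp)
  have hmark := pr_le_avg_div (p := fun g => 4 * (2 : ℝ) ^ e * ∑ t ∈ P, ind (Present (D t)) g ≤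
      P.card) (f := fun g => ∏ t ∈ P, (1 - p * ind (Present (D t)) g))
    (c := Real.exp (-(1 / (8 * κ)))) (Real.exp_pos _) ?_ ?_
  · refine hmark.trans ?_
    rw [div_le_iff₀ (Real.exp_pos _), ← Real.exp_add]
    refine hexp2.trans (Real.exp_le_exp.2 (le_of_eq ?_))
    field_simp
    norm_num
  · exact fun g => Finset.prod_nonneg fun t _ => by
      nlinarith [ind_nonneg (Present (D t)) g, ind_le_one (Present (D t)) g]
  · intro g hg
    have hterm : ∀ t ∈ P, Real.exp (-(2 * p * ind (Present (D t)) g)) ≤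
        1 - p * ind (Present (D t)) g := by
      intro t _
      by_cases h : Present (D t) g
      · rw [ind_of_true h, mul_one, mul_one, Real.exp_neg]
        have h1 := Real.add_one_le_exp (2 * p)
        rw [inv_le_comm₀ (Real.exp_pos _) (by linarith)]
        refine le_trans ?_ h1
        rw [inv_le_comm₀ (by linarith) (by linarith), inv_le_iff_one_le_mul₀ (by linarith)]
        nlinarith
      · simp [ind_of_false h]
    refine le_trans ?_ (Finset.prod_le_prod (fun t _ => (Real.exp_pos _).le) hterm)
    rw [← Real.exp_sum]
    apply Real.exp_le_exp.2
    rw [Finset.sum_neg_distrib, ← Finset.mul_sum]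
    have h1 : 2 * p * ∑ t ∈ P, ind (Present (D t)) g =
        (4 * 2 ^ e * ∑ t ∈ P, ind (Present (D t)) g) * (1 / (8 * (P.card * κ))) := by
      rw [hp]; field_simp; ring
    have h2 := mul_le_mul_of_nonneg_right hg (by positivity : 0 ≤ 1 / (8 * (P.card * κ)))
    have h3 : P.card * (1 / (8 * (P.card * κ))) = 1 / (8 * κ) := by field_simp
    rw [h1]
    linarith

/-! ### Upper tails -/

/-- A bound on the moments of the number of sets `D t` that are present. -/
theorem avg_pow_card_present_le {ι : Type} [DecidableEq ι] {P : Finset ι} (D : ι → Finset E)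
    {q : ℕ} {Λ : ℝ} (hΛ : 0 ≤ Λ)
    (h : ∀ s ⊆ P, s.card ≤ q → ∑ t ∈ P, (1 / 2 : ℝ) ^ (D t \ s.biUnion D).card ≤ Λ) :
    avg (fun g => (∑ t ∈ P, ind (Present (D t)) g) ^ q) ≤ Λ ^ q := by
  -- The sets in `s` are those already required to be present. Expanding one factor of the power
  -- adds one more set to `s`, and the hypothesis bounds the conditional expectation of the sum by
  -- `Λ`.
  have key : ∀ r : ℕ, ∀ s ⊆ P, s.card + r ≤ q →
      avg (fun g => ind (Present (s.biUnion D)) g * (∑ t ∈ P, ind (Present (D t)) g) ^ r) ≤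
        (1 / 2 : ℝ) ^ (s.biUnion D).card * Λ ^ r := by
    intro r
    induction r with
    | zero =>
      intro s _ _
      simp only [pow_zero, mul_one]
      exact (pr_present _).le
    | succ r ih =>
      intro s hs hsr
      have h1 : ∀ t g, ind (Present ((insert t s).biUnion D)) g =
          ind (Present (s.biUnion D)) g * ind (Present (D t)) g := by
        intro t g
        rw [← ind_and, Finset.biUnion_insert, Finset.union_comm]
        exact ind_congr (present_union _ _ g)
      calc avg (fun g => ind (Present (s.biUnion D)) g *
              (∑ t ∈ P, ind (Present (D t)) g) ^ (r + 1))
          = ∑ t ∈ P, avg (fun g => ind (Present ((insert t s).biUnion D)) g *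
              (∑ t ∈ P, ind (Present (D t)) g) ^ r) := by
            rw [← avg_sum]
            congr 1
            funext g
            simp only [h1]
            rw [← Finset.sum_mul, ← Finset.mul_sum, pow_succ]
            ring
        _ ≤ ∑ t ∈ P, (1 / 2 : ℝ) ^ ((insert t s).biUnion D).card * Λ ^ r := by
            refine Finset.sum_le_sum fun t ht => ih _ ?_ ?_
            · exact Finset.insert_subset ht hs
            · have := Finset.card_insert_le t s
              omega
        _ = (1 / 2 : ℝ) ^ (s.biUnion D).card *
              (∑ t ∈ P, (1 / 2 : ℝ) ^ (D t \ s.biUnion D).card) * Λ ^ r := by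
            rw [Finset.mul_sum, Finset.sum_mul]
            refine Finset.sum_congr rfl fun t _ => ?_
            rw [Finset.biUnion_insert, ← pow_add, ← Finset.card_sdiff_add_card, add_comm]
        _ ≤ (1 / 2 : ℝ) ^ (s.biUnion D).card * Λ * Λ ^ r := by
            gcongr
            exact h s hs (by omega)
        _ = _ := by rw [pow_succ]; ring
  have := key q ∅ (Finset.empty_subset _) (by simp)
  simpa [Present, ind] using this

/-- Pairwise independent families of events: if every event shares coordinates with few others,
then it is very unlikely that half of the events happen. -/
theorem pr_half_le {ι : Type} [DecidableEq ι] {T : Finset ι} (B : ι → (E → Bool) → Prop)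
    (dep : ι → Finset E) (hB : ∀ t ∈ T, DependsOn (B t) (dep t : Set E)) {N : ℕ} {p : ℝ}
    (hp : ∀ t ∈ T, pr (B t) ≤ p) (hp0 : 0 ≤ p)
    (hfew : ∀ t ∈ T, 2 * N * (T.filter fun t' => t' = t ∨ ¬ Disjoint (dep t) (dep t')).card ≤ T.card) :
    pr (fun g => (T.card : ℝ) < 2 * ∑ t ∈ T, ind (B t) g) ≤ (T.card * p) ^ N := by
  classical
  set H : (E → Bool) → Prop := fun g => (T.card : ℝ) < 2 * ∑ t ∈ T, ind (B t) g with hH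
  have hprod : ∀ s ⊆ T, (s : Set ι).Pairwise (fun t t' => Disjoint (dep t) (dep t')) →
      avg (fun g => ∏ t ∈ s, ind (B t) g) ≤ p ^ s.card := by
    intro s
    induction s using Finset.induction_on with
    | empty => intro _ _; simp [avg_const]
    | insert a s ha ih =>
      intro hs hpw
      have haT : a ∈ T := hs (Finset.mem_insert_self a s)
      have hsT : s ⊆ T := (Finset.subset_insert a s).trans hs
      simp only [Finset.prod_insert ha]
      have hd1 : DependsOn (fun g => ∏ t ∈ s, ind (B t) g) ((s.biUnion dep : Finset E) : Set E) := by
        intro g g' hg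
        refine Finset.prod_congr rfl fun t ht => ?_
        exact dependsOn_ind (hB t (hsT ht)) fun e he =>
          hg e (Finset.mem_coe.2 (Finset.mem_biUnion.2 ⟨t, ht, he⟩))
      have hdisj : Disjoint ((dep a : Finset E) : Set E) ((s.biUnion dep : Finset E) : Set E) := by
        rw [Finset.disjoint_coe, Finset.disjoint_biUnion_right]
        intro t ht
        exact hpw (by simp) (by simp [ht]) (fun h => ha (h ▸ ht))
      rw [avg_mul_of_dependsOn (dependsOn_ind (hB a haT)) hd1 hdisj,
        Finset.card_insert_of_notMem ha, pow_succ, mul_comm (p ^ _)]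
      refine mul_le_mul (hp a haT) (ih hsT (hpw.mono (by simp))) ?_ hp0
      exact avg_nonneg fun g => Finset.prod_nonneg fun t _ => ind_nonneg _ _
  -- The `N` bad events are collected one by one. By `hfew`, fewer than `N` of them share
  -- coordinates with at most half of `T`, so on `H` some bad event is independent of all those
  -- collected. Each choice costs a factor `T.card`.
  have key : ∀ r : ℕ, ∀ s ⊆ T, (s : Set ι).Pairwise (fun t t' => Disjoint (dep t) (dep t')) →
      s.card + r ≤ N →
      avg (fun g => (∏ t ∈ s, ind (B t) g) * ind H g) ≤ p ^ s.card * (T.card * p) ^ r := by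
    intro r
    induction r with
    | zero =>
      intro s hs hpw _
      rw [pow_zero, mul_one]
      refine le_trans (avg_mono fun g => ?_) (hprod s hs hpw)
      exact mul_le_of_le_one_right (Finset.prod_nonneg fun t _ => ind_nonneg _ _) (ind_le_one _ _)
    | succ r ih =>
      intro s hs hpw hsr
      set free := T.filter fun t => t ∉ s ∧ ∀ t' ∈ s, Disjoint (dep t') (dep t) with hfree
      have hle : ∀ g, (∏ t ∈ s, ind (B t) g) * ind H g ≤
          ∑ t ∈ free, (∏ t' ∈ insert t s, ind (B t') g) * ind H g := by
        intro g
        have hsum0 : 0 ≤ ∑ t ∈ free, (∏ t' ∈ insert t s, ind (B t') g) * ind H g :=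
          Finset.sum_nonneg fun t _ => mul_nonneg (Finset.prod_nonneg fun t _ => ind_nonneg _ _)
            (ind_nonneg _ _)
        by_cases hg : H g
        swap
        · rw [ind_of_false hg, mul_zero]; simp
        by_cases hall : ∀ t ∈ s, B t g
        swap
        · push Not at hall
          obtain ⟨t, ht, hBt⟩ := hall
          rw [Finset.prod_eq_zero ht (ind_of_false (p := B t) hBt), zero_mul]
          exact hsum0
        have hbusy : ∃ t ∈ free, B t g := by
          by_contra hno
          push Not at hno
          have hsub : (T.filter fun t => B t g) ⊆
              s.biUnion fun t' => T.filter fun t => t = t' ∨ ¬ Disjoint (dep t') (dep t) := by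
            intro t ht
            rw [Finset.mem_filter] at ht
            by_contra hnot
            simp only [Finset.mem_biUnion, Finset.mem_filter, not_exists, not_and, not_or,
              not_not] at hnot
            exact hno t (Finset.mem_filter.2 ⟨ht.1, fun hts => (hnot t hts ht.1).1 rfl,
              fun t' ht' => (hnot t' ht' ht.1).2⟩) ht.2
          have hcount : (T.card : ℝ) < 2 * (T.filter fun t => B t g).card := by
            have : ∑ t ∈ T, ind (B t) g = (T.filter fun t => B t g).card :=
              sum_ind T B g
            rw [← this]
            exact hg
          have hcount' : T.card < 2 * (T.filter fun t => B t g).card := by exact_mod_cast hcount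
          have h1 := (Finset.card_le_card hsub).trans Finset.card_biUnion_le
          have h2 : ∑ t' ∈ s, 2 * N * (T.filter fun t => t = t' ∨ ¬ Disjoint (dep t') (dep t)).card ≤
              s.card * T.card := by
            rw [← smul_eq_mul]
            exact Finset.sum_le_card_nsmul _ _ _ fun t' ht' => hfew t' (hs ht')
          rw [← Finset.mul_sum] at h2
          have h3 := Nat.mul_le_mul_left (2 * N) h1
          have h4 : s.card * T.card ≤ N * T.card := Nat.mul_le_mul_right _ (by omega)
          have h5 := Nat.mul_lt_mul_of_pos_left hcount' (by omega : 0 < N)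
          have h6 : N * (2 * (T.filter fun t => B t g).card) =
              2 * N * (T.filter fun t => B t g).card := by ring
          omega
        obtain ⟨t, ht, hBt⟩ := hbusy
        refine le_trans ?_ (Finset.single_le_sum (fun t _ => mul_nonneg
          (Finset.prod_nonneg fun t _ => ind_nonneg _ _) (ind_nonneg _ _)) ht)
        rw [Finset.prod_insert (Finset.mem_filter.1 ht).2.1, ind_of_true hBt, one_mul]
      calc _ ≤ avg (fun g => ∑ t ∈ free, (∏ t' ∈ insert t s, ind (B t') g) * ind H g) :=
            avg_mono hle
        _ = ∑ t ∈ free, avg (fun g => (∏ t' ∈ insert t s, ind (B t') g) * ind H g) := avg_sum _ _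
        _ ≤ ∑ t ∈ free, p ^ (s.card + 1) * (T.card * p) ^ r := by
            refine Finset.sum_le_sum fun t ht => ?_
            rw [Finset.mem_filter] at ht
            have := ih (insert t s) (Finset.insert_subset ht.1 hs) ?_ ?_
            · rwa [Finset.card_insert_of_notMem ht.2.1] at this
            · rw [Finset.coe_insert]
              exact Set.pairwise_insert.2 ⟨hpw, fun t' ht' _ =>
                ⟨(ht.2.2 t' ht').symm, ht.2.2 t' ht'⟩⟩
            · rw [Finset.card_insert_of_notMem ht.2.1]; omega
        _ ≤ T.card * (p ^ (s.card + 1) * (T.card * p) ^ r) := by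
            rw [Finset.sum_const, nsmul_eq_mul]
            gcongr
            exact Finset.filter_subset _ _
        _ = _ := by ring
  have := key N ∅ (Finset.empty_subset _) (by simp) (by simp)
  simpa [pr] using this

end Cube

/-! ## Transversal tuples and their edges -/

/-- A choice of one vertex in each block. -/
abbrev Tup (k m : ℕ) : Type := Fin k → Fin m

/-- The potential edges of a graph on the block vertices. -/
abbrev Slot (k m : ℕ) : Type := Sym2 (BlockVertex k m)

section Tuples

variable {k m : ℕ}

/-- The members of `P` that agree with `c` on `R`. -/
def cyl (P : Finset (Tup k m)) (R : Finset (Fin k)) (c : Tup k m) : Finset (Tup k m) :=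
  P.filter fun t => ∀ i ∈ R, t i = c i

theorem mem_cyl {P : Finset (Tup k m)} {R : Finset (Fin k)} {c t : Tup k m} :
    t ∈ cyl P R c ↔ t ∈ P ∧ ∀ i ∈ R, t i = c i := Finset.mem_filter

theorem cyl_subset (P : Finset (Tup k m)) (R : Finset (Fin k)) (c : Tup k m) : cyl P R c ⊆ P :=
  Finset.filter_subset _ _

theorem cyl_empty (P : Finset (Tup k m)) (c : Tup k m) : cyl P ∅ c = P := by
  ext t; simp [mem_cyl]

/-- Fixing the coordinates in a subset `R` of `Q` leaves at most `K * θ ^ |R|` members of `P`. -/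
def Spread (θ : ℝ) (Q : Finset (Fin k)) (P : Finset (Tup k m)) (K : ℝ) : Prop :=
  ∀ R ⊆ Q, ∀ c, ((cyl P R c).card : ℝ) ≤ K * θ ^ R.card

theorem Spread.mono_const {θ : ℝ} (hθ : 0 ≤ θ) {Q : Finset (Fin k)} {P : Finset (Tup k m)}
    {K K' : ℝ} (h : Spread θ Q P K) (hK : K ≤ K') : Spread θ Q P K' := fun R hR c =>
  (h R hR c).trans (mul_le_mul_of_nonneg_right hK (pow_nonneg hθ _))

theorem Spread.mono_set {θ : ℝ} {Q : Finset (Fin k)} {P P' : Finset (Tup k m)}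
    {K : ℝ} (h : Spread θ Q P K) (hP : P' ⊆ P) : Spread θ Q P' K := fun R hR c =>
  le_trans (by exact_mod_cast Finset.card_le_card (Finset.filter_subset_filter _ hP)) (h R hR c)

/-- The coordinates in `Q` at which `t` and `t'` agree. -/
def agree (Q : Finset (Fin k)) (t t' : Tup k m) : Finset (Fin k) := Q.filter fun i => t i = t' i

/-- The set of agreement is itself one of the sets `R` on which the tuples agree, so its weight may
be replaced by a sum over all such `R`. For fixed `R` these tuples form a cylinder, which spreadness
counts. This controls the overlap sums in Janson's inequality. -/
theorem sum_pow_agree_le {θ : ℝ} {Q : Finset (Fin k)} {P : Finset (Tup k m)}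
    {K : ℝ} (h : Spread θ Q P K) {z : ℝ} (hz : 0 ≤ z) (r : ℕ) (t : Tup k m) :
    ∑ t' ∈ P with r ≤ (agree Q t t').card, z ^ (agree Q t t').card ≤
      K * ∑ R ∈ Q.powerset with r ≤ R.card, (z * θ) ^ R.card := by
  calc ∑ t' ∈ P with r ≤ (agree Q t t').card, z ^ (agree Q t t').card
      ≤ ∑ t' ∈ P, ∑ R ∈ Q.powerset with r ≤ R.card,
          if t' ∈ cyl P R t then z ^ R.card else 0 := by
        rw [Finset.sum_filter]
        refine Finset.sum_le_sum fun t' ht' => ?_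
        have h0 : ∀ R ∈ Q.powerset.filter (r ≤ ·.card),
            0 ≤ if t' ∈ cyl P R t then z ^ R.card else 0 := by
          intro R _
          split_ifs <;> positivity
        split_ifs with hr
        · have hmem : agree Q t t' ∈ Q.powerset.filter (r ≤ ·.card) :=
            Finset.mem_filter.2 ⟨Finset.mem_powerset.2 (Finset.filter_subset _ _), hr⟩
          refine le_trans (le_of_eq ?_) (Finset.single_le_sum h0 hmem)
          rw [if_pos]
          exact mem_cyl.2 ⟨ht', fun i hi => (Finset.mem_filter.1 hi).2.symm⟩
        · exact Finset.sum_nonneg h0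
    _ = ∑ R ∈ Q.powerset with r ≤ R.card, ((cyl P R t).card : ℝ) * z ^ R.card := by
        rw [Finset.sum_comm]
        refine Finset.sum_congr rfl fun R _ => ?_
        rw [← Finset.sum_filter, Finset.sum_const, nsmul_eq_mul]
        congr 3
        ext t'
        rw [Finset.mem_filter]
        exact ⟨fun h => h.2, fun h => ⟨cyl_subset _ _ _ h, h⟩⟩
    _ ≤ ∑ R ∈ Q.powerset with r ≤ R.card, K * θ ^ R.card * z ^ R.card := by
        refine Finset.sum_le_sum fun R hR => ?_
        have := h R (Finset.mem_powerset.1 (Finset.mem_filter.1 hR).1) t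
        gcongr
    _ = _ := by
        rw [Finset.mul_sum]
        exact Finset.sum_congr rfl fun R _ => by rw [mul_pow]; ring

theorem sum_powerset_pow_card (Q : Finset (Fin k)) (x : ℝ) :
    ∑ R ∈ Q.powerset, x ^ R.card = (1 + x) ^ Q.card := by
  rw [add_comm, ← Finset.sum_pow_mul_eq_add_pow]
  simp

theorem one_add_pow_le_exp (Q : Finset (Fin k)) {x : ℝ} (hx : 0 ≤ x) :
    (1 + x) ^ Q.card ≤ Real.exp (k * x) := by
  have h1 : 1 + x ≤ Real.exp x := by linarith [Real.add_one_le_exp x]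
  have hQ : Q.card ≤ k := by simpa using Finset.card_le_univ Q
  calc (1 + x) ^ Q.card ≤ (1 + x) ^ k := pow_le_pow_right₀ (by linarith) hQ
    _ ≤ Real.exp x ^ k := by gcongr
    _ = Real.exp (k * x) := by rw [← Real.exp_nat_mul]

theorem sum_powerset_one_le (Q : Finset (Fin k)) {x : ℝ} (hx : 0 ≤ x) (hk : k * x ≤ 1) :
    ∑ R ∈ Q.powerset with 1 ≤ R.card, x ^ R.card ≤ 2 * (k * x) := by
  have h1 : ∑ R ∈ Q.powerset, x ^ R.card =
      ∑ R ∈ Q.powerset with 1 ≤ R.card, x ^ R.card + 1 := by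
    rw [← Finset.sum_filter_add_sum_filter_not Q.powerset (1 ≤ ·.card)]
    congr 1
    have : Q.powerset.filter (fun R => ¬ 1 ≤ R.card) = {∅} := by
      ext R; simp only [Finset.mem_filter, Finset.mem_powerset, Finset.mem_singleton]
      constructor
      · rintro ⟨_, h⟩; exact Finset.card_eq_zero.1 (by omega)
      · rintro rfl; simp
    rw [this]; simp
  have hkx : 0 ≤ k * x := by positivity
  have h2 := Real.abs_exp_sub_one_sub_id_le (x := k * x) (by rwa [abs_of_nonneg hkx])
  have h3 := (abs_le.1 h2).2
  have h4 := one_add_pow_le_exp Q hx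
  rw [sum_powerset_pow_card] at h1
  nlinarith

/-- The constant and linear terms of the binomial expansion are removed. The remaining square turns
a ratio `x` of order 1/m into a Janson exponent of order m^2. -/
theorem sum_powerset_two_le (Q : Finset (Fin k)) {x : ℝ} (hx : 0 ≤ x) (hk : k * x ≤ 1) :
    ∑ R ∈ Q.powerset with 2 ≤ R.card, x ^ R.card ≤ (k * x) ^ 2 := by
  have h1 : ∑ R ∈ Q.powerset, x ^ R.card =
      ∑ R ∈ Q.powerset with 2 ≤ R.card, x ^ R.card + (1 + Q.card * x) := by
    rw [← Finset.sum_filter_add_sum_filter_not Q.powerset (2 ≤ ·.card)]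
    congr 1
    have : Q.powerset.filter (fun R => ¬ 2 ≤ R.card) =
        Q.powersetCard 0 ∪ Q.powersetCard 1 := by
      ext R
      simp only [Finset.mem_filter, Finset.mem_powerset, Finset.mem_union,
        Finset.mem_powersetCard, ← and_or_left]
      exact and_congr_right fun _ => by omega
    rw [this, Finset.sum_union]
    · congr 1
      · simp
      · rw [Finset.sum_congr rfl fun R hR => by rw [(Finset.mem_powersetCard.1 hR).2, pow_one]]
        simp
    · exact Finset.pairwise_disjoint_powersetCard Q (by norm_num)
  have hQ : Q.card ≤ k := by simpa using Finset.card_le_univ Q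
  have hQ' : (Q.card : ℝ) ≤ k := by exact_mod_cast hQ
  have hq0 : 0 ≤ Q.card * x := by positivity
  have hqx : Q.card * x ≤ k * x := by gcongr
  have h2 := Real.abs_exp_sub_one_sub_id_le (x := Q.card * x)
    (by rw [abs_of_nonneg hq0]; linarith)
  have h3 := (abs_le.1 h2).2
  have h4 : (1 + x) ^ Q.card ≤ Real.exp (Q.card * x) := by
    rw [Real.exp_nat_mul]
    gcongr
    linarith [Real.add_one_le_exp x]
  rw [sum_powerset_pow_card] at h1
  nlinarith

/-- The edges between the vertices of `b` in the blocks `J` and those of `t` in the blocks `Q`. -/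
def linkEdges (J Q : Finset (Fin k)) (b t : Tup k m) : Finset (Slot k m) :=
  (J ×ˢ Q).image fun p => s((p.1, b p.1), (p.2, t p.2))

/-- The edges between the vertices of `t` in the blocks `J`. -/
def cliqueEdges (J : Finset (Fin k)) (t : Tup k m) : Finset (Slot k m) :=
  ((J ×ˢ J).filter fun p => p.1 < p.2).image fun p => s((p.1, t p.1), (p.2, t p.2))

/-- Slots are unordered pairs; the disjointness of `J` and `Q` rules out the swapped identification.
-/
theorem link_slot_inj {J Q : Finset (Fin k)} (hJQ : Disjoint J Q) {i i' j j' : Fin k}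
    {u u' v v' : Fin m} (hj : j ∈ J) (hi' : i' ∈ Q)
    (h : s((j, u), (i, v)) = s((j', u'), (i', v'))) : j = j' ∧ u = u' ∧ i = i' ∧ v = v' := by
  rw [Sym2.eq_iff] at h
  simp only [Prod.mk.injEq] at h
  rcases h with h | h
  · exact ⟨h.1.1, h.1.2, h.2.1, h.2.2⟩
  · exact absurd (h.1.1 ▸ hi') (Finset.disjoint_left.1 hJQ hj)

theorem card_linkEdges {J Q : Finset (Fin k)} (hJQ : Disjoint J Q) (b t : Tup k m) :
    (linkEdges J Q b t).card = J.card * Q.card := by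
  rw [linkEdges, Finset.card_image_of_injOn, Finset.card_product]
  rintro ⟨j, i⟩ hp ⟨j', i'⟩ hp' h
  rw [Finset.mem_coe, Finset.mem_product] at hp hp'
  obtain ⟨h1, _, h2, _⟩ := link_slot_inj hJQ hp.1 hp'.2 h
  exact Prod.ext h1 h2

theorem linkEdges_inter_subset {J Q : Finset (Fin k)} (hJQ : Disjoint J Q) (b t t' : Tup k m) :
    linkEdges J Q b t ∩ linkEdges J Q b t' ⊆ linkEdges J (agree Q t t') b t := by
  intro e he
  simp only [linkEdges, Finset.mem_inter, Finset.mem_image, Finset.mem_product] at he ⊢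
  obtain ⟨⟨⟨j, i⟩, hp, rfl⟩, ⟨⟨j', i'⟩, hp', h⟩⟩ := he
  refine ⟨(j, i), ⟨hp.1, Finset.mem_filter.2 ⟨hp.2, ?_⟩⟩, rfl⟩
  obtain ⟨_, _, h2, h3⟩ := link_slot_inj hJQ hp'.1 hp.2 h
  simp only at h2 h3
  rw [← h3, h2]

theorem card_linkEdges_le (J Q : Finset (Fin k)) (b t : Tup k m) :
    (linkEdges J Q b t).card ≤ J.card * Q.card := by
  rw [← Finset.card_product]; exact Finset.card_image_le

/-- Lower tail for the number of tuples joined to the vertices of `b` in the blocks `J`. -/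
theorem pr_link_lower {J Q : Finset (Fin k)} (hJQ : Disjoint J Q) (hk : 0 < k) (b : Tup k m)
    {P : Finset (Tup k m)} (hP : P.Nonempty) {θ : ℝ} (hθ : 0 < θ) (hS : Spread θ Q P P.card)
    (hx : k * (2 ^ J.card * θ) ≤ 1) :
    pr (fun g => 4 * (2 : ℝ) ^ (J.card * Q.card) *
        ∑ t ∈ P, ind (Present (linkEdges J Q b t)) g ≤ P.card) ≤
      Real.exp (-(1 / (32 * (k * (2 ^ J.card * θ))))) := by
  have hk' : (0 : ℝ) < k := by exact_mod_cast hk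
  have := pr_card_present_le hP (linkEdges J Q b) (fun t _ => card_linkEdges hJQ b t)
    (κ := 2 * (k * (2 ^ J.card * θ))) (by positivity) ?_
  · refine this.trans (le_of_eq ?_)
    congr 3
    ring
  intro t _
  calc ∑ t' ∈ P with ¬ Disjoint (linkEdges J Q b t) (linkEdges J Q b t'),
        (2 : ℝ) ^ (linkEdges J Q b t ∩ linkEdges J Q b t').card
      ≤ ∑ t' ∈ P with 1 ≤ (agree Q t t').card, ((2 : ℝ) ^ J.card) ^ (agree Q t t').card := by
        refine (Finset.sum_le_sum_of_subset_of_nonneg ?_ fun _ _ _ => by positivity).trans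
          (Finset.sum_le_sum fun t' _ => ?_)
        · intro t' ht'
          rw [Finset.mem_filter] at ht' ⊢
          refine ⟨ht'.1, ?_⟩
          rw [Finset.not_disjoint_iff] at ht'
          obtain ⟨_, e, he, he'⟩ := ht'
          have := linkEdges_inter_subset hJQ b t t' (Finset.mem_inter.2 ⟨he, he'⟩)
          simp only [linkEdges, Finset.mem_image, Finset.mem_product] at this
          obtain ⟨p, hp, _⟩ := this
          exact Finset.card_pos.2 ⟨p.2, hp.2⟩
        · rw [← pow_mul]
          refine pow_le_pow_right₀ one_le_two ?_
          exact (Finset.card_le_card (linkEdges_inter_subset hJQ b t t')).trans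
            (card_linkEdges_le _ _ _ _)
    _ ≤ P.card * ∑ R ∈ Q.powerset with 1 ≤ R.card, (2 ^ J.card * θ) ^ R.card :=
        sum_pow_agree_le hS (by positivity) 1 t
    _ ≤ _ := by
        gcongr
        exact sum_powerset_one_le Q (by positivity) hx

/-- Upper tail for the number of tuples joined to the vertices of `b` in the blocks `J`. -/
theorem pr_link_upper {J Q : Finset (Fin k)} (hJQ : Disjoint J Q) (b : Tup k m)
    {P : Finset (Tup k m)} {θ Λ : ℝ} (hθ : 0 < θ) (hΛ : 0 < Λ) (hS : Spread θ Q P Λ) {q : ℕ}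
    (hx : k * (2 ^ J.card * (q * θ)) ≤ 1 / 2) :
    pr (fun g => 4 * Λ < (2 : ℝ) ^ (J.card * Q.card) *
        ∑ t ∈ P, ind (Present (linkEdges J Q b t)) g) ≤ (1 / 2) ^ q := by
  -- Twice the bound on the expected count; it remains valid after conditioning on at most `q`
  -- linked tuples. Markov's inequality for the `q`-th moment at level `2 * M` gives 2^(-q).
  set M : ℝ := 2 * Λ / 2 ^ (J.card * Q.card) with hM
  have hM0 : 0 < M := by positivity
  have hmom := avg_pow_card_present_le (P := P) (linkEdges J Q b) (q := q) hM0.le ?_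
  · have hmark := pr_le_avg_div (p := fun g => 4 * Λ < (2 : ℝ) ^ (J.card * Q.card) *
        ∑ t ∈ P, ind (Present (linkEdges J Q b t)) g)
      (f := fun g => (∑ t ∈ P, ind (Present (linkEdges J Q b t)) g) ^ q)
      (c := (2 * M) ^ q) (by positivity)
      (fun g => pow_nonneg (Finset.sum_nonneg fun _ _ => ind_nonneg _ _) _) ?_
    · refine hmark.trans ?_
      rw [div_le_iff₀ (by positivity), ← mul_pow]
      refine hmom.trans (le_of_eq ?_)
      congr 1
      ring
    · intro g hg
      refine pow_le_pow_left₀ (by positivity) ?_ q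
      rw [hM, mul_div_assoc', div_le_iff₀ (by positivity)]
      linarith
  intro s hs hsq
  rcases P.eq_empty_or_nonempty with hP | ⟨t0, -⟩
  · rw [hP]; simpa using hM0.le
  -- Given that the tuples of `s` are linked, the edges of `t` at a coordinate are still
  -- unconditioned unless `s` uses the same vertex there. Each seen coordinate saves a factor 2^|J|.
  set seen : Tup k m → Finset (Fin k) := fun t => Q.filter fun i => ∃ t' ∈ s, t i = t' i with hseen
  have hterm : ∀ t ∈ P, (1 / 2 : ℝ) ^ (linkEdges J Q b t \ s.biUnion (linkEdges J Q b)).card ≤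
      (2 ^ J.card) ^ (seen t).card / 2 ^ (J.card * Q.card) := by
    intro t _
    have hsub : linkEdges J (Q \ seen t) b t ⊆
        linkEdges J Q b t \ s.biUnion (linkEdges J Q b) := by
      intro e he
      simp only [linkEdges, Finset.mem_image, Finset.mem_product, Finset.mem_sdiff] at he
      obtain ⟨⟨j, i⟩, hp, rfl⟩ := he
      rw [Finset.mem_sdiff]
      constructor
      · exact Finset.mem_image.2 ⟨(j, i), Finset.mem_product.2 ⟨hp.1, hp.2.1⟩, rfl⟩
      · intro hmem
        simp only [linkEdges, Finset.mem_biUnion, Finset.mem_image, Finset.mem_product] at hmem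
        obtain ⟨t', ht', ⟨j', i'⟩, hp', h⟩ := hmem
        obtain ⟨_, _, h2, h3⟩ := link_slot_inj hJQ hp'.1 hp.2.1 h
        simp only at h2 h3
        refine hp.2.2 (Finset.mem_filter.2 ⟨hp.2.1, t', ht', ?_⟩)
        simp only
        rw [← h3, h2]
    have hcard := Finset.card_le_card hsub
    rw [card_linkEdges (hJQ.mono_right Finset.sdiff_subset),
      Finset.card_sdiff_of_subset (Finset.filter_subset _ _), Nat.mul_sub] at hcard
    have hle : (seen t).card ≤ Q.card := Finset.card_filter_le _ _
    rw [le_div_iff₀ (by positivity), ← pow_mul, one_div, inv_pow, inv_mul_le_iff₀ (by positivity),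
      ← pow_add]
    refine pow_le_pow_right₀ one_le_two ?_
    have h1 := Nat.mul_le_mul_left J.card hle
    have h2 : J.card * Q.card - J.card * (seen t).card ≤
        (linkEdges J Q b t \ s.biUnion (linkEdges J Q b)).card := hcard
    omega
  have hcount : ∀ R ⊆ Q, ((P.filter fun t => R ⊆ seen t).card : ℝ) ≤
      q ^ R.card * (Λ * θ ^ R.card) := by
    intro R hR
    -- A coordinate in `R` has at most `q` seen values, and the values outside `R` do not affect the
    -- cylinder, so they are frozen at `t0`. Conditioning thus amounts to replacing `θ` by `q * θ`.
    set cs : Finset (Tup k m) := Fintype.piFinset fun i =>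
      if i ∈ R then s.image (fun t' => t' i) else {t0 i} with hcs
    have hsub : (P.filter fun t => R ⊆ seen t) ⊆ cs.biUnion fun c => cyl P R c := by
      intro t ht
      rw [Finset.mem_filter] at ht
      refine Finset.mem_biUnion.2 ⟨fun i => if i ∈ R then t i else t0 i, ?_, ?_⟩
      · rw [hcs, Fintype.mem_piFinset]
        intro i
        split_ifs with hi
        · obtain ⟨t', ht', h⟩ := (Finset.mem_filter.1 (ht.2 hi)).2
          exact Finset.mem_image.2 ⟨t', ht', h.symm⟩
        · simp
      · exact mem_cyl.2 ⟨ht.1, fun i hi => by simp [hi]⟩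
    have hcsq : cs.card ≤ q ^ R.card := by
      rw [hcs, Fintype.card_piFinset]
      calc ∏ i, (if i ∈ R then s.image (fun t' => t' i) else {t0 i}).card
          ≤ ∏ i, (if i ∈ R then q else 1) := by
            refine Finset.prod_le_prod' fun i _ => ?_
            split_ifs
            · exact Finset.card_image_le.trans hsq
            · simp
        _ = q ^ R.card := by
            rw [Finset.prod_ite]; simp
    calc ((P.filter fun t => R ⊆ seen t).card : ℝ)
        ≤ ∑ c ∈ cs, ((cyl P R c).card : ℝ) := by
          exact_mod_cast (Finset.card_le_card hsub).trans Finset.card_biUnion_le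
      _ ≤ ∑ c ∈ cs, Λ * θ ^ R.card := Finset.sum_le_sum fun c _ => hS R hR c
      _ = cs.card * (Λ * θ ^ R.card) := by rw [Finset.sum_const, nsmul_eq_mul]
      _ ≤ _ := by
          gcongr
          exact_mod_cast hcsq
  calc ∑ t ∈ P, (1 / 2 : ℝ) ^ (linkEdges J Q b t \ s.biUnion (linkEdges J Q b)).card
      ≤ ∑ t ∈ P, (2 ^ J.card) ^ (seen t).card / 2 ^ (J.card * Q.card) := Finset.sum_le_sum hterm
    _ = (∑ t ∈ P, ((2 : ℝ) ^ J.card) ^ (seen t).card) / 2 ^ (J.card * Q.card) := by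
        rw [Finset.sum_div]
    _ ≤ (∑ t ∈ P, ∑ R ∈ Q.powerset, if R ⊆ seen t then ((2 : ℝ) ^ J.card) ^ R.card else 0) /
          2 ^ (J.card * Q.card) := by
        gcongr with t _
        have hmem : seen t ∈ Q.powerset := Finset.mem_powerset.2 (Finset.filter_subset _ _)
        refine le_trans (le_of_eq ?_) (Finset.single_le_sum (fun R _ => ?_) hmem)
        · rw [if_pos (Finset.Subset.refl _)]
        · split_ifs <;> positivity
    _ = (∑ R ∈ Q.powerset, ((P.filter fun t => R ⊆ seen t).card : ℝ) * (2 ^ J.card) ^ R.card) /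
          2 ^ (J.card * Q.card) := by
        rw [Finset.sum_comm]
        congr 1
        refine Finset.sum_congr rfl fun R _ => ?_
        rw [← Finset.sum_filter, Finset.sum_const, nsmul_eq_mul]
    _ ≤ (∑ R ∈ Q.powerset, q ^ R.card * (Λ * θ ^ R.card) * (2 ^ J.card) ^ R.card) /
          2 ^ (J.card * Q.card) := by
        gcongr with R hR
        exact hcount R (Finset.mem_powerset.1 hR)
    _ = Λ * (1 + 2 ^ J.card * (q * θ)) ^ Q.card / 2 ^ (J.card * Q.card) := by
        rw [← sum_powerset_pow_card, Finset.mul_sum]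
        congr 1
        refine Finset.sum_congr rfl fun R _ => ?_
        rw [mul_pow, mul_pow]
        ring
    _ ≤ Λ * 2 / 2 ^ (J.card * Q.card) := by
        gcongr
        have h0 : 0 ≤ (2 : ℝ) ^ J.card * (q * θ) := by positivity
        refine (one_add_pow_le_exp Q h0).trans ?_
        have h1 : 0 ≤ k * ((2 : ℝ) ^ J.card * (q * θ)) := by positivity
        have h2 := Real.abs_exp_sub_one_sub_id_le
          (x := k * ((2 : ℝ) ^ J.card * (q * θ))) (by rw [abs_of_nonneg h1]; linarith)
        have h3 := (abs_le.1 h2).2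
        nlinarith
    _ = M := by rw [hM]; ring

end Tuples

/-! ### Pieces with good common neighborhoods, and cliques among them -/

section GoodPieces

variable {k m : ℕ}

/-- The restriction of `P` to the common neighborhood of the vertices of `b` in the blocks `J` has
roughly the expected size, and so do its subsets given by fixing coordinates in `Q`, in terms of the
bound `θ` on the spread of `P`. -/
def GoodPiece (g : Slot k m → Bool) (J Q : Finset (Fin k)) (θ : ℝ) (P : Finset (Tup k m))
    (b : Tup k m) : Prop :=
  (P.card : ℝ) < 4 * 2 ^ (J.card * Q.card) * ∑ t ∈ P, ind (Present (linkEdges J Q b t)) g ∧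
  ∀ R ⊆ Q, ∀ c, (2 : ℝ) ^ (J.card * Q.card) *
    ∑ t ∈ cyl P R c, ind (Present (linkEdges J Q b t)) g ≤
      4 * (P.card * (2 ^ J.card * θ) ^ R.card)

theorem cyl_cyl_subset (P : Finset (Tup k m)) (R R' : Finset (Fin k)) (c c' : Tup k m) :
    cyl (cyl P R c) R' c' ⊆ cyl P (R ∪ R') (fun i => if i ∈ R then c i else c' i) := by
  intro t ht
  rw [mem_cyl, mem_cyl] at ht
  refine mem_cyl.2 ⟨ht.1.1, fun i hi => ?_⟩
  by_cases hiR : i ∈ R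
  · simp only [hiR, if_true]; exact ht.1.2 i hiR
  · simp only [hiR, if_false]
    exact ht.2 i ((Finset.mem_union.1 hi).resolve_left hiR)

theorem Spread.fix {θ : ℝ} {Q R : Finset (Fin k)} (hR : R ⊆ Q) {P : Finset (Tup k m)} {K : ℝ}
    (h : Spread θ Q P K) (c : Tup k m) : Spread θ (Q \ R) (cyl P R c) (K * θ ^ R.card) := by
  intro R' hR' c'
  have hd : Disjoint R R' := Finset.disjoint_of_subset_right hR' Finset.disjoint_sdiff
  have h1 := h (R ∪ R') (Finset.union_subset hR (hR'.trans Finset.sdiff_subset))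
    (fun i => if i ∈ R then c i else c' i)
  rw [Finset.card_union_of_disjoint hd, pow_add, ← mul_assoc] at h1
  refine le_trans ?_ h1
  exact_mod_cast Finset.card_le_card (cyl_cyl_subset P R R' c c')

/-- The lower bound fails with the probability from Janson's inequality; the upper bounds are a
union over at most (2m)^k choices of fixed blocks and values. For a cylinder only the links to the
unfixed blocks are counted. Ignoring the others costs 2^(|J||R|), which is why the ratio in
`GoodPiece` carries the factor 2^|J|. -/
theorem pr_not_goodPiece {J Q : Finset (Fin k)} (hJQ : Disjoint J Q) (hk : 0 < k) (b : Tup k m)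
    {P : Finset (Tup k m)} (hP : P.Nonempty) {θ : ℝ} (hθ : 0 < θ) (hS : Spread θ Q P P.card)
    {q : ℕ} (hq : k * (2 ^ J.card * (q * θ)) ≤ 1 / 2) (hx : k * (2 ^ J.card * θ) ≤ 1) :
    pr (fun g => ¬ GoodPiece g J Q θ P b) ≤
      Real.exp (-(1 / (32 * (k * (2 ^ J.card * θ))))) + (2 * m) ^ k * (1 / 2) ^ q := by
  have hPpos : (0 : ℝ) < P.card := by exact_mod_cast hP.card_pos
  set low : (Slot k m → Bool) → Prop := fun g => 4 * (2 : ℝ) ^ (J.card * Q.card) *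
    ∑ t ∈ P, ind (Present (linkEdges J Q b t)) g ≤ P.card
  set up : Finset (Fin k) × Tup k m → (Slot k m → Bool) → Prop := fun x g =>
    4 * (P.card * θ ^ x.1.card) < (2 : ℝ) ^ (J.card * (Q \ x.1).card) *
      ∑ t ∈ cyl P x.1 x.2, ind (Present (linkEdges J (Q \ x.1) b t)) g
  have himp : ∀ g, ¬ GoodPiece g J Q θ P b → low g ∨ ∃ x ∈ Q.powerset ×ˢ Finset.univ, up x g := by
    intro g hg
    by_contra hno
    rw [not_or] at hno
    refine hg ⟨not_le.1 hno.1, fun R hR c => ?_⟩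
    have h1 : ¬ up (R, c) g := fun h => hno.2 ⟨(R, c), by simp [hR], h⟩
    have h2 := not_lt.1 h1
    have h3 : ∑ t ∈ cyl P R c, ind (Present (linkEdges J Q b t)) g ≤
        ∑ t ∈ cyl P R c, ind (Present (linkEdges J (Q \ R) b t)) g := by
      refine Finset.sum_le_sum fun t _ => ind_le_ind (p := Present _) (q := Present _) fun h e he =>
        h e ?_
      exact Finset.image_subset_image
        (Finset.product_subset_product_right Finset.sdiff_subset) he
    have h4 : J.card * Q.card = J.card * R.card + J.card * (Q \ R).card := by
      rw [← Nat.mul_add, Finset.card_sdiff_of_subset hR,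
        Nat.add_sub_cancel' (Finset.card_le_card hR)]
    calc (2 : ℝ) ^ (J.card * Q.card) * ∑ t ∈ cyl P R c, ind (Present (linkEdges J Q b t)) g
        ≤ 2 ^ (J.card * Q.card) *
          ∑ t ∈ cyl P R c, ind (Present (linkEdges J (Q \ R) b t)) g := by gcongr
      _ = 2 ^ (J.card * R.card) * (2 ^ (J.card * (Q \ R).card) *
          ∑ t ∈ cyl P R c, ind (Present (linkEdges J (Q \ R) b t)) g) := by
          rw [h4, pow_add, mul_assoc]
      _ ≤ 2 ^ (J.card * R.card) * (4 * (P.card * θ ^ R.card)) := by gcongr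
      _ = _ := by rw [mul_pow, ← pow_mul]; ring
  have hup : ∀ x ∈ Q.powerset ×ˢ (Finset.univ : Finset (Tup k m)),
      pr (up x) ≤ (1 / 2 : ℝ) ^ q := by
    intro x hx
    have hxQ : x.1 ⊆ Q := Finset.mem_powerset.1 (Finset.mem_product.1 hx).1
    exact pr_link_upper (hJQ.mono_right Finset.sdiff_subset) b hθ (by positivity)
      (hS.fix hxQ x.2) hq
  refine (pr_mono himp).trans ((pr_or_le _ _).trans (add_le_add ?_ ?_))
  · exact pr_link_lower hJQ hk b hP hθ hS hx
  · refine (pr_exists_le_card_mul _ up _ hup).trans ?_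
    gcongr
    rw [Finset.card_product, Finset.card_powerset, mul_pow]
    push_cast
    gcongr
    · norm_num
    · simpa using Finset.card_le_univ Q
    · simp

/-- The slots that meet the vertices of `b` in the blocks `J` and a block in `Q`. -/
def touching (J Q : Finset (Fin k)) (b : Tup k m) : Finset (Slot k m) :=
  (J ×ˢ (Q ×ˢ Finset.univ)).image fun p => s((p.1, b p.1), (p.2.1, p.2.2))

theorem dependsOn_goodPiece (J Q : Finset (Fin k)) (θ : ℝ) (P : Finset (Tup k m)) (b : Tup k m) :
    DependsOn (fun g => GoodPiece g J Q θ P b) (touching J Q b : Set (Slot k m)) := by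
  intro g g' h
  have h1 : ∀ t, ind (Present (linkEdges J Q b t)) g = ind (Present (linkEdges J Q b t)) g' := by
    intro t
    refine dependsOn_ind (dependsOn_present _) fun e he => h e ?_
    simp only [linkEdges, Finset.coe_image, Set.mem_image, Finset.mem_coe,
      Finset.mem_product] at he
    obtain ⟨⟨j, i⟩, hp, rfl⟩ := he
    exact Finset.mem_coe.2 (Finset.mem_image.2 ⟨(j, i, t i), by simp [hp.1, hp.2], rfl⟩)
  simp only [GoodPiece, h1]

/-- Hence the goodness events of tuples that differ in all blocks of `J` depend on disjoint sets of
slots. -/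
theorem exists_eq_of_not_disjoint_touching {J Q : Finset (Fin k)} (hJQ : Disjoint J Q)
    {b b' : Tup k m} (h : ¬ Disjoint (touching J Q b) (touching J Q b')) : ∃ j ∈ J, b' j = b j := by
  rw [Finset.not_disjoint_iff] at h
  obtain ⟨e, he, he'⟩ := h
  simp only [touching, Finset.mem_image, Finset.mem_product] at he he'
  obtain ⟨⟨j, i, v⟩, hp, rfl⟩ := he
  obtain ⟨⟨j', i', v'⟩, hp', h⟩ := he'
  obtain ⟨h1, h2, _, _⟩ := link_slot_inj hJQ hp'.1 hp.2.1 h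
  simp only at h1 h2
  exact ⟨j, hp.1, by rw [← h2, h1]⟩

theorem clique_slot_inj {i i' j j' : Fin k} {u u' v v' : Fin m} (h1 : i < j) (h2 : i' < j')
    (h : s((i, u), (j, v)) = s((i', u'), (j', v'))) : i = i' ∧ u = u' ∧ j = j' ∧ v = v' := by
  rw [Sym2.eq_iff] at h
  simp only [Prod.mk.injEq] at h
  rcases h with h | h
  · exact ⟨h.1.1, h.1.2, h.2.1, h.2.2⟩
  · have := h.1.1; have := h.2.1; omega

theorem card_cliqueEdges (J : Finset (Fin k)) (t : Tup k m) :
    (cliqueEdges J t).card = ((J ×ˢ J).filter fun p => p.1 < p.2).card := by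
  rw [cliqueEdges, Finset.card_image_of_injOn]
  rintro ⟨i, j⟩ hp ⟨i', j'⟩ hp' h
  rw [Finset.mem_coe, Finset.mem_filter] at hp hp'
  obtain ⟨h1, _, h2, _⟩ := clique_slot_inj hp.2 hp'.2 h
  exact Prod.ext h1 h2

theorem cliqueEdges_inter_subset (J : Finset (Fin k)) (t t' : Tup k m) :
    cliqueEdges J t ∩ cliqueEdges J t' ⊆ cliqueEdges (agree J t t') t := by
  intro e he
  simp only [cliqueEdges, Finset.mem_inter, Finset.mem_image, Finset.mem_filter,
    Finset.mem_product] at he ⊢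
  obtain ⟨⟨⟨i, j⟩, hp, rfl⟩, ⟨⟨i', j'⟩, hp', h⟩⟩ := he
  obtain ⟨h1, h2, h3, h4⟩ := clique_slot_inj hp'.2 hp.2 h
  simp only at h1 h2 h3 h4
  refine ⟨(i, j), ⟨⟨Finset.mem_filter.2 ⟨hp.1.1, ?_⟩, Finset.mem_filter.2 ⟨hp.1.2, ?_⟩⟩, hp.2⟩, rfl⟩
  · simp only; rw [← h2, h1]
  · simp only; rw [← h4, h3]

/-- A spread set of tuples contains a clique on the blocks `J`. -/
theorem pr_no_clique_le {J : Finset (Fin k)} (hk : 0 < k) {T : Finset (Tup k m)}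
    (hT : T.Nonempty) {θ K : ℝ} (hθ : 0 < θ) (hK : 0 < K) (hS : Spread θ J T (T.card * K))
    (hx : k * (2 ^ J.card * θ) ≤ 1) :
    pr (fun g => ∀ t ∈ T, ¬ Present (cliqueEdges J t) g) ≤
      Real.exp (-(1 / (16 * (K * (k * (2 ^ J.card * θ)) ^ 2)))) := by
  have hk' : (0 : ℝ) < k := by exact_mod_cast hk
  refine le_trans (pr_mono fun g hg => ?_) (pr_card_present_le hT (cliqueEdges J)
    (fun t _ => card_cliqueEdges J t) (κ := K * (k * (2 ^ J.card * θ)) ^ 2) (by positivity) ?_)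
  · rw [Finset.sum_eq_zero fun t ht => ind_of_false (p := Present (cliqueEdges J t)) (hg t ht)]
    simp
  intro t _
  -- A common edge forces agreement in two blocks, so the sum starts at sets of size two. The number
  -- of common edges is bounded crudely by |J| times the number of agreements.
  calc ∑ t' ∈ T with ¬ Disjoint (cliqueEdges J t) (cliqueEdges J t'),
        (2 : ℝ) ^ (cliqueEdges J t ∩ cliqueEdges J t').card
      ≤ ∑ t' ∈ T with 2 ≤ (agree J t t').card, ((2 : ℝ) ^ J.card) ^ (agree J t t').card := by
        refine (Finset.sum_le_sum_of_subset_of_nonneg ?_ fun _ _ _ => by positivity).trans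
          (Finset.sum_le_sum fun t' _ => ?_)
        · intro t' ht'
          rw [Finset.mem_filter] at ht' ⊢
          refine ⟨ht'.1, ?_⟩
          rw [Finset.not_disjoint_iff] at ht'
          obtain ⟨_, e, he, he'⟩ := ht'
          have := cliqueEdges_inter_subset J t t' (Finset.mem_inter.2 ⟨he, he'⟩)
          simp only [cliqueEdges, Finset.mem_image, Finset.mem_filter, Finset.mem_product] at this
          obtain ⟨p, hp, _⟩ := this
          exact Finset.one_lt_card.2 ⟨p.1, hp.1.1, p.2, hp.1.2, hp.2.ne⟩
        · rw [← pow_mul]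
          refine pow_le_pow_right₀ one_le_two ?_
          refine (Finset.card_le_card (cliqueEdges_inter_subset J t t')).trans ?_
          rw [card_cliqueEdges]
          refine (Finset.card_filter_le _ _).trans ?_
          rw [Finset.card_product]
          exact Nat.mul_le_mul_right _ (Finset.card_filter_le _ _)
    _ ≤ T.card * K * ∑ R ∈ J.powerset with 2 ≤ R.card, (2 ^ J.card * θ) ^ R.card :=
        sum_pow_agree_le hS (by positivity) 2 t
    _ ≤ T.card * K * (k * (2 ^ J.card * θ)) ^ 2 := by
        gcongr
        exact sum_powerset_two_le J (by positivity) hx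
    _ = _ := by ring

/-- Among spread pieces of `T`, given by the values on the blocks `J`, there is one whose vertices in
these blocks form a clique with a good common neighborhood. -/
theorem pr_no_good_clique_le {J Q : Finset (Fin k)} (hJ : J.Nonempty) (hJQ : Disjoint J Q)
    {T : Finset (Tup k m)} (hT : T.Nonempty) {θ θ' K : ℝ} (hθ : 0 < θ) (hK : 0 < K)
    (hS : Spread θ J T (T.card * K)) (hx : k * (2 ^ J.card * θ) ≤ 1) {p : ℝ} (hp0 : 0 ≤ p)
    (hp : ∀ t ∈ T, pr (fun g => ¬ GoodPiece g J Q θ' (cyl T J t) t) ≤ p) {N : ℕ}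
    (hN : 2 * N * (J.card * (K * θ)) ≤ 1) :
    pr (fun g => ¬ ∃ t ∈ T, GoodPiece g J Q θ' (cyl T J t) t ∧ Present (cliqueEdges J t) g) ≤
      (T.card * p) ^ N + Real.exp (-(1 / (32 * (K * (k * (2 ^ J.card * θ)) ^ 2)))) := by
  classical
  have hk : 0 < k := by obtain ⟨j, _⟩ := hJ; exact j.pos
  set bad : Tup k m → (Slot k m → Bool) → Prop := fun t g =>
    ¬ GoodPiece g J Q θ' (cyl T J t) t with hbad
  set ε := Real.exp (-(1 / (32 * (K * (k * (2 ^ J.card * θ)) ^ 2)))) with hε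
  have hε0 : 0 ≤ ε := (Real.exp_pos _).le
  set H : (Slot k m → Bool) → Prop := fun g => (T.card : ℝ) < 2 * ∑ t ∈ T, ind (bad t) g with hH
  have hdepbad : ∀ t, DependsOn (bad t) (touching J Q t : Set (Slot k m)) := fun t g g' h => by
    simp only [hbad, dependsOn_goodPiece J Q θ' (cyl T J t) t h]
  have hHp : pr H ≤ (T.card * p) ^ N := by
    refine pr_half_le bad (touching J Q) (fun t _ => hdepbad t) hp hp0 fun t ht => ?_
    have hsub : (T.filter fun t' => t' = t ∨ ¬ Disjoint (touching J Q t) (touching J Q t')) ⊆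
        J.biUnion fun j => cyl T {j} t := by
      intro t' ht'
      rw [Finset.mem_filter] at ht'
      rw [Finset.mem_biUnion]
      have : ∃ j ∈ J, t' j = t j := by
        rcases ht'.2 with h | h
        · obtain ⟨j, hj⟩ := hJ; exact ⟨j, hj, by rw [h]⟩
        · exact exists_eq_of_not_disjoint_touching hJQ h
      obtain ⟨j, hj, h⟩ := this
      exact ⟨j, hj, mem_cyl.2 ⟨ht'.1, by simpa using h⟩⟩
    have h1 : ((T.filter fun t' => t' = t ∨
        ¬ Disjoint (touching J Q t) (touching J Q t')).card : ℝ) ≤ J.card * (T.card * K * θ) := by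
      calc _ ≤ ∑ j ∈ J, ((cyl T {j} t).card : ℝ) := by
            exact_mod_cast (Finset.card_le_card hsub).trans Finset.card_biUnion_le
        _ ≤ ∑ j ∈ J, T.card * K * θ := by
            refine Finset.sum_le_sum fun j hj => ?_
            simpa using hS {j} (by simpa using hj) t
        _ = _ := by rw [Finset.sum_const, nsmul_eq_mul]
    have h2 : (2 * N * (T.filter fun t' => t' = t ∨
        ¬ Disjoint (touching J Q t) (touching J Q t')).card : ℝ) ≤ T.card := by
      calc _ ≤ 2 * N * (J.card * (T.card * K * θ)) := by gcongr
        _ = (2 * N * (J.card * (K * θ))) * T.card := by ring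
        _ ≤ 1 * T.card := by gcongr
        _ = T.card := one_mul _
    exact_mod_cast h2
  -- Goodness depends only on slots between `J` and `Q`, being a clique only on slots inside `J`. So
  -- one can condition on the exact set of good tuples. If it contains half of `T`, it is spread
  -- with twice the constant, and Janson's inequality applies to it.
  set good : (Slot k m → Bool) → Finset (Tup k m) := fun g => T.filter fun t => ¬ bad t g with hgood
  set none : Finset (Tup k m) → (Slot k m → Bool) → Prop := fun T' g =>
    ∀ t ∈ T', ¬ Present (cliqueEdges J t) g with hnone
  set large := T.powerset.filter fun T' => T.card ≤ 2 * T'.card with hlarge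
  have himp : ∀ g, (¬ ∃ t ∈ T, GoodPiece g J Q θ' (cyl T J t) t ∧ Present (cliqueEdges J t) g) →
      H g ∨ ∃ T' ∈ large, good g = T' ∧ none T' g := by
    intro g hg
    by_cases hHg : H g
    · exact Or.inl hHg
    refine Or.inr ⟨good g, ?_, rfl, ?_⟩
    · rw [hlarge, Finset.mem_filter, Finset.mem_powerset]
      refine ⟨Finset.filter_subset _ _, ?_⟩
      have h1 := not_lt.1 hHg
      have h2 : ∑ t ∈ T, ind (bad t) g = (T.filter fun t => bad t g).card := sum_ind T bad g
      rw [h2] at h1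
      have h3 : 2 * (T.filter fun t => bad t g).card ≤ T.card := by exact_mod_cast h1
      have h4 := Finset.card_filter_add_card_filter_not (s := T) (fun t => bad t g)
      simp only [hgood]
      omega
    · intro t ht hcl
      rw [hgood, Finset.mem_filter] at ht
      exact hg ⟨t, ht.1, not_not.1 ht.2, hcl⟩
  have hind : ∀ T' ∈ large, pr (fun g => good g = T' ∧ none T' g) ≤ ε * pr fun g => good g = T' := by
    intro T' hT'
    rw [hlarge, Finset.mem_filter, Finset.mem_powerset] at hT'
    have hd1 : DependsOn (fun g => good g = T')
        {e | ∃ j ∈ J, ∃ i ∈ Q, ∃ u v, e = s((j, u), (i, v))} := by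
      intro g g' h
      have : good g = good g' := by
        refine Finset.filter_congr fun t _ => ?_
        rw [hdepbad t fun e he => h e ?_]
        simp only [touching, Finset.coe_image, Set.mem_image, Finset.mem_coe,
          Finset.mem_product] at he
        obtain ⟨⟨j, i, v⟩, hp, rfl⟩ := he
        exact ⟨j, hp.1, i, hp.2.1, _, _, rfl⟩
      simp only [this]
    have hd2 : DependsOn (none T') {e | ∃ j ∈ J, ∃ i ∈ J, ∃ u v, e = s((j, u), (i, v))} := by
      intro g g' h
      refine propext (forall₂_congr fun t _ => ?_)
      rw [dependsOn_present (cliqueEdges J t) fun e he => h e ?_]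
      simp only [cliqueEdges, Finset.coe_image, Set.mem_image, Finset.mem_coe,
        Finset.mem_filter, Finset.mem_product] at he
      obtain ⟨⟨i, j⟩, hp, rfl⟩ := he
      exact ⟨i, hp.1.1, j, hp.1.2, _, _, rfl⟩
    have hdisj : Disjoint {e : Slot k m | ∃ j ∈ J, ∃ i ∈ Q, ∃ u v, e = s((j, u), (i, v))}
        {e | ∃ j ∈ J, ∃ i ∈ J, ∃ u v, e = s((j, u), (i, v))} := by
      rw [Set.disjoint_left]
      rintro e ⟨j, hj, i, hi, u, v, rfl⟩ ⟨j', hj', i', hi', u', v', h⟩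
      obtain ⟨_, _, h2, _⟩ := link_slot_inj hJQ hj' hi h.symm
      exact Finset.disjoint_left.1 hJQ (h2 ▸ hi') hi
    rw [pr_and_of_dependsOn hd1 hd2 hdisj, mul_comm]
    refine mul_le_mul_of_nonneg_right ?_ (pr_nonneg _)
    have hne : T'.Nonempty := by
      rw [← Finset.card_pos]
      have := hT.card_pos
      omega
    have hSp : Spread θ J T' (T'.card * (2 * K)) := by
      refine (hS.mono_set hT'.1).mono_const hθ.le ?_
      have : (T.card : ℝ) ≤ 2 * T'.card := by exact_mod_cast hT'.2
      nlinarith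
    refine (pr_no_clique_le hk hne hθ (by positivity) hSp hx).trans (le_of_eq ?_)
    rw [hε]
    congr 3
    ring
  have hsum : ∑ T' ∈ large, pr (fun g => good g = T') ≤ 1 := by
    unfold pr
    rw [← avg_sum]
    refine (avg_mono fun g => ?_).trans_eq (avg_const 1)
    rw [sum_ind large (fun T' g => good g = T') g]
    have : (large.filter fun T' => good g = T').card ≤ 1 :=
      Finset.card_le_one.2 fun a ha b hb => by
        rw [← (Finset.mem_filter.1 ha).2, ← (Finset.mem_filter.1 hb).2]
    exact_mod_cast this
  refine (pr_mono himp).trans ((pr_or_le _ _).trans (add_le_add hHp ?_))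
  refine (pr_exists_le large fun T' g => good g = T' ∧ none T' g).trans ?_
  refine (Finset.sum_le_sum hind).trans ?_
  rw [← Finset.mul_sum]
  exact mul_le_of_le_one_right hε0 hsum

end GoodPieces

/-! ### Restoring spreadness by fixing coordinates -/

section Restoration

variable {k m : ℕ}

theorem Spread.mono_ratio {θ θ' : ℝ} (hθ : 0 ≤ θ) (h : θ ≤ θ') {Q : Finset (Fin k)}
    {P : Finset (Tup k m)} {K : ℝ} (hK : 0 ≤ K) (hS : Spread θ Q P K) : Spread θ' Q P K :=
  fun R hR c => (hS R hR c).trans (mul_le_mul_of_nonneg_left (pow_le_pow_left₀ hθ h _) hK)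

/-- If `P` is not spread, then some maximal way of fixing coordinates gives a spread part. -/
theorem exists_spread_cyl {θ : ℝ} (hθ : 0 < θ) {Q : Finset (Fin k)} {X : Finset (Tup k m)}
    (hX : ¬ Spread θ Q X X.card) :
    ∃ R ⊆ Q, R.Nonempty ∧ ∃ c, (cyl X R c).Nonempty ∧ X.card * θ ^ R.card ≤ (cyl X R c).card ∧
      Spread θ (Q \ R) (cyl X R c) (cyl X R c).card := by
  classical
  -- A violating set of maximal size works: a violation inside its cylinder would combine with it to
  -- a larger one.
  set viol := Q.powerset.filter fun R => ∃ c, (X.card : ℝ) * θ ^ R.card < (cyl X R c).card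
    with hviol
  have hne : viol.Nonempty := by
    unfold Spread at hX
    push Not at hX
    obtain ⟨R, hR, c, h⟩ := hX
    exact ⟨R, Finset.mem_filter.2 ⟨Finset.mem_powerset.2 hR, c, h⟩⟩
  obtain ⟨R, hR, hmax⟩ := Finset.exists_max_image viol Finset.card hne
  rw [hviol, Finset.mem_filter, Finset.mem_powerset] at hR
  obtain ⟨hRQ, c, hc⟩ := hR
  have hRne : R.Nonempty := by
    rw [Finset.nonempty_iff_ne_empty]
    rintro rfl
    rw [cyl_empty] at hc
    simp at hc
  have hPpos : (0 : ℝ) < (cyl X R c).card := lt_of_le_of_lt (by positivity) hc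
  refine ⟨R, hRQ, hRne, c, Finset.card_pos.1 (by exact_mod_cast hPpos), hc.le, ?_⟩
  intro R' hR' c'
  rcases R'.eq_empty_or_nonempty with rfl | hne'
  · simp [cyl_empty]
  by_contra hcon
  push Not at hcon
  have hd : Disjoint R R' := Finset.disjoint_of_subset_right hR' Finset.disjoint_sdiff
  have hU : R ∪ R' ∈ viol := by
    rw [hviol, Finset.mem_filter, Finset.mem_powerset]
    refine ⟨Finset.union_subset hRQ (hR'.trans Finset.sdiff_subset),
      fun i => if i ∈ R then c i else c' i, ?_⟩
    refine lt_of_lt_of_le ?_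
      (Nat.cast_le.2 (Finset.card_le_card (cyl_cyl_subset X R R' c c')))
    refine lt_of_le_of_lt ?_ hcon
    rw [Finset.card_union_of_disjoint hd, pow_add, ← mul_assoc]
    gcongr
  have h1 := hmax _ hU
  rw [Finset.card_union_of_disjoint hd] at h1
  have := hne'.card_pos
  omega

/-- Any set of tuples consists of spread parts, given by fixing coordinates, and of a remainder which
is small or spread. -/
theorem exists_decomposition {θ : ℝ} (hθ : 0 < θ) (Q : Finset (Fin k)) (s : ℝ)
    (X : Finset (Tup k m)) :
    ∃ X₀ ⊆ X, ∃ F : Finset (Fin k) → Finset (Tup k m), (∀ J, F J ⊆ X) ∧ F ∅ = ∅ ∧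
      X.card ≤ X₀.card + ∑ J ∈ Q.powerset, (F J).card ∧
      (∀ J, ∀ t ∈ F J, Spread θ (Q \ J) (cyl (F J) J t) (cyl (F J) J t).card ∧
        s * θ ^ J.card ≤ (cyl (F J) J t).card) ∧
      (X₀.card < s ∨ Spread θ Q X₀ X₀.card) := by
  classical
  induction X using Finset.strongInduction with
  | H X ih =>
    by_cases hend : X.card < s ∨ Spread θ Q X X.card
    · exact ⟨X, Finset.Subset.refl _, fun _ => ∅, by simp, rfl, by simp, by simp, hend⟩
    rw [not_or, not_lt] at hend
    obtain ⟨R, hRQ, hRne, c, hPne, hPbig, hPs⟩ := exists_spread_cyl hθ hend.2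
    set P := cyl X R c with hP
    have hPX : P ⊆ X := cyl_subset _ _ _
    obtain ⟨X₀, hX₀, F, hF, hF0, hcard, hpieces, hX₀s⟩ := ih (X \ P)
      (Finset.sdiff_ssubset hPX hPne)
    have hRmem : R ∈ Q.powerset := Finset.mem_powerset.2 hRQ
    refine ⟨X₀, hX₀.trans Finset.sdiff_subset, Function.update F R (F R ∪ P), ?_, ?_, ?_, ?_, hX₀s⟩
    · intro J
      by_cases hJ : J = R
      · subst hJ
        rw [Function.update_self]
        exact Finset.union_subset ((hF J).trans Finset.sdiff_subset) hPX
      · rw [Function.update_of_ne hJ]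
        exact (hF J).trans Finset.sdiff_subset
    · rw [Function.update_of_ne hRne.ne_empty.symm, hF0]
    · have h1 : ∑ J ∈ Q.powerset, (Function.update F R (F R ∪ P) J).card =
          ∑ J ∈ Q.powerset, (F J).card + P.card := by
        rw [← Finset.add_sum_erase _ _ hRmem, ← Finset.add_sum_erase Q.powerset _ hRmem,
          Function.update_self, Finset.card_union_of_disjoint]
        · rw [Finset.sum_congr rfl fun J hJ => by
            rw [Function.update_of_ne (Finset.ne_of_mem_erase hJ)]]
          ring
        · exact Finset.disjoint_of_subset_left (hF R) Finset.sdiff_disjoint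
      have h2 := Finset.card_sdiff_add_card_eq_card hPX
      rw [h1]
      omega
    · intro J t ht
      by_cases hJ : J = R
      swap
      · rw [Function.update_of_ne hJ] at ht ⊢
        exact hpieces J t ht
      subst hJ
      rw [Function.update_self] at ht ⊢
      -- Pieces fixing the same blocks are stored in one set. They remain recoverable as cylinders,
      -- because the rest of `X` no longer contains tuples with the values `c` on these blocks.
      have hout : ∀ t' ∈ F J, ¬ ∀ i ∈ J, t' i = c i := fun t' ht' h =>
        (Finset.mem_sdiff.1 (hF J ht')).2 (mem_cyl.2 ⟨(Finset.mem_sdiff.1 (hF J ht')).1, h⟩)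
      by_cases htP : t ∈ P
      · have heq : cyl (F J ∪ P) J t = P := by
          ext t'
          rw [mem_cyl, Finset.mem_union]
          have htc := (mem_cyl.1 htP).2
          constructor
          · rintro ⟨h | h, h'⟩
            · exact absurd (fun i hi => (h' i hi).trans (htc i hi)) (hout t' h)
            · exact h
          · exact fun h => ⟨Or.inr h, fun i hi => ((mem_cyl.1 h).2 i hi).trans (htc i hi).symm⟩
        rw [heq]
        refine ⟨hPs, le_trans ?_ hPbig⟩
        gcongr
        exact hend.1
      · have htF : t ∈ F J := (Finset.mem_union.1 ht).resolve_right htP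
        have heq : cyl (F J ∪ P) J t = cyl (F J) J t := by
          ext t'
          rw [mem_cyl, mem_cyl, Finset.mem_union]
          constructor
          · rintro ⟨h | h, h'⟩
            · exact ⟨h, h'⟩
            · exact absurd (fun i hi => (h' i hi).symm.trans ((mem_cyl.1 h).2 i hi)) (hout t htF)
          · exact fun h => ⟨Or.inl h.1, h.2⟩
        rw [heq]
        exact hpieces J t htF

/-- Half of a set of tuples is spread, or many of its members lie in spread parts that are given by
fixing the same coordinates. -/
theorem exists_spread_or_pieces {θ : ℝ} (hθ : 0 < θ) (Q : Finset (Fin k)) {x : ℝ} (hx : 0 < x)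
    {S : Finset (Tup k m)} (hS : S.Nonempty) :
    (∃ X ⊆ S, S.card ≤ 2 * X.card ∧ Spread θ Q X X.card) ∨
    ∃ J ⊆ Q, J.Nonempty ∧ ∃ T ⊆ S, T.Nonempty ∧
      S.card * x ^ J.card ≤ 2 * (1 + x) ^ Q.card * T.card ∧
      ∀ t ∈ T, Spread θ (Q \ J) (cyl T J t) (cyl T J t).card ∧
        S.card * θ ^ J.card ≤ 2 * (cyl T J t).card := by
  obtain ⟨X₀, hX₀, F, hF, hF0, hcard, hpieces, hX₀s⟩ :=
    exists_decomposition hθ Q ((S.card : ℝ) / 2) S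
  have hSpos : (0 : ℝ) < S.card := by exact_mod_cast hS.card_pos
  by_cases hlarge : (X₀.card : ℝ) < S.card / 2
  swap
  · refine Or.inl ⟨X₀, hX₀, ?_, hX₀s.resolve_left hlarge⟩
    have : (S.card : ℝ) ≤ 2 * X₀.card := by linarith
    exact_mod_cast this
  right
  have hsum : (S.card : ℝ) / 2 < ∑ J ∈ Q.powerset, ((F J).card : ℝ) := by
    have : (S.card : ℝ) ≤ X₀.card + ∑ J ∈ Q.powerset, ((F J).card : ℝ) := by exact_mod_cast hcard
    linarith
  -- A pigeonhole argument with weights x^|J|, whose total is (1 + x)^|Q|. Equal weights would lose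
  -- a factor 2^|Q|. With small `x` the loss (1 + x)^|Q| is mild, and x^|J| is affordable for the
  -- few blocks fixed in the application.
  have hex : ∃ J ∈ Q.powerset, (S.card : ℝ) / (2 * (1 + x) ^ Q.card) * x ^ J.card < (F J).card := by
    by_contra hno
    push Not at hno
    have h1 := Finset.sum_le_sum hno
    rw [← Finset.mul_sum, sum_powerset_pow_card] at h1
    have h2 : (S.card : ℝ) / (2 * (1 + x) ^ Q.card) * (1 + x) ^ Q.card = S.card / 2 := by
      have : (1 + x) ^ Q.card ≠ 0 := by positivity
      field_simp
    linarith
  obtain ⟨J, hJ, hJbig⟩ := hex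
  have hpos : (0 : ℝ) < (F J).card := lt_of_le_of_lt (by positivity) hJbig
  have hne : (F J).Nonempty := Finset.card_pos.1 (by exact_mod_cast hpos)
  refine ⟨J, Finset.mem_powerset.1 hJ, ?_, F J, hF J, hne, ?_, fun t ht => ⟨(hpieces J t ht).1, ?_⟩⟩
  · rw [Finset.nonempty_iff_ne_empty]
    rintro rfl
    rw [hF0] at hne
    exact Finset.not_nonempty_empty hne
  · have h1 : (S.card : ℝ) * x ^ J.card =
        2 * (1 + x) ^ Q.card * (S.card / (2 * (1 + x) ^ Q.card) * x ^ J.card) := by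
      have : (1 + x) ^ Q.card ≠ 0 := by positivity
      field_simp
    rw [h1]
    gcongr
  · have := (hpieces J t ht).2
    linarith

end Restoration

/-! ### The invariant of the adversary -/

section States

variable {k m : ℕ}

/-- The tuples that extend the vertices of `a` in the blocks `I` by common neighbors. -/
def extensions (g : Slot k m → Bool) (I : Finset (Fin k)) (a : Tup k m) : Finset (Tup k m) :=
  Fintype.piFinset fun i =>
    if i ∈ I then {a i} else Finset.univ.filter fun v => ∀ j ∈ I, g s((j, a j), (i, v)) = true

theorem mem_extensions {g : Slot k m → Bool} {I : Finset (Fin k)} {a t : Tup k m} :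
    t ∈ extensions g I a ↔ (∀ i ∈ I, t i = a i) ∧
      ∀ i ∉ I, ∀ j ∈ I, g s((j, a j), (i, t i)) = true := by
  rw [extensions, Fintype.mem_piFinset]
  constructor
  · intro h
    refine ⟨fun i hi => ?_, fun i hi => ?_⟩
    · have := h i; simpa [hi] using this
    · have := h i; simpa [hi] using this
  · rintro ⟨h1, h2⟩ i
    by_cases hi : i ∈ I
    · simpa [hi] using h1 i hi
    · simpa [hi] using h2 i hi

/-- The common neighborhoods of few vertices are not much larger than expected. -/
def RegularDegrees (g : Slot k m → Bool) (d : ℕ) : Prop :=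
  ∀ I : Finset (Fin k), I.card ≤ d → ∀ a : Tup k m, ∀ i ∉ I,
    ((Finset.univ.filter fun v => ∀ j ∈ I, g s((j, a j), (i, v)) = true).card : ℝ) ≤
      4 * (m / 2 ^ I.card)

/-- Extensions form a box, and each of its sides that remains free is a common neighborhood of
bounded size. This cap on the density limits how many blocks the adversary ever fixes. -/
theorem card_cyl_extensions_le {g : Slot k m → Bool} {d : ℕ} (hg : RegularDegrees g d)
    {I : Finset (Fin k)} (hI : I.card ≤ d) (a : Tup k m) (J : Finset (Fin k)) (t : Tup k m) :
    ((cyl (extensions g I a) J t).card : ℝ) ≤ (4 * (m / 2 ^ I.card)) ^ ((I ∪ J)ᶜ).card := by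
  have hsub : cyl (extensions g I a) J t ⊆ Fintype.piFinset fun i =>
      if i ∈ I then {a i} else if i ∈ J then {t i} else
        Finset.univ.filter fun v => ∀ j ∈ I, g s((j, a j), (i, v)) = true := by
    intro t' ht'
    rw [mem_cyl, mem_extensions] at ht'
    rw [Fintype.mem_piFinset]
    intro i
    by_cases hi : i ∈ I
    · simpa [hi] using ht'.1.1 i hi
    · by_cases hj : i ∈ J
      · simpa [hi, hj] using ht'.2 i hj
      · simpa [hi, hj] using ht'.1.2 i hi
  have h1 : ((cyl (extensions g I a) J t).card : ℝ) ≤ ∏ i : Fin k,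
      if i ∈ (I ∪ J)ᶜ then 4 * ((m : ℝ) / 2 ^ I.card) else 1 := by
    calc ((cyl (extensions g I a) J t).card : ℝ)
        ≤ ∏ i : Fin k, ((if i ∈ I then {a i} else if i ∈ J then {t i} else
            Finset.univ.filter fun v => ∀ j ∈ I, g s((j, a j), (i, v)) = true :
              Finset (Fin m)).card : ℝ) := by
          have := Finset.card_le_card hsub
          rw [Fintype.card_piFinset] at this
          exact_mod_cast this
      _ ≤ _ := by
          refine Finset.prod_le_prod (fun _ _ => by positivity) fun i _ => ?_
          by_cases hi : i ∈ I
          · simp [hi]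
          · by_cases hj : i ∈ J
            · simp [hi, hj]
            · simpa [hi, hj] using hg I hI a i hi
  refine h1.trans (le_of_eq ?_)
  rw [Finset.prod_ite_mem, Finset.univ_inter, Finset.prod_const]

/-- A family of spread pieces of size at least `σ`, given by the values on the blocks `J`. -/
structure PieceFamily (θ θ' y : ℝ) (J Q : Finset (Fin k)) (σ : ℕ) (T : Finset (Tup k m)) :
    Prop where
  nonempty : T.Nonempty
  spread : Spread θ J T (T.card * y)
  piece_spread : ∀ t ∈ T, Spread θ' Q (cyl T J t) (cyl T J t).card
  le_card : ∀ t ∈ T, σ ≤ (cyl T J t).card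

/-- If `B` contains a family of spread pieces, then it contains a family with a piece given by a
clique with a good common neighborhood. -/
def Selects (g : Slot k m → Bool) (θ θ' y : ℝ) (d : ℕ) (B : Finset (Tup k m)) : Prop :=
  ∀ J Q : Finset (Fin k), J.Nonempty → J.card ≤ d → Disjoint J Q → ∀ σ : ℕ,
    (∃ T ⊆ B, PieceFamily θ θ' y J Q σ T) → ∃ T ⊆ B, ∃ t ∈ T, σ ≤ (cyl T J t).card ∧
      GoodPiece g J Q θ' (cyl T J t) t ∧ Present (cliqueEdges J t) g

/-- After `l` queries, with the set `A` of tuples consistent with the answers: there is a clique `a`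
on the blocks `I` such that the extensions of `a` in `A` contain a large spread set. -/
structure CliqueState (g : Slot k m → Bool) (θ y : ℝ) (d l : ℕ) (I : Finset (Fin k)) (a : Tup k m)
    (S A : Finset (Tup k m)) : Prop where
  nonempty : S.Nonempty
  subset : S ⊆ A
  subset_extensions : S ⊆ extensions g I a
  card_le : I.card ≤ d
  clique : Present (cliqueEdges I a) g
  spread : Spread θ Iᶜ S S.card
  large : y ^ I.card * (m / 2 ^ I.card) ^ (Iᶜ).card ≤ 16 ^ l * S.card

theorem present_cliqueEdges_union {g : Slot k m → Bool} {I J : Finset (Fin k)} {a t : Tup k m}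
    (hI : Present (cliqueEdges I a) g) (hJ : Present (cliqueEdges J t) g)
    (ht : t ∈ extensions g I a) : Present (cliqueEdges (I ∪ J) t) g := by
  rw [mem_extensions] at ht
  have hmem : ∀ {J' : Finset (Fin k)} {a' : Tup k m} {i j}, i ∈ J' → j ∈ J' → i < j →
      s((i, a' i), (j, a' j)) ∈ cliqueEdges J' a' := fun {J' a' i j} hi hj hij =>
    Finset.mem_image.2 ⟨(i, j), by simp [hi, hj, hij], rfl⟩
  intro e he
  simp only [cliqueEdges, Finset.mem_image, Finset.mem_filter, Finset.mem_product,
    Finset.mem_union] at he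
  obtain ⟨⟨i, j⟩, ⟨⟨hi, hj⟩, hij⟩, rfl⟩ := he
  simp only at hi hj hij ⊢
  by_cases hiI : i ∈ I <;> by_cases hjI : j ∈ I
  · rw [ht.1 i hiI, ht.1 j hjI]
    exact hI _ (hmem hiI hjI hij)
  · rw [ht.1 i hiI]
    exact ht.2 j hjI i hiI
  · rw [ht.1 j hjI, Sym2.eq_swap]
    exact ht.2 i hiI j hjI
  · exact hJ _ (hmem (hi.resolve_left hiI) (hj.resolve_left hjI) hij)

/-- One query can be answered such that a state persists. -/
theorem CliqueState.step {g : Slot k m → Bool} {y x : ℝ} {d l h : ℕ} (hm : 0 < m) (hy : 16 ≤ y)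
    (hd : 2 ^ d ≤ y) (hx0 : 0 < x) (hx1 : x ≤ 1) (hyx : 4 * (1 + x) ^ k ≤ y * x ^ d)
    (hyd : 4 ^ (k + 1) * 16 ^ h < y ^ (d + 1)) (hl : l ≤ h) (hreg : RegularDegrees g d)
    {I : Finset (Fin k)} {a : Tup k m} {S A A' S' : Finset (Tup k m)}
    (hst : CliqueState g (y ^ 4 / m) y d l I a S A)
    (hsel : Selects g (y ^ 4 / m) (y ^ 2 / m) y d (extensions g I a ∩ A'))
    (hS' : S' ⊆ S) (hS'A : S' ⊆ A') (hhalf : S.card ≤ 2 * S'.card) :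
    ∃ I' a' S'', CliqueState g (y ^ 4 / m) y d (l + 1) I' a' S'' A' := by
  have hm' : (0 : ℝ) < m := by exact_mod_cast hm
  have hy0 : 0 < y := by linarith
  -- Pieces are made spread with the smaller ratio `θ'`, since restricting to a common neighborhood
  -- worsens the ratio by up to 16 * 2^|J| ≤ y^2.
  set θ : ℝ := y ^ 4 / m with hθdef
  set θ' : ℝ := y ^ 2 / m with hθ'def
  have hθ : 0 < θ := by positivity
  have hθ' : 0 < θ' := by positivity
  have hθθ' : θ' ≤ θ := by
    rw [hθdef, hθ'def]
    gcongr
    · linarith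
    · norm_num
  have hhalf' : (S.card : ℝ) ≤ 2 * S'.card := by exact_mod_cast hhalf
  have hS'ne : S'.Nonempty := by
    rw [← Finset.card_pos]
    have := hst.nonempty.card_pos
    omega
  have hS'sp : Spread θ Iᶜ S' (2 * S'.card) := (hst.spread.mono_set hS').mono_const hθ.le hhalf'
  rcases exists_spread_or_pieces hθ' Iᶜ hx0 hS'ne with ⟨X, hX, hXcard, hXsp⟩ |
    ⟨J, hJI, hJ, T, hTS', hTne, hTbig, hTp⟩
  · have hXcard' : (S'.card : ℝ) ≤ 2 * X.card := by exact_mod_cast hXcard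
    refine ⟨I, a, X, ?_, hX.trans hS'A, (hX.trans hS').trans hst.subset_extensions, hst.card_le,
      hst.clique, hXsp.mono_ratio hθ'.le hθθ' (Nat.cast_nonneg _), ?_⟩
    · rw [← Finset.card_pos]
      have := hS'ne.card_pos
      omega
    · refine hst.large.trans ?_
      rw [pow_succ, mul_assoc]
      gcongr
      have : (0 : ℝ) ≤ X.card := Nat.cast_nonneg _
      linarith
  have hIJ : Disjoint I J := Finset.disjoint_of_subset_right hJI disjoint_compl_right
  set Q := (I ∪ J)ᶜ with hQ
  have hQ' : Iᶜ \ J = Q := by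
    ext i; simp [hQ]
  have hcardIJ : (I ∪ J).card = I.card + J.card := Finset.card_union_of_disjoint hIJ
  have hcardQ : (Iᶜ).card = Q.card + J.card := by
    rw [← hQ', Finset.card_sdiff_of_subset hJI]
    have := Finset.card_le_card hJI
    omega
  have h2I : (2 : ℝ) ^ I.card ≤ y := (pow_le_pow_right₀ one_le_two hst.card_le).trans hd
  have hM : (0 : ℝ) < m / 2 ^ I.card := by positivity
  -- Fixing a block reduces the expected number of extensions by the factor m/2^|I|, but a piece
  -- retains a fraction of order `θ'` per block. The product of the two is y^2/2^|I| ≥ y: this is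
  -- the gain per fixed block.
  have hgain : y ^ J.card ≤ ((m / 2 ^ I.card) * θ') ^ J.card := by
    refine pow_le_pow_left₀ hy0.le ?_ _
    rw [hθ'def, div_mul_div_comm, mul_comm (m : ℝ), mul_div_mul_right _ _ hm'.ne',
      le_div_iff₀ (by positivity), pow_two]
    gcongr
  have hlow : y ^ (I.card + J.card) * (m / 2 ^ I.card) ^ Q.card ≤
      2 * 16 ^ l * (S'.card * θ' ^ J.card) := by
    have h1 := hst.large.trans (mul_le_mul_of_nonneg_left hhalf' (by positivity : (0:ℝ) ≤ 16 ^ l))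
    have h2 := mul_le_mul_of_nonneg_right h1 (by positivity : (0 : ℝ) ≤ θ' ^ J.card)
    calc y ^ (I.card + J.card) * (m / 2 ^ I.card) ^ Q.card
        = y ^ I.card * (m / 2 ^ I.card) ^ Q.card * y ^ J.card := by rw [pow_add]; ring
      _ ≤ y ^ I.card * (m / 2 ^ I.card) ^ Q.card * ((m / 2 ^ I.card) * θ') ^ J.card := by gcongr
      _ = y ^ I.card * (m / 2 ^ I.card) ^ (Iᶜ).card * θ' ^ J.card := by
          rw [hcardQ, pow_add, mul_pow]; ring
      _ ≤ _ := h2.trans (le_of_eq (by ring))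
  have hText : T ⊆ extensions g I a := (hTS'.trans hS').trans hst.subset_extensions
  -- Comparing the gained density with the cap gives y^(|I|+|J|) ≤ 4^(k+1) 16^h, which `hyd` turns
  -- into a bound on the number of blocks.
  have hcardle : I.card + J.card ≤ d := by
    obtain ⟨t, ht⟩ := hTne
    have h1 : ((cyl T J t).card : ℝ) ≤ (4 * (m / 2 ^ I.card)) ^ Q.card :=
      le_trans (by exact_mod_cast Finset.card_le_card (Finset.filter_subset_filter _ hText))
        (card_cyl_extensions_le hreg hst.card_le a J t)
    have h2 := (hTp t ht).2
    have h3 : y ^ (I.card + J.card) * (m / 2 ^ I.card) ^ Q.card ≤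
        4 ^ (k + 1) * 16 ^ h * (m / 2 ^ I.card) ^ Q.card := by
      calc y ^ (I.card + J.card) * (m / 2 ^ I.card) ^ Q.card
          ≤ 2 * 16 ^ l * (2 * (4 * (m / 2 ^ I.card)) ^ Q.card) := by
            refine hlow.trans (mul_le_mul_of_nonneg_left ?_ (by positivity))
            linarith
        _ = 4 ^ (Q.card + 1) * 16 ^ l * (m / 2 ^ I.card) ^ Q.card := by
            rw [mul_pow, pow_succ]; ring
        _ ≤ _ := by
            gcongr
            · norm_num
            · simpa using Finset.card_le_univ Q
            · norm_num
    have h4 := (le_of_mul_le_mul_right h3 (by positivity)).trans_lt hyd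
    have h5 := (pow_lt_pow_iff_right₀ (by linarith : 1 < y)).1 h4
    omega
  have hJd : J.card ≤ d := by omega
  -- The size guaranteed for every piece of `T` is handed over as the number σ, because the piece
  -- found below may belong to another family. Passing from `S'` to `T` costs the spread constant
  -- `y` by `hyx`.
  have hfam : PieceFamily θ θ' y J Q ⌈S'.card * θ' ^ J.card / 2⌉₊ T := by
    refine ⟨hTne, fun R hR c => ?_, fun t ht => hQ' ▸ (hTp t ht).1, fun t ht => ?_⟩
    · have h1 := (hS'sp.mono_set hTS') R (hR.trans hJI) c
      refine h1.trans (mul_le_mul_of_nonneg_right ?_ (by positivity))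
      have h2 : 4 * (1 + x) ^ (Iᶜ).card ≤ y * x ^ J.card := by
        calc 4 * (1 + x) ^ (Iᶜ).card ≤ 4 * (1 + x) ^ k := by
              gcongr
              · linarith
              · simpa using Finset.card_le_univ Iᶜ
          _ ≤ y * x ^ d := hyx
          _ ≤ _ := by
              refine mul_le_mul_of_nonneg_left ?_ hy0.le
              exact pow_le_pow_of_le_one hx0.le hx1 hJd
      have hTc : (0 : ℝ) ≤ T.card := Nat.cast_nonneg _
      have h3 := mul_le_mul_of_nonneg_right h2 hTc
      have h4 : (2 * S'.card : ℝ) * x ^ J.card ≤ (T.card * y) * x ^ J.card := by linarith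
      exact le_of_mul_le_mul_right h4 (by positivity)
    · refine Nat.ceil_le.2 ?_
      have := (hTp t ht).2
      linarith
  have hJQ : Disjoint J Q := by
    rw [← hQ']; exact Finset.disjoint_sdiff
  -- `T₂` need not be `T` nor lie in `S`. The new state only needs it to consist of extensions of
  -- `a` consistent with the answers, with a piece as large as those of `T`.
  obtain ⟨T₂, hT₂, t, ht, hσ, hgood, hcl⟩ := hsel J Q hJ hJd hJQ _
    ⟨T, Finset.subset_inter hText (hTS'.trans hS'A), hfam⟩
  set P := cyl T₂ J t with hP
  have htP : t ∈ P := mem_cyl.2 ⟨ht, fun _ _ => rfl⟩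
  have hσ' : S'.card * θ' ^ J.card ≤ 2 * P.card := by
    have := Nat.ceil_le.1 hσ
    linarith
  classical
  set S'' := P.filter fun t' => Present (linkEdges J Q t t') g with hS''
  have hcyl : ∀ R c, ∑ t' ∈ cyl P R c, ind (Present (linkEdges J Q t t')) g =
      (cyl S'' R c).card := by
    intro R c
    rw [sum_ind _ (fun t' => Present (linkEdges J Q t t')) g, hS'', cyl, cyl,
      Finset.filter_filter, Finset.filter_filter]
    simp only [and_comm]
  have hcyl0 : ∑ t' ∈ P, ind (Present (linkEdges J Q t t')) g = S''.card := by
    have := hcyl ∅ t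
    rwa [cyl_empty, cyl_empty] at this
  have hbig : (P.card : ℝ) < 4 * 2 ^ (J.card * Q.card) * S''.card := by
    rw [← hcyl0]; exact hgood.1
  have hPB : P ⊆ extensions g I a ∩ A' := (cyl_subset _ _ _).trans hT₂
  have hS''P : S'' ⊆ P := Finset.filter_subset _ _
  have hS''ext : S'' ⊆ extensions g (I ∪ J) t := by
    intro t' ht'
    rw [hS'', Finset.mem_filter] at ht'
    have h1 := mem_extensions.1 (Finset.mem_inter.1 (hPB ht'.1)).1
    have h2 := mem_extensions.1 (Finset.mem_inter.1 (hPB htP)).1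
    have h3 := (mem_cyl.1 ht'.1).2
    rw [mem_extensions]
    refine ⟨fun i hi => ?_, fun i hi j hj => ?_⟩
    · rcases Finset.mem_union.1 hi with hi | hi
      · rw [h1.1 i hi, h2.1 i hi]
      · exact h3 i hi
    · rcases Finset.mem_union.1 hj with hj | hj
      · rw [h2.1 j hj]
        exact h1.2 i (fun h => hi (Finset.mem_union_left _ h)) j hj
      · exact ht'.2 _ (Finset.mem_image.2 ⟨(j, i), Finset.mem_product.2
          ⟨hj, Finset.mem_compl.2 hi⟩, rfl⟩)
  refine ⟨I ∪ J, t, S'', ?_, ?_, hS''ext, hcardIJ ▸ hcardle, ?_, ?_, ?_⟩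
  · rw [← Finset.card_pos]
    by_contra h0
    have h0' : S''.card = 0 := by omega
    rw [h0'] at hbig
    simp at hbig
    exact absurd (Nat.cast_nonneg (α := ℝ) P.card) (not_le.2 hbig)
  · exact hS''P.trans (hPB.trans Finset.inter_subset_right)
  · exact present_cliqueEdges_union hst.clique hcl (Finset.mem_inter.1 (hPB htP)).1
  · intro R hR c
    rcases R.eq_empty_or_nonempty with rfl | hRne
    · simp [cyl_empty]
    have h1 := hgood.2 R hR c
    rw [hcyl] at h1
    -- The 16 combines the factor 4 of both bounds in `GoodPiece`. For nonempty `R` it is absorbed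
    -- into the base, and 16 * 2^|J| * θ' ≤ y^2 * θ' = θ.
    have hratio : 16 * (2 ^ J.card * θ') ^ R.card ≤ θ ^ R.card := by
      calc 16 * (2 ^ J.card * θ') ^ R.card ≤ 16 ^ R.card * (2 ^ J.card * θ') ^ R.card := by
            gcongr
            exact le_self_pow₀ (by norm_num) hRne.card_pos.ne'
        _ = (16 * (2 ^ J.card * θ')) ^ R.card := (mul_pow _ _ _).symm
        _ ≤ θ ^ R.card := by
            refine pow_le_pow_left₀ (by positivity) ?_ _
            have h2J : (2 : ℝ) ^ J.card ≤ y := (pow_le_pow_right₀ one_le_two hJd).trans hd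
            calc 16 * (2 ^ J.card * θ') ≤ y * (y * θ') := by gcongr
              _ = θ := by rw [hθdef, hθ'def]; ring
    have h2 : (2 : ℝ) ^ (J.card * Q.card) * (cyl S'' R c).card ≤
        2 ^ (J.card * Q.card) * (S''.card * θ ^ R.card) := by
      calc (2 : ℝ) ^ (J.card * Q.card) * (cyl S'' R c).card
          ≤ 4 * (P.card * (2 ^ J.card * θ') ^ R.card) := h1
        _ ≤ 4 * ((4 * 2 ^ (J.card * Q.card) * S''.card) * (2 ^ J.card * θ') ^ R.card) := by
            gcongr
        _ = 2 ^ (J.card * Q.card) * (S''.card * (16 * (2 ^ J.card * θ') ^ R.card)) := by ring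
        _ ≤ _ := by gcongr
    exact le_of_mul_le_mul_left h2 (by positivity)
  · rw [hcardIJ]
    -- The factor 16 lost per query is 2 for the majority, 2 for the size of a piece and 4 for its
    -- restriction to the common neighborhood.
    have h1 : y ^ (I.card + J.card) * (m / 2 ^ I.card) ^ Q.card ≤
        16 ^ (l + 1) * S''.card * 2 ^ (J.card * Q.card) := by
      calc y ^ (I.card + J.card) * (m / 2 ^ I.card) ^ Q.card
          ≤ 2 * 16 ^ l * (2 * (4 * 2 ^ (J.card * Q.card) * S''.card)) := by
            refine hlow.trans (mul_le_mul_of_nonneg_left ?_ (by positivity))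
            linarith
        _ = _ := by rw [pow_succ]; ring
    have h2 : ((m : ℝ) / 2 ^ I.card) ^ Q.card =
        (m / 2 ^ (I.card + J.card)) ^ Q.card * 2 ^ (J.card * Q.card) := by
      rw [pow_mul, ← mul_pow]
      congr 1
      rw [pow_add]
      field_simp
    rw [h2, ← mul_assoc] at h1
    exact le_of_mul_le_mul_right h1 (by positivity)

end States

/-! ## Binary trees of queries -/

/-- A binary tree of Boolean functions; a stub stands for a subtree that has been removed. -/
inductive QueryTree (X : Type) : Type
  | stub : QueryTree X
  | leaf (f : X → Bool) : QueryTree X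
  | node (f : X → Bool) (l r : QueryTree X) : QueryTree X

namespace QueryTree

variable {X : Type}

/-- The number of labels. -/
def size : QueryTree X → ℕ
  | stub => 0
  | leaf _ => 1
  | node _ l r => l.size + r.size + 1

/-- The label of the root holds at `t`. -/
def Holds : QueryTree X → X → Prop
  | stub, _ => False
  | leaf f, t => f t = true
  | node f _ _, t => f t = true

/-- On the set `A`, the label of an inner node is covered by the labels of its children, all labels
belong to `Q`, and the labels of the leaves satisfy `ax`. -/
def Valid (Q : Finset (X → Bool)) (ax : (X → Bool) → Prop) (A : Finset X) : QueryTree X → Prop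
  | stub => True
  | leaf f => f ∈ Q ∧ ax f
  | node f l r => f ∈ Q ∧ (∀ t ∈ A, f t = true → l.Holds t ∨ r.Holds t) ∧
      Valid Q ax A l ∧ Valid Q ax A r

variable {Q : Finset (X → Bool)} {ax : (X → Bool) → Prop} {A A' : Finset X}

theorem Valid.mono (hA : A' ⊆ A) : ∀ {τ : QueryTree X}, τ.Valid Q ax A → τ.Valid Q ax A'
  | stub, _ => trivial
  | leaf _, h => h
  | node _ _ _, h => ⟨h.1, fun t ht => h.2.1 t (hA ht), h.2.2.1.mono hA, h.2.2.2.mono hA⟩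

theorem Valid.exists_label {τ : QueryTree X} (h : τ.Valid Q ax A) (hs : 0 < τ.size) :
    ∃ f ∈ Q, ∀ t, τ.Holds t ↔ f t = true := by
  cases τ with
  | stub => simp [size] at hs
  | leaf f => exact ⟨f, h.1, fun t => Iff.rfl⟩
  | node f l r => exact ⟨f, h.1, fun t => Iff.rfl⟩

/-- A tree can be split into a subtree and its complement, such that both are significantly
smaller. -/
theorem exists_split (n : ℕ) (hn : 2 ≤ n) : ∀ τ : QueryTree X, τ.Valid Q ax A → n < 2 * τ.size →
    ∃ f ∈ Q, ∃ c τ' : QueryTree X, c.size + τ'.size = τ.size ∧ 2 * c.size ≤ n ∧ n ≤ 8 * c.size ∧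
      (∀ t, c.Holds t ↔ f t = true) ∧ (∀ t, τ'.Holds t ↔ τ.Holds t) ∧ c.Valid Q ax A ∧
      ∀ A' ⊆ A, (∀ t ∈ A', f t = false) → τ'.Valid Q ax A'
  | stub, _, h => by simp [size] at h
  | leaf _, _, h => by simp [size] at h; omega
  | node f l r, hv, h => by
    obtain ⟨hf, hcov, hl, hr⟩ := hv
    simp only [size] at h ⊢
    -- The threshold `n` stays fixed during the descent, which follows a child of more than n/2
    -- labels as long as there is one.
    by_cases h1 : n < 2 * l.size
    · obtain ⟨f', hf', c, τ', hsz, h2, h3, hc, hτ', hcv, hval⟩ := exists_split n hn l hl h1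
      refine ⟨f', hf', c, node f τ' r, by simp only [size]; omega, h2, h3, hc, fun t => Iff.rfl, hcv,
        fun A' hA' hfalse => ⟨hf, fun t ht hft => ?_, hval A' hA' hfalse, hr.mono hA'⟩⟩
      rw [hτ' t]
      exact hcov t (hA' ht) hft
    by_cases h2 : n < 2 * r.size
    · obtain ⟨f', hf', c, τ', hsz, h2, h3, hc, hτ', hcv, hval⟩ := exists_split n hn r hr h2
      refine ⟨f', hf', c, node f l τ', by simp only [size]; omega, h2, h3, hc, fun t => Iff.rfl, hcv,
        fun A' hA' hfalse => ⟨hf, fun t ht hft => ?_, hl.mono hA', hval A' hA' hfalse⟩⟩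
      rw [hτ' t]
      exact hcov t (hA' ht) hft
    rcases le_total r.size l.size with hle | hle
    · obtain ⟨f', hf', hlab⟩ := hl.exists_label (by omega)
      refine ⟨f', hf', l, node f stub r, by simp only [size]; omega, by omega, by omega, hlab,
        fun t => Iff.rfl, hl, fun A' hA' hfalse => ⟨hf, fun t ht hft => ?_, trivial, hr.mono hA'⟩⟩
      refine Or.inr ((hcov t (hA' ht) hft).resolve_left fun hh => ?_)
      rw [hlab, hfalse t ht] at hh
      exact Bool.false_ne_true hh
    · obtain ⟨f', hf', hlab⟩ := hr.exists_label (by omega)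
      refine ⟨f', hf', r, node f l stub, by simp only [size]; omega, by omega, by omega, hlab,
        fun t => Iff.rfl, hr, fun A' hA' hfalse => ⟨hf, fun t ht hft => ?_, hl.mono hA', trivial⟩⟩
      refine Or.inl ((hcov t (hA' ht) hft).resolve_right fun hh => ?_)
      rw [hlab, hfalse t ht] at hh
      exact Bool.false_ne_true hh

end QueryTree

/-! ### The adversary argument against query trees -/

section Game

variable {k m : ℕ}

/-- The sets of tuples that are given by the answers to `l` queries from `Q`. -/
def answerSets (Q : Finset (Tup k m → Bool)) : ℕ → Finset (Finset (Tup k m))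
  | 0 => {Finset.univ}
  | l + 1 => (Q ×ˢ (Finset.univ ×ˢ answerSets Q l)).image fun p =>
      p.2.2.filter fun t => p.1 t = p.2.1

theorem filter_mem_answerSets {Q : Finset (Tup k m → Bool)} {l : ℕ} {A : Finset (Tup k m)}
    (hA : A ∈ answerSets Q l) {f : Tup k m → Bool} (hf : f ∈ Q) (b : Bool) :
    A.filter (fun t => f t = b) ∈ answerSets Q (l + 1) :=
  Finset.mem_image.2 ⟨(f, b, A), by simp [hf, hA], rfl⟩

theorem card_answerSets_le (Q : Finset (Tup k m → Bool)) (l : ℕ) :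
    (answerSets Q l).card ≤ (2 * Q.card) ^ l := by
  induction l with
  | zero => simp [answerSets]
  | succ l ih =>
    refine Finset.card_image_le.trans ?_
    rw [Finset.card_product, Finset.card_product, Finset.card_univ, Fintype.card_bool, pow_succ']
    calc Q.card * (2 * (answerSets Q l).card) ≤ Q.card * (2 * (2 * Q.card) ^ l) := by gcongr
      _ = _ := by ring

/-- Two distinct vertices that are not joined by an edge. -/
def NonEdge (g : Slot k m → Bool) (u v : BlockVertex k m) : Prop :=
  u ≠ v ∧ ¬ (u.1 ≠ v.1 ∧ g s(u, v) = true)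

/-- The function `f` only holds at tuples with a certain non-edge. -/
def IsNonEdgeTest (g : Slot k m → Bool) (f : Tup k m → Bool) : Prop :=
  ∃ u v, NonEdge g u v ∧ ∀ t, f t = true → t u.1 = u.2 ∧ t v.1 = v.2

/-- A vertex common to all tuples of `S` lies in a block of `I`: otherwise fixing it would not
shrink `S`, contrary to spreadness with ratio below 1. On `I` all tuples carry the clique `a`. -/
theorem CliqueState.not_nonEdge {g : Slot k m → Bool} {θ y : ℝ} {d l : ℕ} (hθ : θ < 1)
    {I : Finset (Fin k)} {a : Tup k m} {S A : Finset (Tup k m)} (hst : CliqueState g θ y d l I a S A)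
    {u v : BlockVertex k m} (huv : NonEdge g u v) : ¬ ∀ t ∈ S, t u.1 = u.2 ∧ t v.1 = v.2 := by
  intro h
  have hSpos : (0 : ℝ) < S.card := by exact_mod_cast hst.nonempty.card_pos
  obtain ⟨t, ht⟩ := hst.nonempty
  have hta := (mem_extensions.1 (hst.subset_extensions ht)).1
  have hmem : ∀ w : BlockVertex k m, (∀ t ∈ S, t w.1 = w.2) → w.1 ∈ I := by
    intro w hw
    by_contra hwI
    have h1 := hst.spread {w.1} (by simpa using hwI) t
    have h2 : cyl S {w.1} t = S := by
      ext t'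
      rw [mem_cyl]
      refine ⟨fun h => h.1, fun h => ⟨h, fun i hi => ?_⟩⟩
      rw [Finset.mem_singleton.1 hi, hw t' h, hw t ht]
    rw [h2, Finset.card_singleton, pow_one] at h1
    nlinarith
  have hu := hmem u fun t ht => (h t ht).1
  have hv := hmem v fun t ht => (h t ht).2
  have hau : a u.1 = u.2 := by rw [← hta _ hu]; exact (h t ht).1
  have hav : a v.1 = v.2 := by rw [← hta _ hv]; exact (h t ht).2
  have hne : u.1 ≠ v.1 := by
    intro heq
    refine huv.1 (Prod.ext heq ?_)
    rw [← hau, ← hav, heq]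
  refine huv.2 ⟨hne, ?_⟩
  have hcl : ∀ {i j}, i ∈ I → j ∈ I → i < j → g s((i, a i), (j, a j)) = true := fun {i j} hi hj hij =>
    hst.clique _ (Finset.mem_image.2 ⟨(i, j), by simp [hi, hj, hij], rfl⟩)
  have hu' : u = (u.1, a u.1) := Prod.ext rfl hau.symm
  have hv' : v = (v.1, a v.1) := Prod.ext rfl hav.symm
  rw [hu', hv']
  rcases lt_or_gt_of_ne hne with hlt | hlt
  · exact hcl hu hv hlt
  · rw [Sym2.eq_swap]; exact hcl hv hu hlt

/-- There is no small valid query tree if all extension sets select. -/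
theorem no_valid_tree {g : Slot k m → Bool} {y x : ℝ} {d h : ℕ} (hm : 0 < m) (hy : 16 ≤ y)
    (hym : y ^ 4 < m) (hd : 2 ^ d ≤ y) (hx0 : 0 < x) (hx1 : x ≤ 1)
    (hyx : 4 * (1 + x) ^ k ≤ y * x ^ d) (hyd : 4 ^ (k + 1) * 16 ^ h < y ^ (d + 1))
    (hreg : RegularDegrees g d) {Q : Finset (Tup k m → Bool)}
    (hsel : ∀ l ≤ h, ∀ A ∈ answerSets Q l, ∀ I a,
      Selects g (y ^ 4 / m) (y ^ 2 / m) y d (extensions g I a ∩ A)) :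
    ∀ r l : ℕ, l + r ≤ h → ∀ (τ : QueryTree (Tup k m)) (A S : Finset (Tup k m)) (I : Finset (Fin k))
      (a : Tup k m), (τ.size : ℝ) ≤ (8 / 7) ^ r → A ∈ answerSets Q l →
      CliqueState g (y ^ 4 / m) y d l I a S A → τ.Valid Q (IsNonEdgeTest g) A →
      (∀ t ∈ A, τ.Holds t) → False := by
  have hm' : (0 : ℝ) < m := by exact_mod_cast hm
  have hθ1 : y ^ 4 / m < 1 := (div_lt_one hm').2 hym
  intro r
  induction r with
  | zero =>
    intro l hl τ A S I a hsize hA hst hval hhold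
    have hsize' : τ.size ≤ 1 := by
      rw [pow_zero] at hsize; exact_mod_cast hsize
    obtain ⟨t, ht⟩ := hst.nonempty
    cases τ with
    | stub => exact hhold t (hst.subset ht)
    | leaf f =>
      obtain ⟨u, v, huv, hf⟩ := hval.2
      exact hst.not_nonEdge hθ1 huv fun t ht => hf t (hhold t (hst.subset ht))
    | node f τ₁ τ₂ =>
      simp only [QueryTree.size] at hsize'
      rcases hval.2.1 t (hst.subset ht) (hhold t (hst.subset ht)) with h | h
      · cases τ₁ with
        | stub => exact h
        | leaf f => simp [QueryTree.size] at hsize'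
        | node f l r => simp [QueryTree.size] at hsize'
      · cases τ₂ with
        | stub => exact h
        | leaf f => simp [QueryTree.size] at hsize'
        | node f l r => simp [QueryTree.size] at hsize'
  | succ r ih =>
    intro l hl τ A S I a hsize hA hst hval hhold
    classical
    -- A tree too small to split is kept: its root label, which holds on `A`, is queried again. Only
    -- the counter advances, so exactly `h` rounds may be assumed.
    by_cases hsmall : τ.size ≤ 1
    · obtain ⟨f, hf, hτf⟩ := hval.exists_label (by
        by_contra h0
        obtain ⟨t, ht⟩ := hst.nonempty
        have := hhold t (hst.subset ht)
        cases τ with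
        | stub => exact this
        | leaf f => simp [QueryTree.size] at h0
        | node f l r => simp [QueryTree.size] at h0)
      have hAf : A.filter (fun t => f t = true) = A :=
        Finset.filter_true_of_mem fun t ht => (hτf t).1 (hhold t ht)
      have hA' := filter_mem_answerSets hA hf true
      rw [hAf] at hA'
      refine ih (l + 1) (by omega) τ A S I a ?_ hA' ?_ hval hhold
      · exact (Nat.cast_le_one.2 hsmall).trans (one_le_pow₀ (by norm_num))
      · refine ⟨hst.nonempty, hst.subset, hst.subset_extensions, hst.card_le, hst.clique,
          hst.spread, hst.large.trans ?_⟩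
        gcongr
        · norm_num
        · omega
    obtain ⟨f, hf, c, τ', hsz, hc1, hc2, hcf, hτ', hcv, hval'⟩ :=
      QueryTree.exists_split τ.size (by omega) τ hval (by omega)
    have hsz' : (c.size : ℝ) + τ'.size = τ.size := by exact_mod_cast hsz
    have hc1' : 2 * (c.size : ℝ) ≤ τ.size := by exact_mod_cast hc1
    have hc2' : (τ.size : ℝ) ≤ 8 * c.size := by exact_mod_cast hc2
    have hτ0 : (0 : ℝ) ≤ τ.size := Nat.cast_nonneg _
    rw [pow_succ] at hsize
    -- The answer true leaves at most half of the labels, the answer false removes at least an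
    -- eighth.
    have hbound : (τ.size : ℝ) * (7 / 8) ≤ (8 / 7) ^ r := by linarith
    have hA' : ∀ b, A.filter (fun t => f t = b) ∈ answerSets Q (l + 1) := filter_mem_answerSets hA hf
    have hstep : ∀ b, S.card ≤ 2 * (S.filter fun t => f t = b).card →
        ∃ I' a' S'', CliqueState g (y ^ 4 / m) y d (l + 1) I' a' S'' (A.filter fun t => f t = b) :=
      fun b hb => hst.step hm hy hd hx0 hx1 hyx hyd (by omega) hreg
        (hsel (l + 1) (by omega) _ (hA' b) I a) (Finset.filter_subset _ _)
        (Finset.filter_subset_filter _ hst.subset) hb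
    have hsplit : (S.filter fun t => f t = true).card + (S.filter fun t => f t = false).card =
        S.card := by
      have := Finset.card_filter_add_card_filter_not (s := S) (fun t => f t = true)
      simpa using this
    by_cases hmaj : S.card ≤ 2 * (S.filter fun t => f t = true).card
    · obtain ⟨I', a', S'', hst'⟩ := hstep true hmaj
      exact ih (l + 1) (by omega) c _ S'' I' a' (by linarith) (hA' true) hst'
        (hcv.mono (Finset.filter_subset _ _)) fun t ht => (hcf t).2 (Finset.mem_filter.1 ht).2
    · obtain ⟨I', a', S'', hst'⟩ := hstep false (by omega)
      exact ih (l + 1) (by omega) τ' _ S'' I' a' (by linarith) (hA' false) hst'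
        (hval' _ (Finset.filter_subset _ _) fun t ht => (Finset.mem_filter.1 ht).2)
        fun t ht => (hτ' t).2 (hhold t (Finset.mem_filter.1 ht).1)

/-- The state before the first query. -/
theorem cliqueState_zero (g : Slot k m → Bool) {y : ℝ} (hm : 0 < m) (hy : 1 ≤ y) (d : ℕ)
    (a : Tup k m) : CliqueState g (y ^ 4 / m) y d 0 ∅ a Finset.univ Finset.univ := by
  have hm' : (0 : ℝ) < m := by exact_mod_cast hm
  refine ⟨⟨a, Finset.mem_univ _⟩, Finset.Subset.refl _, fun t _ => mem_extensions.2 (by simp),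
    by simp, fun e he => by simp [cliqueEdges] at he, fun R _ c => ?_, by simp⟩
  have hcard : (cyl (Finset.univ : Finset (Tup k m)) R c).card = m ^ (Rᶜ).card := by
    have : cyl (Finset.univ : Finset (Tup k m)) R c =
        Fintype.piFinset fun i => if i ∈ Rᶜ then Finset.univ else {c i} := by
      ext t
      rw [mem_cyl, Fintype.mem_piFinset]
      simp only [Finset.mem_univ, true_and, Finset.mem_compl]
      refine forall_congr' fun i => ?_
      by_cases hi : i ∈ R <;> simp [hi]
    rw [this, Fintype.card_piFinset]
    have : ∀ i, (if i ∈ Rᶜ then (Finset.univ : Finset (Fin m)) else {c i}).card =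
        if i ∈ Rᶜ then m else 1 := by
      intro i; split_ifs <;> simp
    simp only [this]
    rw [Finset.prod_ite_mem, Finset.univ_inter, Finset.prod_const]
  have hk : (Rᶜ).card + R.card = k := by
    rw [add_comm, Finset.card_add_card_compl, Fintype.card_fin]
  rw [hcard]
  have h1 : (Finset.univ : Finset (Tup k m)).card = m ^ ((Rᶜ).card + R.card) := by
    rw [hk]; simp
  rw [h1]
  push_cast
  rw [pow_add, mul_assoc, ← mul_pow]
  refine le_mul_of_one_le_right (by positivity) (one_le_pow₀ ?_)
  rw [mul_div_cancel₀ _ hm'.ne']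
  exact one_le_pow₀ hy

end Game

/-! ### Union bounds for the random graph -/

section BadEvents

variable {k m : ℕ}

/-- The union bound needs a list of sets independent of `g`. The extension sets depend on `g`, but
they are boxes, of which there are only 2^(mk) in total, negligible against exp(m^2/poly(y)). -/
theorem card_extension_boxes_le {Q : Finset (Tup k m → Bool)} (hQ : Q.Nonempty) (h : ℕ) :
    ∃ 𝓑 : Finset (Finset (Tup k m)), 𝓑.card ≤ 2 ^ (m * k) * ((h + 1) * (2 * Q.card) ^ h) ∧
      ∀ g, ∀ l ≤ h, ∀ A ∈ answerSets Q l, ∀ I a, extensions g I a ∩ A ∈ 𝓑 := by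
  classical
  refine ⟨((Finset.univ : Finset (Fin k → Finset (Fin m))) ×ˢ
    (Finset.range (h + 1)).biUnion (answerSets Q)).image
      (fun p => Fintype.piFinset p.1 ∩ p.2), ?_, ?_⟩
  · refine Finset.card_image_le.trans ?_
    rw [Finset.card_product]
    refine Nat.mul_le_mul (by simp [pow_mul]) ?_
    refine Finset.card_biUnion_le.trans ?_
    have : ∀ l ∈ Finset.range (h + 1), (answerSets Q l).card ≤ (2 * Q.card) ^ h := by
      intro l hl
      refine (card_answerSets_le Q l).trans (Nat.pow_le_pow_right ?_ ?_)
      · have := hQ.card_pos; omega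
      · have := Finset.mem_range.1 hl; omega
    simpa using Finset.sum_le_card_nsmul _ _ _ this
  · intro g l hl A hA I a
    refine Finset.mem_image.2 ⟨(_, A), Finset.mem_product.2 ⟨Finset.mem_univ _, ?_⟩, rfl⟩
    exact Finset.mem_biUnion.2 ⟨l, Finset.mem_range.2 (by omega), hA⟩

/-- A union over all families `T` would be far too large. Instead one family is chosen in advance,
without reference to `g`, for every set `B`, pair of block sets and size `σ`. For this reason
`Selects` may answer with a family different from the given one. -/
theorem pr_exists_not_selects_le {θ θ' y δ : ℝ} {d : ℕ} (hδ0 : 0 ≤ δ)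
    (hδ : ∀ J Q : Finset (Fin k), J.Nonempty → J.card ≤ d → Disjoint J Q → ∀ σ : ℕ,
      ∀ T : Finset (Tup k m), PieceFamily θ θ' y J Q σ T →
        pr (fun g => ¬ ∃ t ∈ T, GoodPiece g J Q θ' (cyl T J t) t ∧
          Present (cliqueEdges J t) g) ≤ δ)
    (𝓑 : Finset (Finset (Tup k m))) :
    pr (fun g => ∃ B ∈ 𝓑, ¬ Selects g θ θ' y d B) ≤
      (𝓑.card * (4 ^ k * (m ^ k + 1)) : ℕ) * δ := by
  classical
  have hchoose : ∀ x : Finset (Tup k m) × (Finset (Fin k) × Finset (Fin k)) × ℕ,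
      ∃ T : Finset (Tup k m), (∃ T ⊆ x.1, PieceFamily θ θ' y x.2.1.1 x.2.1.2 x.2.2 T) →
        T ⊆ x.1 ∧ PieceFamily θ θ' y x.2.1.1 x.2.1.2 x.2.2 T := by
    intro x
    by_cases h : ∃ T ⊆ x.1, PieceFamily θ θ' y x.2.1.1 x.2.1.2 x.2.2 T
    · exact h.imp fun T hT _ => hT
    · exact ⟨∅, fun h' => absurd h' h⟩
  choose T hT using hchoose
  set items := (𝓑 ×ˢ ((Finset.univ : Finset (Finset (Fin k) × Finset (Fin k))) ×ˢ
    Finset.range (m ^ k + 1))).filter fun x => x.2.1.1.Nonempty ∧ x.2.1.1.card ≤ d ∧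
      Disjoint x.2.1.1 x.2.1.2 ∧ ∃ T ⊆ x.1, PieceFamily θ θ' y x.2.1.1 x.2.1.2 x.2.2 T with hitems
  refine (pr_mono (q := fun g => ∃ x ∈ items, ¬ ∃ t ∈ T x,
    GoodPiece g x.2.1.1 x.2.1.2 θ' (cyl (T x) x.2.1.1 t) t ∧
      Present (cliqueEdges x.2.1.1 t) g) ?_).trans ?_
  · rintro g ⟨B, hB, hsel⟩
    unfold Selects at hsel
    push Not at hsel
    obtain ⟨J, Q, hJ, hJd, hJQ, σ, hex, hno⟩ := hsel
    obtain ⟨hTB, hfam⟩ := hT (B, (J, Q), σ) hex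
    have hσ : σ ≤ m ^ k := by
      obtain ⟨t, ht⟩ := hfam.nonempty
      refine (hfam.le_card t ht).trans ((Finset.card_le_univ _).trans (by simp))
    refine ⟨(B, (J, Q), σ), ?_, ?_⟩
    · rw [hitems, Finset.mem_filter]
      refine ⟨?_, hJ, hJd, hJQ, hex⟩
      simp [hB, Nat.lt_succ_of_le hσ]
    · rintro ⟨t, ht, hgood, hcl⟩
      exact hno _ hTB t ht (hfam.le_card t ht) hgood hcl
  · refine (pr_exists_le_card_mul items _ δ ?_).trans ?_
    · intro x hx
      obtain ⟨_, hJ, hJd, hJQ, hex⟩ := Finset.mem_filter.1 hx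
      exact hδ _ _ hJ hJd hJQ _ _ (hT x hex).2
    · refine mul_le_mul_of_nonneg_right (Nat.cast_le.2 ?_) hδ0
      refine (Finset.card_filter_le _ _).trans (le_of_eq ?_)
      simp only [Finset.card_product, Finset.card_univ, Fintype.card_prod, Fintype.card_finset,
        Fintype.card_fin, Finset.card_range]
      rw [← mul_pow]
      norm_num

theorem half_pow_floor_le (z : ℝ) : (1 / 2 : ℝ) ^ ⌊z⌋₊ ≤ 2 * Real.exp (-(z / 2)) := by
  have h1 : z < ⌊z⌋₊ + 1 := Nat.lt_floor_add_one z
  have h2 : (1 / 2 : ℝ) ≤ Real.exp (-(1 / 2)) := by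
    have := Real.add_one_le_exp (-(1 / 2) : ℝ)
    linarith
  have h3 : Real.exp (1 / 2) ≤ 2 := by
    rw [Real.exp_neg] at h2
    have := (le_inv_comm₀ (by norm_num) (Real.exp_pos _)).1 h2
    norm_num at this
    linarith
  calc (1 / 2 : ℝ) ^ ⌊z⌋₊ ≤ Real.exp (-(1 / 2)) ^ ⌊z⌋₊ := by gcongr
    _ = Real.exp (⌊z⌋₊ * (-(1 / 2))) := by rw [← Real.exp_nat_mul]
    _ ≤ Real.exp (1 / 2 + -(z / 2)) := Real.exp_le_exp.2 (by linarith)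
    _ = Real.exp (1 / 2) * Real.exp (-(z / 2)) := Real.exp_add _ _
    _ ≤ _ := by gcongr

theorem two_mul_pow_le_exp {y : ℝ} (hm : 0 < m) (hlog : k * Real.log (2 * m) ≤ y) :
    (2 * (m : ℝ)) ^ k ≤ Real.exp y := by
  have hm' : (0 : ℝ) < m := by exact_mod_cast hm
  have h : (2 * (m : ℝ)) ^ k = Real.exp (k * Real.log (2 * m)) := by
    rw [Real.exp_nat_mul, Real.exp_log (by positivity)]
  rw [h]
  exact Real.exp_le_exp.2 hlog

/-- Both terms of `pr_no_good_clique_le` are at most exp(-m^2/y^14). Even after the factor `T.card`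
a bad piece costs exp(-m/y^5), and about m/y^6 independent ones are needed. For the cliques the
Janson parameter is at most of order y * (y^2 * y^4/m)^2 = y^13/m^2. -/
theorem pr_no_good_clique_le_exp {y : ℝ} {d : ℕ} (hy : 256 ≤ y) (hym : y ^ 20 ≤ m) (hky : k ≤ y)
    (hd : 2 ^ d ≤ y) (hlog : k * Real.log (2 * m) ≤ y) {J Q : Finset (Fin k)} (hJ : J.Nonempty)
    (hJd : J.card ≤ d) (hJQ : Disjoint J Q) {σ : ℕ} {T : Finset (Tup k m)}
    (hT : PieceFamily (y ^ 4 / m) (y ^ 2 / m) y J Q σ T) :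
    pr (fun g => ¬ ∃ t ∈ T, GoodPiece g J Q (y ^ 2 / m) (cyl T J t) t ∧
      Present (cliqueEdges J t) g) ≤ 2 * Real.exp (-(m ^ 2 / y ^ 14)) := by
  have hy0 : 0 < y := by linarith
  have hy1 : 1 ≤ y := by linarith
  have hm' : (0 : ℝ) < m := lt_of_lt_of_le (by positivity) hym
  have hm : 0 < m := by exact_mod_cast hm'
  have hk : 0 < k := by obtain ⟨j, _⟩ := hJ; exact j.pos
  have hk' : (0 : ℝ) < k := by exact_mod_cast hk
  have h2J : (2 : ℝ) ^ J.card ≤ y := (pow_le_pow_right₀ one_le_two hJd).trans hd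
  have hJy : (J.card : ℝ) ≤ y := by
    refine le_trans ?_ h2J
    exact_mod_cast J.card.lt_two_pow_self.le
  have hypow : ∀ i : ℕ, i ≤ 20 → y ^ i ≤ m := fun i hi => (pow_le_pow_right₀ hy1 hi).trans hym
  have hkJ : ∀ z : ℝ, 0 ≤ z → k * (2 ^ J.card * z) ≤ y ^ 2 * z := by
    intro z _
    calc k * (2 ^ J.card * z) ≤ y * (y * z) := by gcongr
      _ = _ := by ring
  have hexpy := two_mul_pow_le_exp hm hlog
  -- The moment order and, below, the number of independent failures are taken up to what
  -- `pr_not_goodPiece` and `pr_no_good_clique_le` allow, with k, |J| and 2^|J| each estimated by y.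
  set q := ⌊m / (2 * y ^ 4)⌋₊ with hq
  have hqle : (q : ℝ) ≤ m / (2 * y ^ 4) := Nat.floor_le (by positivity)
  set N := ⌊m / (2 * y ^ 6)⌋₊ with hN
  have hNle : (N : ℝ) ≤ m / (2 * y ^ 6) := Nat.floor_le (by positivity)
  set p := Real.exp (-(1 / (32 * (k * (2 ^ J.card * (y ^ 2 / m)))))) +
    (2 * m) ^ k * (1 / 2) ^ q with hp
  have hp0 : 0 ≤ p := by positivity
  have hpieces : ∀ t ∈ T, pr (fun g => ¬ GoodPiece g J Q (y ^ 2 / m) (cyl T J t) t) ≤ p := by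
    intro t ht
    refine pr_not_goodPiece hJQ hk t ⟨t, mem_cyl.2 ⟨ht, fun _ _ => rfl⟩⟩ (by positivity)
      (hT.piece_spread t ht) ?_ ?_
    · refine (hkJ _ (by positivity)).trans ?_
      calc y ^ 2 * (q * (y ^ 2 / m)) ≤ y ^ 2 * (m / (2 * y ^ 4) * (y ^ 2 / m)) := by gcongr
        _ = 1 / 2 := by field_simp
    · refine (hkJ _ (by positivity)).trans ?_
      rw [← mul_div_assoc, ← pow_add, div_le_one hm']
      exact hypow 4 (by norm_num)
  have hmain := pr_no_good_clique_le hJ hJQ hT.nonempty (by positivity) hy0 hT.spread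
    (by
      refine (hkJ _ (by positivity)).trans ?_
      rw [← mul_div_assoc, ← pow_add, div_le_one hm']
      exact hypow 6 (by norm_num)) hp0 hpieces (N := N)
    (by
      calc 2 * N * (J.card * (y * (y ^ 4 / m)))
          ≤ 2 * (m / (2 * y ^ 6)) * (y * (y * (y ^ 4 / m))) := by gcongr
        _ = 1 := by field_simp)
  have hTp : T.card * p ≤ Real.exp (-(m / y ^ 5)) := by
    have hTcard : (T.card : ℝ) ≤ Real.exp y := by
      refine le_trans ?_ hexpy
      have h1 : T.card ≤ m ^ k := (Finset.card_le_univ _).trans (by simp)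
      have h2 : (T.card : ℝ) ≤ (m : ℝ) ^ k := by exact_mod_cast h1
      refine h2.trans (pow_le_pow_left₀ hm'.le (by linarith) _)
    have hp1 : p ≤ 3 * Real.exp y * Real.exp (-(m / (32 * y ^ 4))) := by
      have h1 : Real.exp (-(1 / (32 * (k * (2 ^ J.card * (y ^ 2 / m)))))) ≤
          Real.exp (-(m / (32 * y ^ 4))) := by
        refine Real.exp_le_exp.2 (neg_le_neg ?_)
        rw [show (m : ℝ) / (32 * y ^ 4) = 1 / (32 * (y ^ 2 * (y ^ 2 / m))) by field_simp]
        refine one_div_le_one_div_of_le (by positivity) ?_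
        have := hkJ (y ^ 2 / m) (by positivity)
        linarith
      have h2 : (1 / 2 : ℝ) ^ q ≤ 2 * Real.exp (-(m / (32 * y ^ 4))) := by
        refine (half_pow_floor_le _).trans ?_
        gcongr 2 * Real.exp (-?_)
        rw [div_div]
        refine div_le_div_of_nonneg_left hm'.le (by positivity) ?_
        have : 0 < y ^ 4 := by positivity
        linarith
      have h3 : (1 : ℝ) ≤ Real.exp y := Real.one_le_exp hy0.le
      calc p ≤ Real.exp (-(m / (32 * y ^ 4))) +
            Real.exp y * (2 * Real.exp (-(m / (32 * y ^ 4)))) := by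
              rw [hp]; gcongr
        _ ≤ Real.exp y * Real.exp (-(m / (32 * y ^ 4))) +
            Real.exp y * (2 * Real.exp (-(m / (32 * y ^ 4)))) := by
              gcongr
              exact le_mul_of_one_le_left (Real.exp_pos _).le h3
        _ = _ := by ring
    have h3 : (3 : ℝ) ≤ Real.exp y := by
      have := Real.add_one_le_exp y; linarith
    calc T.card * p ≤ Real.exp y * (Real.exp y * Real.exp y * Real.exp (-(m / (32 * y ^ 4)))) := by
          gcongr
          exact hp1.trans (by gcongr)
      _ = Real.exp (3 * y - m / (32 * y ^ 4)) := by
          rw [← Real.exp_add, ← Real.exp_add, ← Real.exp_add]; congr 1; ring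
      _ ≤ _ := by
          refine Real.exp_le_exp.2 ?_
          have h5 : (m : ℝ) / y ^ 5 = m / y ^ 4 / y := by rw [div_div, ← pow_succ]
          have h6 : (m : ℝ) / (32 * y ^ 4) = m / y ^ 4 / 32 := by rw [div_div, mul_comm]
          have h7 : y ^ 2 ≤ m / y ^ 4 := by
            rw [le_div_iff₀ (by positivity), ← pow_add]; exact hypow 6 (by norm_num)
          rw [h5, h6]
          have h8 : m / y ^ 4 / y ≤ m / y ^ 4 / 256 := by gcongr
          nlinarith
  have hfirst : (T.card * p) ^ N ≤ Real.exp (-(m ^ 2 / y ^ 14)) := by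
    have hNge : m / (4 * y ^ 6) ≤ N := by
      have h1 : (m : ℝ) / (2 * y ^ 6) < N + 1 := Nat.lt_floor_add_one _
      have h2 : (1 : ℝ) ≤ m / (4 * y ^ 6) := by
        rw [le_div_iff₀ (by positivity), one_mul]
        refine le_trans ?_ (hypow 7 (by norm_num))
        rw [pow_succ y 6, mul_comm]
        gcongr
        linarith
      have h3 : (m : ℝ) / (2 * y ^ 6) = 2 * (m / (4 * y ^ 6)) := by field_simp; norm_num
      linarith
    calc (T.card * p) ^ N ≤ Real.exp (-(m / y ^ 5)) ^ N := by gcongr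
      _ = Real.exp (-(N * (m / y ^ 5))) := by rw [← Real.exp_nat_mul]; congr 1; ring
      _ ≤ Real.exp (-(m / (4 * y ^ 6) * (m / y ^ 5))) := by gcongr
      _ ≤ _ := by
          refine Real.exp_le_exp.2 (neg_le_neg ?_)
          rw [div_mul_div_comm, ← sq]
          refine div_le_div_of_nonneg_left (by positivity) (by positivity) ?_
          calc 4 * y ^ 6 * y ^ 5 = 4 * y ^ 11 := by ring
            _ ≤ y * y ^ 11 := by gcongr; linarith
            _ = y ^ 12 := by ring
            _ ≤ y ^ 14 := pow_le_pow_right₀ hy1 (by norm_num)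
  have hsecond : Real.exp (-(1 / (32 * (y * (k * (2 ^ J.card * (y ^ 4 / m))) ^ 2)))) ≤
      Real.exp (-(m ^ 2 / y ^ 14)) := by
    refine Real.exp_le_exp.2 (neg_le_neg ?_)
    rw [show (m : ℝ) ^ 2 / y ^ 14 = 1 / (y ^ 14 / m ^ 2) by field_simp]
    refine one_div_le_one_div_of_le (by positivity) ?_
    calc 32 * (y * (k * (2 ^ J.card * (y ^ 4 / m))) ^ 2)
        ≤ y * (y * (y ^ 2 * (y ^ 4 / m)) ^ 2) := by
          have h1 := pow_le_pow_left₀ (by positivity) (hkJ (y ^ 4 / m) (by positivity)) 2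
          have h2 : 32 ≤ y := by linarith
          exact mul_le_mul h2 (mul_le_mul_of_nonneg_left h1 hy0.le) (by positivity) hy0.le
      _ = _ := by field_simp
  linarith

theorem exp_neg_le_one_div {a b : ℝ} (h0 : 0 < a) (h : a ≤ b) : Real.exp (-b) ≤ 1 / a := by
  rw [Real.exp_neg, ← one_div]
  refine one_div_le_one_div_of_le h0 (h.trans ?_)
  have := Real.add_one_le_exp b
  linarith

/-- With high probability, all sets that occur after at most `h` queries select. -/
theorem pr_not_selects_le {y : ℝ} {d h : ℕ} (hy : 256 ≤ y) (hym : y ^ 20 ≤ m) (hky : k ≤ y)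
    (hd : 2 ^ d ≤ y) (hlog : k * Real.log (2 * m) ≤ y) (hhy : h ≤ y)
    {Q : Finset (Tup k m → Bool)} (hQ : Q.Nonempty)
    (hQm : Real.log (2 * Q.card) ≤ m ^ 2 / y ^ 17) :
    pr (fun g => ¬ ∀ l ≤ h, ∀ A ∈ answerSets Q l, ∀ I a,
      Selects g (y ^ 4 / m) (y ^ 2 / m) y d (extensions g I a ∩ A)) ≤ 1 / m := by
  have hy0 : 0 < y := by linarith
  have hy1 : 1 ≤ y := by linarith
  have hm' : (0 : ℝ) < m := lt_of_lt_of_le (by positivity) hym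
  have hm : 0 < m := by exact_mod_cast hm'
  obtain ⟨𝓑, h𝓑, hmem⟩ := card_extension_boxes_le hQ h
  have h1 := pr_exists_not_selects_le (θ := y ^ 4 / m) (θ' := y ^ 2 / m) (y := y) (d := d)
    (δ := 2 * Real.exp (-(m ^ 2 / y ^ 14))) (by positivity)
    (fun J Q hJ hJd hJQ σ T hT => pr_no_good_clique_le_exp hy hym hky hd hlog hJ hJd hJQ hT) 𝓑
  refine (pr_mono ?_).trans (h1.trans ?_)
  · intro g hg
    push Not at hg
    obtain ⟨l, hl, A, hA, I, a, hs⟩ := hg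
    exact ⟨_, hmem g l hl A hA I a, hs⟩
  have hQpos : (0 : ℝ) < Q.card := by exact_mod_cast hQ.card_pos
  have e1 : (2 : ℝ) ^ (m * k) ≤ Real.exp (m * y) := by
    have h2 : (2 : ℝ) ≤ Real.exp 1 := by have := Real.add_one_le_exp (1 : ℝ); linarith
    calc (2 : ℝ) ^ (m * k) ≤ Real.exp 1 ^ (m * k) := by gcongr
      _ = Real.exp (m * k) := by rw [← Real.exp_nat_mul]; push_cast; rw [mul_one]
      _ ≤ _ := by gcongr
  have e2 : (h : ℝ) + 1 ≤ Real.exp y := by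
    have := Real.add_one_le_exp y; linarith
  have e3 : (2 * (Q.card : ℝ)) ^ h ≤ Real.exp (m ^ 2 / y ^ 16) := by
    have h2 : (2 * (Q.card : ℝ)) ^ h = Real.exp (h * Real.log (2 * Q.card)) := by
      rw [Real.exp_nat_mul, Real.exp_log (by positivity)]
    rw [h2]
    refine Real.exp_le_exp.2 ?_
    calc h * Real.log (2 * Q.card) ≤ h * (m ^ 2 / y ^ 17) := by gcongr
      _ ≤ y * (m ^ 2 / y ^ 17) := by gcongr
      _ = _ := by field_simp
  have e4 : (4 : ℝ) ^ k ≤ Real.exp (2 * y) := by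
    have h2 : (2 : ℝ) ≤ Real.exp 1 := by have := Real.add_one_le_exp (1 : ℝ); linarith
    calc (4 : ℝ) ^ k = 2 ^ (2 * k) := by rw [pow_mul]; norm_num
      _ ≤ Real.exp 1 ^ (2 * k) := by gcongr
      _ = Real.exp (2 * k) := by rw [← Real.exp_nat_mul]; push_cast; rw [mul_one]
      _ ≤ _ := by gcongr
  have e5 : (m : ℝ) ^ k + 1 ≤ 2 * Real.exp y := by
    have h2 := two_mul_pow_le_exp hm hlog
    have h3 : (m : ℝ) ^ k ≤ (2 * m) ^ k := pow_le_pow_left₀ hm'.le (by linarith) _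
    have h4 : (1 : ℝ) ≤ Real.exp y := Real.one_le_exp hy0.le
    linarith
  have e6 : (4 : ℝ) ≤ Real.exp y := by
    have := Real.add_one_le_exp y; linarith
  -- The queries contribute at most m^2/y^16 to the exponent, because `h ≤ y`; the boxes contribute
  -- my and the remaining choices only O(y). All this is dominated by m^2/y^14.
  calc ((𝓑.card * (4 ^ k * (m ^ k + 1)) : ℕ) : ℝ) * (2 * Real.exp (-(m ^ 2 / y ^ 14)))
      ≤ ((2 ^ (m * k) * ((h + 1) * (2 * Q.card) ^ h) * (4 ^ k * (m ^ k + 1)) : ℕ) : ℝ) *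
        (2 * Real.exp (-(m ^ 2 / y ^ 14))) := by
          gcongr
    _ = 2 ^ (m * k) * ((h + 1) * (2 * Q.card) ^ h) * (4 ^ k * (m ^ k + 1)) *
        (2 * Real.exp (-(m ^ 2 / y ^ 14))) := by push_cast; ring
    _ ≤ Real.exp (m * y) * (Real.exp y * Real.exp (m ^ 2 / y ^ 16)) *
        (Real.exp (2 * y) * (2 * Real.exp y)) * (2 * Real.exp (-(m ^ 2 / y ^ 14))) := by
          gcongr
    _ = 4 * (Real.exp (m * y) * (Real.exp y * Real.exp (m ^ 2 / y ^ 16)) *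
        (Real.exp (2 * y) * Real.exp y) * Real.exp (-(m ^ 2 / y ^ 14))) := by ring
    _ ≤ Real.exp y * (Real.exp (m * y) * (Real.exp y * Real.exp (m ^ 2 / y ^ 16)) *
        (Real.exp (2 * y) * Real.exp y) * Real.exp (-(m ^ 2 / y ^ 14))) := by gcongr
    _ = Real.exp (-(m ^ 2 / y ^ 14 - m * y - m ^ 2 / y ^ 16 - 5 * y)) := by
          simp only [← Real.exp_add]; congr 1; ring
    _ ≤ 1 / m := by
          refine exp_neg_le_one_div hm' ?_
          have f1 : m * y ^ 4 ≤ m ^ 2 / y ^ 16 := by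
            rw [le_div_iff₀ (by positivity), mul_assoc, ← pow_add, sq]
            gcongr
          have f2 : (m : ℝ) ^ 2 / y ^ 14 = m ^ 2 / y ^ 16 * y ^ 2 := by field_simp
          have f3 : (65536 : ℝ) ≤ y ^ 2 := by nlinarith
          have f4 : m ^ 2 / y ^ 16 * 65536 ≤ m ^ 2 / y ^ 16 * y ^ 2 := by gcongr
          have f5 : m * y ≤ m * y ^ 4 := by
            gcongr
            exact le_self_pow₀ hy1 (by norm_num)
          have f6 : y ≤ m := le_trans (le_self_pow₀ hy1 (by norm_num)) hym
          have f7 : (m : ℝ) * 1 ≤ m * y ^ 4 := by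
            gcongr
            exact one_le_pow₀ hy1
          rw [f2]
          linarith

/-- With high probability, common neighborhoods are not much larger than expected. -/
theorem pr_not_regularDegrees_le {y : ℝ} {d : ℕ} (hy : 256 ≤ y) (hym : y ^ 20 ≤ m) (hky : k ≤ y)
    (hd : 2 ^ d ≤ y) (hlog : k * Real.log (2 * m) ≤ y) :
    pr (fun g : Slot k m → Bool => ¬ RegularDegrees g d) ≤ 1 / m := by
  classical
  have hy0 : 0 < y := by linarith
  have hy1 : 1 ≤ y := by linarith
  have hm' : (0 : ℝ) < m := lt_of_lt_of_le (by positivity) hym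
  have hm : 0 < m := by exact_mod_cast hm'
  set q := ⌊m / (2 * y ^ 2)⌋₊ with hq
  have hqle : (q : ℝ) ≤ m / (2 * y ^ 2) := Nat.floor_le (by positivity)
  set items := ((Finset.univ : Finset (Finset (Fin k) × Tup k m × Fin k))).filter fun x =>
    x.1.card ≤ d ∧ x.2.2 ∉ x.1 with hitems
  refine (pr_mono (q := fun g => ∃ x ∈ items, 4 * ((m : ℝ) / 2 ^ x.1.card) <
    ((Finset.univ.filter fun v => ∀ j ∈ x.1, g s((j, x.2.1 j), (x.2.2, v)) = true).card : ℝ))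
      ?_).trans ?_
  · intro g hg
    unfold RegularDegrees at hg
    push Not at hg
    obtain ⟨I, hI, a, i, hi, hlt⟩ := hg
    exact ⟨(I, a, i), by simp [hitems, hI, hi], hlt⟩
  refine (pr_exists_le_card_mul items _ ((1 / 2) ^ q) ?_).trans ?_
  · rintro ⟨I, a, i⟩ hx
    obtain ⟨hI, hi⟩ : I.card ≤ d ∧ i ∉ I := by simpa [hitems] using hx
    have hinj : Function.Injective fun v : Fin m => Function.update a i v :=
      Function.update_injective a i
    -- Tuples that vary only in block `i` stand for its vertices, so the upper tail for links
    -- becomes one for common neighborhoods.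
    set P : Finset (Tup k m) := Finset.univ.image fun v => Function.update a i v with hP
    have hIQ : Disjoint I {i} := Finset.disjoint_singleton_right.2 hi
    have hPcard : P.card = m := by
      rw [hP, Finset.card_image_of_injective _ hinj]; simp
    have hS : Spread (1 / m) {i} P m := by
      intro R hR c
      rcases Finset.subset_singleton_iff.1 hR with rfl | rfl
      · simp [cyl_empty, hPcard]
      · rw [Finset.card_singleton, pow_one, mul_one_div_cancel hm'.ne']
        refine Nat.cast_le_one.2 (Finset.card_le_one.2 ?_)
        intro t ht t' ht'
        rw [mem_cyl] at ht ht'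
        obtain ⟨v, _, rfl⟩ := Finset.mem_image.1 ht.1
        obtain ⟨v', _, rfl⟩ := Finset.mem_image.1 ht'.1
        have e1 := ht.2 i (Finset.mem_singleton_self i)
        have e2 := ht'.2 i (Finset.mem_singleton_self i)
        rw [Function.update_self] at e1 e2
        rw [e1, e2]
    have h2I : (2 : ℝ) ^ I.card ≤ y := (pow_le_pow_right₀ one_le_two hI).trans hd
    have := pr_link_upper hIQ a (θ := 1 / m) (Λ := m) (by positivity) hm' hS (q := q) (by
      calc k * (2 ^ I.card * (q * (1 / m))) ≤ y * (y * (m / (2 * y ^ 2) * (1 / m))) := by gcongr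
        _ = 1 / 2 := by field_simp)
    refine (pr_mono ?_).trans this
    intro g hg
    simp only at hg
    have hsum : ∑ t ∈ P, ind (Present (linkEdges I {i} a t)) g =
        ((Finset.univ.filter fun v => ∀ j ∈ I, g s((j, a j), (i, v)) = true).card : ℝ) := by
      rw [hP, Finset.sum_image fun v _ v' _ h => hinj h,
        ← sum_ind Finset.univ (fun v g => ∀ j ∈ I, g s((j, a j), (i, v)) = true) g]
      refine Finset.sum_congr rfl fun v _ => ind_congr ?_
      simp [Present, linkEdges]
    rw [hsum, Finset.card_singleton, mul_one]
    rw [← mul_div_assoc, div_lt_iff₀ (by positivity)] at hg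
    linarith
  have hcard : (items.card : ℝ) ≤ 2 ^ k * m ^ k * k := by
    have h1 : items.card ≤ 2 ^ k * (m ^ k * k) :=
      (Finset.card_filter_le _ _).trans (le_of_eq (by simp))
    calc (items.card : ℝ) ≤ ((2 ^ k * (m ^ k * k) : ℕ) : ℝ) := by exact_mod_cast h1
      _ = _ := by push_cast; ring
  have hexpy := two_mul_pow_le_exp hm hlog
  have e1 : (k : ℝ) ≤ Real.exp y := by
    have := Real.add_one_le_exp y; linarith
  have e2 : (2 : ℝ) ≤ Real.exp y := by
    have := Real.add_one_le_exp y; linarith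
  calc (items.card : ℝ) * (1 / 2) ^ q
      ≤ (2 ^ k * m ^ k * k) * (2 * Real.exp (-(m / (2 * y ^ 2) / 2))) := by
        gcongr
        exact half_pow_floor_le _
    _ = (2 * m) ^ k * k * (2 * Real.exp (-(m / (2 * y ^ 2) / 2))) := by rw [mul_pow]
    _ ≤ Real.exp y * Real.exp y * (Real.exp y * Real.exp (-(m / (2 * y ^ 2) / 2))) := by gcongr
    _ = Real.exp (-(m / (2 * y ^ 2) / 2 - 3 * y)) := by
        simp only [← Real.exp_add]; congr 1; ring
    _ ≤ 1 / m := by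
        have f1 : (m : ℝ) / (2 * y ^ 2) / 2 = m / y ^ 3 * (y / 4) := by field_simp; norm_num
        have f2 : y ^ 17 ≤ m / y ^ 3 := by
          rw [le_div_iff₀ (by positivity), ← pow_add]; exact hym
        have f3 : y ≤ y ^ 17 := le_self_pow₀ hy1 (by norm_num)
        have f4 : m / y ^ 3 * 64 ≤ m / y ^ 3 * (y / 4) := by gcongr; linarith
        have f5 : 0 ≤ m / y ^ 3 := by positivity
        refine (Real.exp_le_exp.2 (neg_le_neg (show m / y ^ 3 * 2 ≤ _ by rw [f1]; linarith))).trans ?_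
        rw [Real.exp_neg, ← one_div]
        refine one_div_le_one_div_of_le hm' ?_
        refine le_trans ?_ (Real.quadratic_le_exp_of_nonneg (by positivity))
        have f6 : (m : ℝ) ≤ (m / y ^ 3) ^ 2 := by
          rw [div_pow, le_div_iff₀ (by positivity), sq (m : ℝ), ← pow_mul]
          exact mul_le_mul_of_nonneg_left ((pow_le_pow_right₀ hy1 (by norm_num)).trans hym) hm'.le
        nlinarith

/-- With high probability, there is no clique with a vertex in every block. -/
theorem pr_exists_clique_le (hm : 0 < m) (hk : 8 ≤ k) (hmk : (m : ℝ) ^ 4 ≤ 2 ^ k) :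
    pr (fun g : Slot k m → Bool => ∃ t, Present (cliqueEdges Finset.univ t) g) ≤ 1 / m := by
  have hm' : (0 : ℝ) < m := by exact_mod_cast hm
  have hcard : ∀ t : Tup k m, (cliqueEdges Finset.univ t).card = k.choose 2 := by
    intro t
    rw [card_cliqueEdges, Finset.card_filter, Finset.sum_product_right, Nat.choose_two_right,
      ← Finset.sum_range_id, ← Fin.sum_univ_eq_sum_range]
    refine Finset.sum_congr rfl fun j _ => ?_
    rw [← Finset.card_filter, ← Fin.card_Iio]
    congr 1
    ext i
    simp
  have h1 := pr_exists_le_card_mul (Finset.univ : Finset (Tup k m))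
    (fun t g => Present (cliqueEdges Finset.univ t) g) ((1 / 2) ^ k.choose 2)
    (fun t _ => by rw [pr_present, hcard])
  simp only [Finset.mem_univ, true_and] at h1
  refine h1.trans ?_
  have h2 : ((Finset.univ : Finset (Tup k m)).card : ℝ) = (m : ℝ) ^ k := by simp
  rw [h2, one_div_pow, mul_one_div, div_le_div_iff₀ (by positivity) hm', one_mul, ← pow_succ]
  -- Fourth powers make `hmk` applicable; what remains is k(k+1) ≤ 4 * (k choose 2).
  refine le_of_pow_le_pow_left₀ (n := 4) (by norm_num) (by positivity) ?_
  calc ((m : ℝ) ^ (k + 1)) ^ 4 = (m ^ 4) ^ (k + 1) := by rw [← pow_mul, ← pow_mul, mul_comm]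
    _ ≤ (2 ^ k) ^ (k + 1) := by gcongr
    _ = 2 ^ (k * (k + 1)) := by rw [← pow_mul]
    _ ≤ 2 ^ (k.choose 2 * 4) := by
        refine pow_le_pow_right₀ one_le_two ?_
        obtain ⟨j, rfl⟩ : ∃ j, k = j + 1 := ⟨k - 1, by omega⟩
        have h3 := Nat.triangle_succ j
        rw [← Nat.choose_two_right] at h3
        have h4 := Nat.add_one_mul_choose_eq j 1
        rw [Nat.choose_one_right] at h4
        nlinarith
    _ = (2 ^ k.choose 2) ^ 4 := by rw [pow_mul]

end BadEvents

/-! ## Formulas and assignments -/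

section Formulas

variable {k m : ℕ} {V : Type}

theorem Clause.sat_map (f : CliqueVar k m ↪ V) (C : Clause (CliqueVar k m)) (α : V → Bool) :
    Clause.Sat (C.map (f.prodMap (Function.Embedding.refl Bool))) α ↔ Clause.Sat C (α ∘ f) := by
  unfold Clause.Sat
  constructor
  · rintro ⟨l, hl, h⟩
    obtain ⟨l', hl', rfl⟩ := Finset.mem_map.1 hl
    exact ⟨l', hl', h⟩
  · rintro ⟨l, hl, h⟩
    exact ⟨_, Finset.mem_map_of_mem _ hl, h⟩

theorem CNF.mem_rename {f : CliqueVar k m ↪ V} {A : CNF (CliqueVar k m)} {C : Clause V} :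
    C ∈ A.rename f ↔ ∃ C' ∈ A, C'.map (f.prodMap (Function.Embedding.refl Bool)) = C := by
  unfold CNF.rename
  exact Finset.mem_map

theorem mem_cliqueFormula {G : SimpleGraph (BlockVertex k m)} {C : Clause (CliqueVar k m)} :
    C ∈ cliqueFormula G ↔ IsCliqueClause G C := by
  simp [cliqueFormula]

theorem cliqueFormula_isThreeCNF (G : SimpleGraph (BlockVertex k m)) :
    (cliqueFormula G).IsThreeCNF := by
  intro C hC
  rw [mem_cliqueFormula] at hC
  cases hC with
  | edge u v hne hadj =>
    refine ⟨Finset.card_le_two.trans (by norm_num), ?_⟩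
    intro l hl l' hl' h
    simp only [Finset.coe_insert, Finset.coe_singleton, Set.mem_insert_iff,
      Set.mem_singleton_iff] at hl hl'
    rcases hl with rfl | rfl <;> rcases hl' with rfl | rfl <;> simp_all [negLit, xVar]
  | first i => simp
  | next i j =>
    refine ⟨Finset.card_le_three, ?_⟩
    intro l hl l' hl' h
    have hj : j.castSucc ≠ j.succ := (Fin.castSucc_lt_succ).ne
    simp only [Finset.coe_insert, Finset.coe_singleton, Set.mem_insert_iff,
      Set.mem_singleton_iff] at hl hl'
    rcases hl with rfl | rfl | rfl <;> rcases hl' with rfl | rfl | rfl <;>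
      simp_all [negLit, posLit, xVar, zVar]
  | last i => simp

theorem CNF.IsThreeCNF.rename {A : CNF (CliqueVar k m)} (hA : A.IsThreeCNF)
    (f : CliqueVar k m ↪ V) : (A.rename f).IsThreeCNF := by
  intro C hC
  obtain ⟨C', hC', rfl⟩ := CNF.mem_rename.1 hC
  refine ⟨(Finset.card_map _).trans_le (hA C' hC').1, ?_⟩
  intro l hl l' hl' h
  obtain ⟨a, ha, rfl⟩ := Finset.mem_map.1 (Finset.mem_coe.1 hl)
  obtain ⟨b, hb, rfl⟩ := Finset.mem_map.1 (Finset.mem_coe.1 hl')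
  rw [(hA C' hC').2 ha hb (f.injective h)]

theorem not_clause_sat_iff {C : Clause V} {α : V → Bool} :
    ¬ Clause.Sat C α ↔ ∀ l ∈ C, α l.1 ≠ l.2 := by
  unfold Clause.Sat
  push Not
  rfl

/-- The assignment that describes the choice of the vertices of `t`. -/
def encode (t : Tup k m) : CliqueVar k m → Bool :=
  Sum.elim (fun v => decide (t v.1 = v.2)) fun p => decide ((t p.1 : ℕ) < p.2)

/-- The graph whose edges are the slots chosen by `g` between different blocks. -/
def graphOf (g : Slot k m → Bool) : SimpleGraph (BlockVertex k m) where
  Adj u v := u.1 ≠ v.1 ∧ g s(u, v) = true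
  symm := ⟨fun u v h => ⟨h.1.symm, by rw [Sym2.eq_swap]; exact h.2⟩⟩
  loopless := ⟨fun _ h => h.1 rfl⟩

/-- The test whether a tuple contains two given vertices. -/
def pairTest (p : BlockVertex k m × BlockVertex k m) (t : Tup k m) : Bool :=
  decide (t p.1.1 = p.1.2 ∧ t p.2.1 = p.2.2)

/-- Reading `z i j` as "the chosen index is below j" satisfies every clause except edge axioms. A
clause that never fails is assigned two distinct vertices of one block, which no tuple contains;
this is where `2 ≤ m` is needed. So all axioms become pair tests of non-edges. -/
theorem not_sat_encode_iff (hk : 0 < k) (hm : 2 ≤ m) {g : Slot k m → Bool}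
    {C : Clause (CliqueVar k m)} (hC : IsCliqueClause (graphOf g) C) :
    ∃ u v, NonEdge g u v ∧ ∀ t, ¬ Clause.Sat C (encode t) ↔ t u.1 = u.2 ∧ t v.1 = v.2 := by
  have hfalse : (∀ t, Clause.Sat C (encode t)) →
      ∃ u v, NonEdge g u v ∧ ∀ t, ¬ Clause.Sat C (encode t) ↔ t u.1 = u.2 ∧ t v.1 = v.2 := by
    intro h
    refine ⟨(⟨0, hk⟩, ⟨0, by omega⟩), (⟨0, hk⟩, ⟨1, by omega⟩), ⟨by simp, fun h => h.1 rfl⟩,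
      fun t => ?_⟩
    simp only [h t, not_true_eq_false, false_iff, not_and]
    intro h1 h2
    rw [h1] at h2
    simp at h2
  cases hC with
  | edge u v hne hadj =>
    refine ⟨u, v, ⟨hne, hadj⟩, fun t => ?_⟩
    simp [not_clause_sat_iff, negLit, xVar, encode]
  | first i =>
    refine hfalse fun t => ⟨negLit (zVar i 0), by simp, ?_⟩
    simp [negLit, zVar, encode]
  | next i j =>
    refine hfalse fun t => ?_
    by_contra hno
    rw [not_clause_sat_iff] at hno
    simp [negLit, posLit, xVar, zVar, encode, Fin.ext_iff] at hno
    omega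
  | last i =>
    refine hfalse fun t => ⟨posLit (zVar i (Fin.last m)), by simp, ?_⟩
    simp [posLit, zVar, encode]

/-- If a block had no chosen vertex, its chain of clauses would force all its extension variables to
be false, against the last clause. -/
theorem exists_clique_of_sat {g : Slot k m → Bool} {α : CliqueVar k m → Bool}
    (hα : (cliqueFormula (graphOf g)).Sat α) : ∃ t, Present (cliqueEdges Finset.univ t) g := by
  have hcl : ∀ {C}, IsCliqueClause (graphOf g) C → ¬ ∀ l ∈ C, α l.1 ≠ l.2 := fun {C} hC h =>
    not_clause_sat_iff.2 h (hα C (mem_cliqueFormula.2 hC))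
  have hex : ∀ i : Fin k, ∃ j : Fin m, α (xVar (i, j)) = true := by
    intro i
    by_contra hno
    push Not at hno
    have hz : ∀ j : Fin (m + 1), α (zVar i j) = false := by
      intro j
      induction j using Fin.induction with
      | zero =>
        by_contra h
        exact hcl (IsCliqueClause.first i) (by simpa [negLit] using h)
      | succ j ih =>
        by_contra h
        refine hcl (IsCliqueClause.next i j) ?_
        have := hno j
        simp_all [negLit, posLit]
    refine hcl (IsCliqueClause.last i) ?_
    simp [posLit, hz]
  choose t ht using hex
  refine ⟨t, fun e he => ?_⟩
  simp only [cliqueEdges, Finset.mem_image, Finset.mem_filter] at he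
  obtain ⟨⟨i, j⟩, ⟨_, hij⟩, rfl⟩ := he
  by_contra h
  refine hcl (IsCliqueClause.edge (G := graphOf g) (i, t i) (j, t j) ?_ fun hadj => h hadj.2) ?_
  · intro heq
    exact hij.ne (congrArg Prod.fst heq)
  · simp [negLit, ht]

theorem CNF.unsat_rename {g : Slot k m → Bool} (f : CliqueVar k m ↪ V)
    (hg : ¬ ∃ t, Present (cliqueEdges Finset.univ t) g) :
    ((cliqueFormula (graphOf g)).rename f).Unsat := by
  intro α hα
  refine hg (exists_clique_of_sat (α := α ∘ f) fun C hC => ?_)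
  exact (Clause.sat_map f C α).1 (hα _ (CNF.mem_rename.2 ⟨C, hC, rfl⟩))

end Formulas

/-! ## Refutations as query trees -/

section Refutations

variable {V : Type} {F : Finset (BoolFun V)} {A : CNF V}

theorem SemRefutation.lt_of_usedBy (π : SemRefutation F A) {i j : Fin π.length}
    (h : π.UsedBy j i) : j < i := by
  obtain ⟨p, hp, rfl | rfl⟩ := h
  · exact (π.valid_infer i p.1 p.2 hp).2.1
  · exact (π.valid_infer i p.1 p.2 hp).2.2.1

theorem SemRefutation.le_of_reflTransGen (π : SemRefutation F A) {i j : Fin π.length}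
    (h : Relation.ReflTransGen π.UsedBy j i) : j ≤ i := by
  induction h with
  | refl => exact le_rfl
  | tail _ h ih => exact ih.trans (π.lt_of_usedBy h).le

open Classical in
/-- The lines from which the line `i` is derived, including `i`. -/
noncomputable def SemRefutation.ancestors (π : SemRefutation F A) (i : Fin π.length) :
    Finset (Fin π.length) :=
  Finset.univ.filter fun j => Relation.ReflTransGen π.UsedBy j i

theorem SemRefutation.mem_ancestors (π : SemRefutation F A) {i j : Fin π.length} :
    j ∈ π.ancestors i ↔ Relation.ReflTransGen π.UsedBy j i := by
  simp [SemRefutation.ancestors]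

theorem SemRefutation.card_ancestors_lt (π : SemRefutation F A) {i j : Fin π.length}
    (h : π.UsedBy j i) : (π.ancestors j).card + 1 ≤ (π.ancestors i).card := by
  refine Finset.card_lt_card (Finset.ssubset_iff_of_subset ?_ |>.2 ⟨i, ?_, ?_⟩)
  · intro a ha
    exact π.mem_ancestors.2 ((π.mem_ancestors.1 ha).tail h)
  · exact π.mem_ancestors.2 .refl
  · intro hi
    exact absurd (π.le_of_reflTransGen (π.mem_ancestors.1 hi)) (not_le.2 (π.lt_of_usedBy h))

/-- From any line, successive uses form a single path. A common ancestor of two premises of `i`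
would make one premise lead to the other, but the path leaving a premise goes straight to `i`, which
comes after both. -/
theorem SemRefutation.TreeLike.card_ancestors_add_lt {π : SemRefutation F A} (hπ : π.TreeLike)
    {i j j' : Fin π.length} (hj : π.UsedBy j i) (hj' : π.UsedBy j' i) (hne : j ≠ j') :
    (π.ancestors j).card + (π.ancestors j').card + 1 ≤ (π.ancestors i).card := by
  classical
  have hnot : ∀ {a b}, π.UsedBy a i → π.UsedBy b i → a ≠ b →
      ¬ Relation.ReflTransGen π.UsedBy a b := by
    intro a b ha hb hab hr
    rcases hr.cases_head with h | ⟨c, hac, hcb⟩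
    · exact hab h
    · rw [hπ a c i hac ha] at hcb
      exact absurd (π.le_of_reflTransGen hcb) (not_le.2 (π.lt_of_usedBy hb))
  have hdisj : Disjoint (π.ancestors j) (π.ancestors j') := by
    rw [Finset.disjoint_left]
    intro a ha ha'
    rcases Relation.ReflTransGen.total_of_right_unique (fun a b c h h' => hπ a b c h h')
      (π.mem_ancestors.1 ha) (π.mem_ancestors.1 ha') with h | h
    · exact hnot hj hj' hne h
    · exact hnot hj' hj hne.symm h
  rw [← Finset.card_union_of_disjoint hdisj]
  refine Finset.card_lt_card (Finset.ssubset_iff_of_subset ?_ |>.2 ⟨i, ?_, ?_⟩)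
  · intro a ha
    rcases Finset.mem_union.1 ha with ha | ha
    · exact π.mem_ancestors.2 ((π.mem_ancestors.1 ha).tail hj)
    · exact π.mem_ancestors.2 ((π.mem_ancestors.1 ha).tail hj')
  · exact π.mem_ancestors.2 .refl
  · intro hi
    rcases Finset.mem_union.1 hi with hi | hi
    · exact absurd (π.le_of_reflTransGen (π.mem_ancestors.1 hi)) (not_le.2 (π.lt_of_usedBy hj))
    · exact absurd (π.le_of_reflTransGen (π.mem_ancestors.1 hi)) (not_le.2 (π.lt_of_usedBy hj'))

/-- A tree-like refutation, restricted to some of the assignments, unfolds to a query tree. -/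
theorem SemRefutation.TreeLike.exists_queryTree {π : SemRefutation F A} (hπ : π.TreeLike)
    {X : Type} [Fintype X] (enc : X → V → Bool) {Q : Finset (X → Bool)} {ax : (X → Bool) → Prop}
    (hF : ∀ f ∈ F, (fun t => f (enc t)) ∈ Q)
    (hax : ∀ C ∈ A, ∀ f : BoolFun V, (∀ α, f α = true ↔ ¬ Clause.Sat C α) →
      (fun t => f (enc t)) ∈ Q ∧ ax fun t => f (enc t)) (i : Fin π.length) :
    ∃ τ : QueryTree X, τ.size ≤ (π.ancestors i).card ∧ τ.Valid Q ax Finset.univ ∧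
      ∀ t, τ.Holds t ↔ π.line i (enc t) = true := by
  induction i using WellFoundedLT.induction with
  | ind i ih =>
    cases hp : π.premises i with
    | none =>
      obtain ⟨C, hC, hline⟩ := π.valid_input i hp
      refine ⟨.leaf fun t => π.line i (enc t), ?_, hax C hC _ hline, fun t => Iff.rfl⟩
      exact Finset.card_pos.2 ⟨i, π.mem_ancestors.2 .refl⟩
    | some p =>
      obtain ⟨j, j'⟩ := p
      obtain ⟨hiF, hj, hj', hcov⟩ := π.valid_infer i j j' hp
      obtain ⟨τ, hτs, hτv, hτ⟩ := ih j hj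
      obtain ⟨τ', hτ's, hτ'v, hτ'⟩ := ih j' hj'
      have hu : π.UsedBy j i := ⟨_, hp, Or.inl rfl⟩
      have hu' : π.UsedBy j' i := ⟨_, hp, Or.inr rfl⟩
      by_cases hne : j = j'
      · subst hne
        refine ⟨.node (fun t => π.line i (enc t)) τ .stub, ?_,
          ⟨hF _ hiF, fun t _ ht => Or.inl ?_, hτv, trivial⟩, fun t => Iff.rfl⟩
        · have := π.card_ancestors_lt hu
          simp only [QueryTree.size]
          omega
        · exact (hτ t).2 ((hcov _ ht).elim id id)
      · refine ⟨.node (fun t => π.line i (enc t)) τ τ', ?_,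
          ⟨hF _ hiF, fun t _ ht => ?_, hτv, hτ'v⟩, fun t => Iff.rfl⟩
        · have := hπ.card_ancestors_add_lt hu hu' hne
          simp only [QueryTree.size]
          omega
        · rw [hτ, hτ']
          exact hcov _ ht

open Classical in
/-- The lines of a refutation as functions of tuples. -/
noncomputable def queries {k m : ℕ} (F : Finset (BoolFun V)) (f : CliqueVar k m ↪ V) :
    Finset (Tup k m → Bool) :=
  (F.image fun φ t => φ (Function.extend f (encode t) fun _ => false)) ∪
    Finset.univ.image pairTest

theorem card_queries_le {k m : ℕ} (F : Finset (BoolFun V)) (f : CliqueVar k m ↪ V) :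
    (queries F f).card ≤ F.card + (k * m) ^ 2 := by
  refine (Finset.card_union_le _ _).trans (add_le_add Finset.card_image_le ?_)
  refine Finset.card_image_le.trans (le_of_eq ?_)
  simp [sq]

theorem queries_nonempty {k m : ℕ} (hk : 0 < k) (hm : 0 < m) (F : Finset (BoolFun V))
    (f : CliqueVar k m ↪ V) : (queries F f).Nonempty :=
  ⟨pairTest ((⟨0, hk⟩, ⟨0, hm⟩), (⟨0, hk⟩, ⟨0, hm⟩)),
    Finset.mem_union_right _ (Finset.mem_image_of_mem _ (Finset.mem_univ _))⟩

/-- Tree-like refutations are long if all extension sets select. -/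
theorem SemRefutation.TreeLike.lt_length {k m : ℕ} {g : Slot k m → Bool} {f : CliqueVar k m ↪ V}
    {π : SemRefutation F ((cliqueFormula (graphOf g)).rename f)} (hπ : π.TreeLike) (hk : 0 < k)
    (hm : 2 ≤ m) {y x : ℝ} {d h : ℕ} (hy : 16 ≤ y) (hym : y ^ 4 < m) (hd : 2 ^ d ≤ y) (hx0 : 0 < x)
    (hx1 : x ≤ 1) (hyx : 4 * (1 + x) ^ k ≤ y * x ^ d) (hyd : 4 ^ (k + 1) * 16 ^ h < y ^ (d + 1))
    (hreg : RegularDegrees g d)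
    (hsel : ∀ l ≤ h, ∀ A ∈ answerSets (queries F f) l, ∀ I a,
      Selects g (y ^ 4 / m) (y ^ 2 / m) y d (extensions g I a ∩ A)) :
    (8 / 7) ^ h < (π.length : ℝ) := by
  by_contra hlen
  rw [not_lt] at hlen
  have hpairs : ∀ p, pairTest p ∈ queries F f := fun p =>
    Finset.mem_union_right _ (Finset.mem_image_of_mem _ (Finset.mem_univ _))
  obtain ⟨τ, hsize, hval, hholds⟩ := hπ.exists_queryTree
    -- The variables outside the range of `f` do not occur in the formula and are set to false.
    (fun t => Function.extend f (encode t) fun _ => false) (Q := queries F f)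
    (ax := IsNonEdgeTest g)
    (fun φ hφ => Finset.mem_union_left _ (Finset.mem_image_of_mem _ hφ))
    (fun C hC φ hφ => by
      obtain ⟨C', hC', rfl⟩ := CNF.mem_rename.1 hC
      obtain ⟨u, v, huv, hiff⟩ := not_sat_encode_iff hk hm (mem_cliqueFormula.1 hC')
      have heq : ∀ t, φ (Function.extend f (encode t) fun _ => false) = true ↔
          t u.1 = u.2 ∧ t v.1 = v.2 := by
        intro t
        rw [hφ, Clause.sat_map, Function.extend_comp f.injective, hiff]
      have hfun : (fun t => φ (Function.extend f (encode t) fun _ => false)) = pairTest (u, v) := by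
        funext t
        rw [Bool.eq_iff_iff, heq]
        simp [pairTest]
      exact ⟨hfun ▸ hpairs _, u, v, huv, fun t ht => (heq t).1 ht⟩)
    ⟨π.length - 1, Nat.sub_lt π.length_pos Nat.one_pos⟩
  refine no_valid_tree (by omega) hy hym hd hx0 hx1 hyx hyd hreg hsel h 0 (by omega) τ
    Finset.univ Finset.univ ∅ (fun _ => ⟨0, by omega⟩) ?_ (by simp [answerSets])
    (cliqueState_zero g (by omega) (by linarith) d _) hval fun t _ => ?_
  · refine le_trans ?_ hlen
    have h1 := hsize.trans (Finset.card_le_univ _)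
    rw [Fintype.card_fin] at h1
    exact_mod_cast h1
  · rw [hholds, π.last_line]

end Refutations

/-! ## The uniform distribution on the family -/

section Family

variable {k m : ℕ}

/-- The edge axioms determine the graph, so a uniform formula of the family is the formula of a
uniform graph. -/
theorem cliqueFormula_injective :
    Function.Injective (cliqueFormula : SimpleGraph (BlockVertex k m) → _) := by
  have key : ∀ (G : SimpleGraph (BlockVertex k m)) u v, u ≠ v →
      ({negLit (xVar u), negLit (xVar v)} ∈ cliqueFormula G ↔ ¬ G.Adj u v) := by
    intro G u v huv
    rw [mem_cliqueFormula]
    refine ⟨fun h => ?_, fun h => .edge u v huv h⟩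
    generalize hC : ({negLit (xVar u), negLit (xVar v)} : Clause (CliqueVar k m)) = C at h
    have hu : negLit (xVar u) ∈ C := by rw [← hC]; simp
    have hv : negLit (xVar v) ∈ C := by rw [← hC]; simp
    cases h with
    | edge u' v' hne hadj =>
      simp only [negLit, xVar, Finset.mem_insert, Finset.mem_singleton, Prod.mk.injEq,
        Sum.inl.injEq, and_true] at hu hv
      rcases hu with rfl | rfl <;> rcases hv with rfl | rfl
      · exact absurd rfl huv
      · exact hadj
      · exact fun h => hadj h.symm
      · exact absurd rfl huv
    | first i => simp [negLit, xVar, zVar] at hu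
    | next i j => simp [negLit, posLit, xVar, zVar] at hu
    | last i => simp [negLit, posLit, xVar, zVar] at hu
  intro G G' h
  ext u v
  by_cases huv : u = v
  · subst huv; simp
  · rw [← not_iff_not, ← key G u v huv, ← key G' u v huv, h]

theorem CNF.rename_injective {V : Type} (f : CliqueVar k m ↪ V) :
    Function.Injective (CNF.rename f) := fun _ _ h => Finset.map_injective _ h

theorem graphOf_le (g : Slot k m → Bool) : graphOf g ≤ SimpleGraph.completeEquipartiteGraph k m :=
  fun _ _ h => SimpleGraph.completeEquipartiteGraph_adj.2 h.1

-- Adding the edge indicator of `G` modulo 2 is an involution exchanging the two fibers. Slots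
-- within a block are ignored by `graphOf`, so every graph arises equally often.
open Classical in
theorem card_graphOf_fiber {G : SimpleGraph (BlockVertex k m)}
    (hG : G ≤ SimpleGraph.completeEquipartiteGraph k m) :
    (Finset.univ.filter fun g : Slot k m → Bool => graphOf g = G).card =
      (Finset.univ.filter fun g : Slot k m → Bool => graphOf g = ⊥).card := by
  set mask : Slot k m → Bool := fun e => decide (e ∈ G.edgeSet) with hmask
  have hmask' : ∀ u v, mask s(u, v) = decide (G.Adj u v) := by intro u v; simp [hmask]
  have hne : ∀ {u v}, G.Adj u v → u.1 ≠ v.1 := fun {u v} h =>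
    SimpleGraph.completeEquipartiteGraph_adj.1 (hG h)
  have hcross : ∀ (g : Slot k m → Bool) (H : SimpleGraph (BlockVertex k m)), graphOf g = H →
      ∀ u v, u.1 ≠ v.1 → (g s(u, v) = true ↔ H.Adj u v) := by
    rintro g _ rfl u v huv
    simp [graphOf, huv]
  have hinv : ∀ g : Slot k m → Bool, (fun e => xor (xor (g e) (mask e)) (mask e)) = g := by
    intro g; funext e; simp
  refine Finset.card_nbij' (fun g e => xor (g e) (mask e)) (fun g e => xor (g e) (mask e)) ?_ ?_
    (fun g _ => hinv g) (fun g _ => hinv g)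
  · intro g hg
    simp only [Finset.coe_filter, Finset.mem_univ, true_and, Set.mem_ofPred_eq] at hg ⊢
    ext u v
    simp only [graphOf, hmask', SimpleGraph.bot_adj, iff_false, not_and]
    intro huv
    have := hcross g G hg u v huv
    by_cases h : G.Adj u v <;> simp_all
  · intro g hg
    simp only [Finset.coe_filter, Finset.mem_univ, true_and, Set.mem_ofPred_eq] at hg ⊢
    ext u v
    simp only [graphOf, hmask']
    constructor
    · rintro ⟨huv, h⟩
      have := hcross g ⊥ hg u v huv
      by_contra hadj
      simp_all
    · intro hadj
      have := hcross g ⊥ hg u v (hne hadj)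
      refine ⟨hne hadj, ?_⟩
      simp_all

/-- The uniform distribution on the family is that of the formula of a random graph. -/
theorem uniformProb_cliqueFamily (n : ℕ) (P : CNF (Fin n) → Prop) :
    uniformProb (cliqueFamily n) P =
      pr fun g : Slot (cliqueSize (blockSize n)) (blockSize n) → Bool =>
        P ((cliqueFormula (graphOf g)).rename (varIndex n)) := by
  classical
  set k := cliqueSize (blockSize n)
  set m := blockSize n
  set Φ : SimpleGraph (BlockVertex k m) → CNF (Fin n) := fun G =>
    (cliqueFormula G).rename (varIndex n) with hΦ
  have hinj : Function.Injective Φ := fun G G' h =>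
    cliqueFormula_injective (CNF.rename_injective _ h)
  set S := Finset.univ.filter fun G : SimpleGraph (BlockVertex k m) =>
    G ≤ SimpleGraph.completeEquipartiteGraph k m with hS
  set N := (Finset.univ.filter fun g : Slot k m → Bool => graphOf g = ⊥).card with hN
  have hcount : ∀ P' : SimpleGraph (BlockVertex k m) → Prop,
      (Finset.univ.filter fun g : Slot k m → Bool => P' (graphOf g)).card =
        (S.filter P').card * N := by
    intro P'
    rw [Finset.card_eq_sum_card_fiberwise (f := graphOf) (t := S.filter P')]
    · rw [← smul_eq_mul, ← Finset.sum_const]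
      refine Finset.sum_congr rfl fun G hG => ?_
      rw [Finset.mem_filter] at hG
      rw [hN, ← card_graphOf_fiber (Finset.mem_filter.1 hG.1).2, Finset.filter_filter]
      congr 1
      ext g
      simp only [Finset.mem_filter, Finset.mem_univ, true_and, and_iff_right_iff_imp]
      rintro rfl
      exact hG.2
    · intro g hg
      simp only [Finset.coe_filter, Finset.mem_univ, true_and, Set.mem_ofPred_eq] at hg
      simp [hS, hg, graphOf_le]
  have htotal : (2 : ℝ) ^ Fintype.card (Slot k m) = S.card * N := by
    have h := hcount fun _ => True
    simp only [Finset.filter_true] at h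
    rw [Finset.card_univ, Fintype.card_fun, Fintype.card_bool] at h
    exact_mod_cast h
  have hN0 : (N : ℝ) ≠ 0 := by
    intro h0
    rw [h0, mul_zero] at htotal
    exact absurd htotal (by positivity)
  have hfam : cliqueFamily n = S.image Φ := by
    unfold cliqueFamily
    congr
  have hpr : pr (fun g : Slot k m → Bool => P (Φ (graphOf g))) =
      ((S.filter fun G => P (Φ G)).card * N : ℝ) / (S.card * N) := by
    have h := hcount fun G => P (Φ G)
    have h' : ∑ g, ind (fun g : Slot k m → Bool => P (Φ (graphOf g))) g =
        ((Finset.univ.filter fun g : Slot k m → Bool => P (Φ (graphOf g))).card : ℝ) := by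
      rw [Finset.natCast_card_filter]
      exact Finset.sum_congr rfl fun g _ => rfl
    rw [pr, avg, htotal, h', h, Nat.cast_mul]
  rw [hpr, mul_div_mul_right _ _ hN0, uniformProb, hfam, Finset.filter_image,
    Finset.card_image_of_injective _ hinj, Finset.card_image_of_injective _ hinj]

theorem cliqueFamily_isThreeCNF {n : ℕ} {A : CNF (Fin n)} (hA : A ∈ cliqueFamily n) :
    A.IsThreeCNF := by
  classical
  obtain ⟨G, _, rfl⟩ := Finset.mem_image.1 hA
  exact (cliqueFormula_isThreeCNF G).rename _

end Family

/-- With high probability, all tree-like refutations are long. -/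
theorem one_sub_le_uniformProb {n : ℕ} {F : Finset (BoolFun (Fin n))} {y x ℓ : ℝ} {d h : ℕ}
    (hk8 : 8 ≤ cliqueSize (blockSize n)) (hmk : (blockSize n : ℝ) ^ 4 ≤ 2 ^ cliqueSize (blockSize n))
    (hy : 256 ≤ y) (hym : y ^ 20 ≤ blockSize n) (hky : cliqueSize (blockSize n) ≤ y)
    (hd : 2 ^ d ≤ y) (hlog : cliqueSize (blockSize n) * Real.log (2 * blockSize n) ≤ y)
    (hhy : h ≤ y) (hx0 : 0 < x) (hx1 : x ≤ 1)
    (hyx : 4 * (1 + x) ^ cliqueSize (blockSize n) ≤ y * x ^ d)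
    (hyd : 4 ^ (cliqueSize (blockSize n) + 1) * 16 ^ h < y ^ (d + 1))
    (hF : Real.log (2 * (F.card + (cliqueSize (blockSize n) * blockSize n : ℝ) ^ 2)) ≤
      (blockSize n : ℝ) ^ 2 / y ^ 17) (hℓ : ℓ ≤ (8 / 7) ^ h) :
    1 - 3 / (blockSize n : ℝ) ≤ uniformProb (cliqueFamily n) fun A =>
      A.Unsat ∧ ∀ π : SemRefutation F A, π.TreeLike → ℓ ≤ (π.length : ℝ) := by
  rw [uniformProb_cliqueFamily]
  set k := cliqueSize (blockSize n)
  set m := blockSize n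
  have hy1 : 1 ≤ y := by linarith
  have hmy : y ≤ m := (le_self_pow₀ hy1 (by norm_num)).trans hym
  have hm2 : 2 ≤ m := by
    have : (2 : ℝ) ≤ m := by linarith
    exact_mod_cast this
  have hk : 0 < k := by omega
  have hym4 : y ^ 4 < m :=
    lt_of_lt_of_le (pow_lt_pow_right₀ (by linarith) (by norm_num)) hym
  have hQ := queries_nonempty (m := m) hk (by omega) F (varIndex n)
  have hQF : Real.log (2 * (queries F (varIndex n)).card) ≤ (m : ℝ) ^ 2 / y ^ 17 := by
    refine le_trans (Real.log_le_log ?_ ?_) hF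
    · have : (0 : ℝ) < (queries F (varIndex n)).card := by exact_mod_cast hQ.card_pos
      positivity
    · have : ((queries F (varIndex n)).card : ℝ) ≤ F.card + (k * m : ℝ) ^ 2 := by
        exact_mod_cast card_queries_le F (varIndex n)
      linarith
  have h1 := pr_not_selects_le (d := d) hy hym hky hd hlog hhy hQ hQF
  have h2 := pr_not_regularDegrees_le (d := d) hy hym hky hd hlog
  have h3 := pr_exists_clique_le (by omega) hk8 hmk
  have hbad : pr (fun g : Slot k m → Bool =>
      ¬ (CNF.Unsat ((cliqueFormula (graphOf g)).rename (varIndex n)) ∧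
        ∀ π : SemRefutation F ((cliqueFormula (graphOf g)).rename (varIndex n)), π.TreeLike →
          ℓ ≤ (π.length : ℝ))) ≤ 1 / m + (1 / m + 1 / m) := by
    refine le_trans (pr_mono fun g hg => ?_) ((pr_or_le _ _).trans
      (add_le_add h1 ((pr_or_le _ _).trans (add_le_add h2 h3))))
    by_contra hno
    push Not at hno
    obtain ⟨hsel, hreg, hcl⟩ := hno
    exact hg ⟨CNF.unsat_rename _ fun ⟨t, ht⟩ => hcl t ht, fun π hπ =>
      hℓ.trans (hπ.lt_length hk hm2 (by linarith) hym4 hd hx0 hx1 hyx hyd hreg hsel).le⟩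
  rw [pr_not] at hbad
  have : (3 : ℝ) / m = 1 / m + (1 / m + 1 / m) := by ring
  linarith

/-! ### Asymptotics of the parameters -/

theorem uniformProb_le_one {α : Type} (S : Finset α) (P : α → Prop) : uniformProb S P ≤ 1 := by
  classical
  unfold uniformProb
  refine div_le_one_of_le₀ ?_ (Nat.cast_nonneg _)
  exact_mod_cast Finset.card_filter_le _ _

theorem tendsto_blockSize : Tendsto blockSize atTop atTop := by
  refine tendsto_atTop.2 fun M => ?_
  filter_upwards [eventually_ge_atTop (max M (numVars M))] with n hn
  exact Nat.le_findGreatest (le_of_max_le_left hn) (le_of_max_le_right hn)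

/-- Either block size m + 1 is excluded by the number of variables, or m has reached its cap n, in
which case the bound holds because the clique size is positive. -/
theorem le_numVars_succ {n : ℕ} (h : 0 < blockSize n) : n ≤ numVars (blockSize n + 1) := by
  rcases lt_or_ge (blockSize n) n with hlt | hge
  · exact (not_le.1 (Nat.findGreatest_is_greatest (P := fun m => numVars m ≤ n)
      (Nat.lt_succ_self _) hlt)).le
  · refine hge.trans ?_
    have h1 : 0 < cliqueSize (blockSize n + 1) := by
      refine Nat.ceil_pos.2 (mul_pos (by norm_num) (Real.logb_pos (by norm_num) ?_))
      exact_mod_cast Nat.succ_lt_succ h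
    unfold numVars
    nlinarith

theorem eventually_sq_le_two_rpow {η : ℝ} (hη : 0 < η) :
    ∀ᶠ L : ℝ in atTop, 10 * L ^ 2 ≤ (2 : ℝ) ^ (η * L) := by
  have hb : 0 < Real.log 2 * η := mul_pos (Real.log_pos (by norm_num)) hη
  have h := (isLittleO_pow_exp_pos_mul_atTop 2 hb).bound (show (0 : ℝ) < 1 / 10 by norm_num)
  filter_upwards [h] with L hL
  rw [Real.norm_of_nonneg (by positivity), Real.norm_of_nonneg (Real.exp_pos _).le] at hL
  rw [Real.rpow_def_of_pos (by norm_num), ← mul_assoc]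
  linarith

theorem cliqueSize_le (m : ℕ) (hm : 1 ≤ m) : (cliqueSize m : ℝ) ≤ 4 * Real.logb 2 m + 1 := by
  refine (Nat.ceil_lt_add_one (mul_nonneg (by norm_num) (Real.logb_nonneg (by norm_num) ?_))).le
  exact_mod_cast hm

theorem numVars_succ_le {m : ℕ} (hm : 1 ≤ m) {L : ℝ} (hL : L = Real.logb 2 m) (hL5 : 5 ≤ L) :
    (numVars (m + 1) : ℝ) ≤ m * (10 * L ^ 2) := by
  have hm' : (1 : ℝ) ≤ m := by exact_mod_cast hm
  have h1 : (cliqueSize (m + 1) : ℝ) ≤ 4 * L + 5 := by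
    refine (cliqueSize_le (m + 1) (by omega)).trans ?_
    have h2 : Real.logb 2 ((m + 1 : ℕ) : ℝ) ≤ 1 + L := by
      have h3 : (1 : ℝ) + L = Real.logb 2 (2 * m) := by
        rw [Real.logb_mul (by norm_num) (by linarith), hL, Real.logb_self_eq_one (by norm_num)]
      rw [h3]
      refine Real.logb_le_logb_of_le (by norm_num) (by positivity) ?_
      push_cast
      linarith
    linarith
  have h4 : (numVars (m + 1) : ℝ) = cliqueSize (m + 1) * (2 * m + 3) := by
    unfold numVars
    push_cast
    ring
  rw [h4]
  calc (cliqueSize (m + 1) : ℝ) * (2 * m + 3) ≤ (4 * L + 5) * (5 * m) := by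
        gcongr
        linarith
    _ = m * (20 * L + 25) := by ring
    _ ≤ m * (10 * L ^ 2) := by
        gcongr
        nlinarith

/-- The pair tests add only polynomially many functions to `F`; the gap between y^30 and y^17
absorbs them. -/
theorem log_card_le {a M y K : ℝ} {N : ℕ} (hN : (N : ℝ) ≤ Real.exp a) (ha0 : 0 ≤ a)
    (ha : a ≤ M ^ 2 / y ^ 30) (hy : 256 ≤ y) (hyM : y ^ 20 ≤ M) (hK : 1 ≤ K) (hKy : K ≤ y) :
    Real.log (2 * (N + (K * M) ^ 2)) ≤ M ^ 2 / y ^ 17 := by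
  have hy0 : 0 < y := by linarith
  have hM1 : 1 ≤ M := (one_le_pow₀ (by linarith)).trans hyM
  have hKM : 1 ≤ (K * M) ^ 2 := one_le_pow₀ (one_le_mul_of_one_le_of_one_le hK hM1)
  have h1 : Real.log (2 * (N + (K * M) ^ 2)) ≤ 2 * (K * M) + 4 + a := by
    have hexp : 2 * (N + (K * M) ^ 2) ≤ Real.exp (2 * (K * M) + 4 + a) := by
      have e1 : K * M ≤ Real.exp (K * M) := by
        have := Real.add_one_le_exp (K * M); linarith
      have e2 : (K * M) ^ 2 ≤ Real.exp (2 * (K * M)) := by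
        calc (K * M) ^ 2 ≤ Real.exp (K * M) ^ 2 := by gcongr
          _ = _ := by rw [← Real.exp_nat_mul]; norm_num
      have e3 : (4 : ℝ) ≤ Real.exp 4 := by
        have := Real.add_one_le_exp (4 : ℝ); linarith
      have e4 : 1 ≤ Real.exp a := Real.one_le_exp ha0
      rw [Real.exp_add, Real.exp_add]
      have e5 : 1 ≤ Real.exp (2 * (K * M)) := hKM.trans e2
      calc 2 * (N + (K * M) ^ 2) ≤ 2 * (Real.exp (2 * (K * M)) * Real.exp a +
            Real.exp (2 * (K * M)) * Real.exp a) := by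
              gcongr
              · exact hN.trans (le_mul_of_one_le_left (Real.exp_pos _).le e5)
              · exact e2.trans (le_mul_of_one_le_right (Real.exp_pos _).le e4)
        _ = Real.exp (2 * (K * M)) * 4 * Real.exp a := by ring
        _ ≤ _ := by gcongr
    calc _ ≤ Real.log (Real.exp (2 * (K * M) + 4 + a)) := Real.log_le_log (by positivity) hexp
      _ = _ := Real.log_exp _
  have f1 : M * y ^ 3 ≤ M ^ 2 / y ^ 17 := by
    rw [le_div_iff₀ (by positivity), mul_assoc, ← pow_add, sq]
    gcongr
  have f2 : M ^ 2 / y ^ 30 ≤ M ^ 2 / y ^ 17 / 256 := by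
    rw [div_div]
    refine div_le_div_of_nonneg_left (by positivity) (by positivity) ?_
    calc y ^ 17 * 256 ≤ y ^ 17 * y := by gcongr
      _ = y ^ 18 := by ring
      _ ≤ y ^ 30 := pow_le_pow_right₀ (by linarith) (by norm_num)
  have f3 : K * M ≤ M * y := by rw [mul_comm]; gcongr
  have f4 : M * y * 256 ^ 2 ≤ M * y ^ 3 := by
    calc M * y * 256 ^ 2 ≤ M * y * y ^ 2 := by gcongr
      _ = _ := by ring
  have f5 : 1 ≤ M * y := one_le_mul_of_one_le_of_one_le hM1 (by linarith)
  linarith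

theorem two_rpow_le_pow {s : ℝ} {h : ℕ} (hs : s ≤ h / 8) : (2 : ℝ) ^ s ≤ (8 / 7) ^ h := by
  have h2 : (2 : ℝ) ≤ (8 / 7) ^ 8 := by norm_num
  calc (2 : ℝ) ^ s ≤ 2 ^ (h / 8 : ℝ) := Real.rpow_le_rpow_of_exponent_le one_le_two hs
    _ ≤ ((8 / 7) ^ 8) ^ (h / 8 : ℝ) := Real.rpow_le_rpow (by norm_num) h2 (by positivity)
    _ = (8 / 7) ^ (8 * (h / 8) : ℝ) := by rw [Real.rpow_mul (by norm_num)]; norm_cast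
    _ = (8 / 7) ^ h := by rw [mul_div_cancel₀ _ (by norm_num), Real.rpow_natCast]

/-- With m = 2^L the right-hand factor 2^(ηL) is m^η. The power of 1 + x costs at most m^(η/2), as x
= η/20 and k ≤ 5L; `b` is chosen such that x^d costs at most m^(η/4). The remaining m^(η/4) covers
the 4. -/
theorem four_mul_one_add_pow_le {η x b L : ℝ} {k d : ℕ} (hx0 : 0 < x) (hx : x = η / 20)
    (hk : (k : ℝ) ≤ 5 * L) (hd : (d : ℝ) ≤ b * L)
    (hblog : b * Real.logb 2 (1 / x) = η / 4) (hlog0 : 0 ≤ Real.logb 2 (1 / x))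
    (hηL : 8 ≤ η * L) : 4 * (1 + x) ^ k ≤ 2 ^ (η * L) * x ^ d := by
  have rpow_mono : ∀ {u v : ℝ}, u ≤ v → (2 : ℝ) ^ u ≤ 2 ^ v := fun {u v} h =>
    Real.rpow_le_rpow_of_exponent_le one_le_two h
  have h1 : (1 + x) ^ k ≤ 2 ^ (η * L / 2) := by
    calc (1 + x) ^ k ≤ Real.exp x ^ k := by
          gcongr
          linarith [Real.add_one_le_exp x]
      _ = Real.exp (k * x) := by rw [← Real.exp_nat_mul]
      _ ≤ Real.exp (Real.log 2 * (η * L / 2)) := by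
          refine Real.exp_le_exp.2 ?_
          have h2 : k * x ≤ 5 * L * x := mul_le_mul_of_nonneg_right hk hx0.le
          have h3 : 5 * L * x = 1 / 2 * (η * L / 2) := by rw [hx]; ring
          have h4 : (1 / 2 : ℝ) ≤ Real.log 2 := by linarith [Real.log_two_gt_d9]
          rw [h3] at h2
          exact h2.trans (mul_le_mul_of_nonneg_right h4 (by linarith))
      _ = 2 ^ (η * L / 2) := by rw [Real.rpow_def_of_pos (by norm_num)]
  have h2 : (2 : ℝ) ^ (-(η * L / 4)) ≤ x ^ d := by
    have hx2 : x = 2 ^ (-Real.logb 2 (1 / x)) := by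
      rw [← Real.logb_inv, one_div, inv_inv,
        Real.rpow_logb (by norm_num) (by norm_num) hx0]
    have h3 : x ^ d = 2 ^ (-Real.logb 2 (1 / x) * d) := by
      rw [Real.rpow_mul (by norm_num), ← hx2, Real.rpow_natCast]
    rw [h3]
    refine rpow_mono ?_
    have h4 : Real.logb 2 (1 / x) * d ≤ Real.logb 2 (1 / x) * (b * L) :=
      mul_le_mul_of_nonneg_left hd hlog0
    have h5 : Real.logb 2 (1 / x) * (b * L) = η * L / 4 := by
      rw [← mul_assoc, mul_comm _ b, hblog]; ring
    linarith
  calc 4 * (1 + x) ^ k ≤ 2 ^ (2 : ℝ) * 2 ^ (η * L / 2) :=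
        mul_le_mul (by norm_num) h1 (by positivity) (by positivity)
    _ = 2 ^ (2 + η * L / 2) := by rw [← Real.rpow_add (by norm_num)]
    _ ≤ 2 ^ (η * L + -(η * L / 4)) := rpow_mono (by linarith)
    _ = 2 ^ (η * L) * 2 ^ (-(η * L / 4)) := by rw [Real.rpow_add (by norm_num)]
    _ ≤ _ := mul_le_mul_of_nonneg_left h2 (by positivity)

/-- The bounds on the parameters that hold for large block sizes. -/
theorem parameter_bounds {η x b : ℝ} (hη : 0 < η) (hη1 : η ≤ 1 / 32) (hx : x = η / 20)
    (hb : b = η / (4 * Real.logb 2 (1 / x))) {m : ℕ} (hm : 1 ≤ m) {L y : ℝ}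
    (hL : L = Real.logb 2 m) (hy : y = 2 ^ (η * L)) (hL5 : 5 ≤ L) (hηL : 8 ≤ η * L)
    (hLy : 10 * L ^ 2 ≤ y) (hbL : 32 ≤ η * b * L) {d h : ℕ} (hd : d = ⌊b * L⌋₊)
    (hh : h = ⌊η * b * L ^ 2 / 8⌋₊) :
    8 ≤ cliqueSize m ∧ (m : ℝ) ^ 4 ≤ 2 ^ cliqueSize m ∧ 256 ≤ y ∧ y ^ 20 ≤ m ∧ cliqueSize m ≤ y ∧
      2 ^ d ≤ y ∧ cliqueSize m * Real.log (2 * m) ≤ y ∧ h ≤ y ∧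
      4 * (1 + x) ^ cliqueSize m ≤ y * x ^ d ∧
      4 ^ (cliqueSize m + 1) * 16 ^ h < y ^ (d + 1) ∧
      (2 : ℝ) ^ (η * b / 128 * L ^ 2) ≤ (8 / 7) ^ h := by
  have hm' : (1 : ℝ) ≤ m := by exact_mod_cast hm
  have hmL : (m : ℝ) = 2 ^ L := by
    rw [hL, Real.rpow_logb (by norm_num) (by norm_num) (by linarith)]
  have hx0 : 0 < x := by rw [hx]; positivity
  have hxle : x ≤ 1 / 2 := by rw [hx]; linarith
  have hlogx : 1 ≤ Real.logb 2 (1 / x) := by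
    rw [Real.le_logb_iff_rpow_le (by norm_num) (by positivity), Real.rpow_one,
      le_div_iff₀ hx0]
    linarith
  have hb0 : 0 < b := by rw [hb]; positivity
  have hbη : b ≤ η := by
    rw [hb]
    exact div_le_self hη.le (by linarith)
  have hblog : b * Real.logb 2 (1 / x) = η / 4 := by
    rw [hb]; field_simp
  have hk := cliqueSize_le m hm
  rw [← hL] at hk
  have hk' : 4 * L ≤ cliqueSize m := by rw [hL]; exact Nat.le_ceil _
  set k := cliqueSize m
  have hk5 : (k : ℝ) ≤ 5 * L := by linarith
  have hdle : (d : ℝ) ≤ b * L := by rw [hd]; exact Nat.floor_le (by positivity)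
  have hdlt : b * L < d + 1 := by rw [hd]; exact Nat.lt_floor_add_one _
  have hhle : (h : ℝ) ≤ η * b * L ^ 2 / 8 := by rw [hh]; exact Nat.floor_le (by positivity)
  have hhlt : η * b * L ^ 2 / 8 < h + 1 := by rw [hh]; exact Nat.lt_floor_add_one _
  have hbL2 : 32 * L ≤ η * b * L ^ 2 := by nlinarith
  have two_pow : ∀ i : ℕ, (2 : ℝ) ^ i = 2 ^ (i : ℝ) := fun i => (Real.rpow_natCast 2 i).symm
  have rpow_mono : ∀ {u v : ℝ}, u ≤ v → (2 : ℝ) ^ u ≤ 2 ^ v := fun {u v} h =>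
    Real.rpow_le_rpow_of_exponent_le one_le_two h
  have hηb : η * b ≤ 1 := by nlinarith
  have hLL : L ≤ L ^ 2 := by nlinarith
  refine ⟨?_, ?_, ?_, ?_, ?_, ?_, ?_, ?_, ?_, ?_, ?_⟩
  · have : (8 : ℝ) ≤ k := by linarith
    exact_mod_cast this
  · rw [two_pow, hmL, ← Real.rpow_natCast, ← Real.rpow_mul (by norm_num)]
    refine rpow_mono ?_
    push_cast
    linarith
  · rw [hy, show (256 : ℝ) = 2 ^ (8 : ℝ) by norm_num]
    exact rpow_mono hηL
  · rw [hy, hmL, ← Real.rpow_natCast, ← Real.rpow_mul (by norm_num)]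
    refine rpow_mono ?_
    push_cast
    nlinarith
  · nlinarith
  · rw [two_pow, hy]
    exact rpow_mono (hdle.trans (by gcongr))
  · have h1 : Real.log (2 * m) ≤ 1 + L := by
      have h2 : Real.log (2 * m) = Real.log 2 * (1 + L) := by
        rw [Real.log_mul (by norm_num) (by linarith), hL, Real.logb]
        have : Real.log 2 ≠ 0 := (Real.log_pos (by norm_num)).ne'
        field_simp
      rw [h2]
      have := Real.log_two_lt_d9
      nlinarith
    have h0 : 0 ≤ Real.log (2 * m) := Real.log_nonneg (by linarith)
    calc k * Real.log (2 * m) ≤ 5 * L * (1 + L) := by gcongr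
      _ ≤ 10 * L ^ 2 := by nlinarith
      _ ≤ y := hLy
  · nlinarith
  · rw [hy]
    exact four_mul_one_add_pow_le hx0 hx hk5 hdle hblog (by linarith) hηL
  -- The right-hand side is at least 2^(ηbL^2). By the choice of `h`, 16^h uses at most half of this
  -- exponent, and 4^(k+1) fits into the other half by `hbL2`.
  · have h1 : (4 : ℝ) ^ (k + 1) * 16 ^ h = 2 ^ (2 * (k + 1) + 4 * h : ℝ) := by
      have : (4 : ℝ) ^ (k + 1) * 16 ^ h = 2 ^ (2 * (k + 1) + 4 * h) := by
        rw [pow_add 2, pow_mul, pow_mul]; norm_num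
      rw [this, two_pow]
      push_cast
      rfl
    rw [h1, hy, ← Real.rpow_natCast, ← Real.rpow_mul (by norm_num)]
    refine Real.rpow_lt_rpow_of_exponent_lt one_lt_two ?_
    push_cast
    have h2 : η * b * L ^ 2 ≤ η * L * (d + 1) := by
      calc η * b * L ^ 2 = η * L * (b * L) := by ring
        _ ≤ _ := by gcongr
    linarith
  · exact two_rpow_le_pow (by linarith)

theorem theorem1p1 :
    (∀ n : ℕ, ∀ A ∈ cliqueFamily n, A.IsThreeCNF) ∧
    ∀ ε : ℝ, 0 < ε → ∃ c : ℝ, 0 < c ∧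
      ∀ F : (n : ℕ) → Finset (BoolFun (Fin n)),
        (∀ n : ℕ, ((F n).card : ℝ) ≤ Real.exp ((n : ℝ) ^ (2 - ε))) →
        Tendsto
          (fun n : ℕ => uniformProb (cliqueFamily n) fun A =>
            A.Unsat ∧ ∀ π : SemRefutation (F n) A, π.TreeLike →
              (n : ℝ) ^ (c * Real.logb 2 (n : ℝ)) ≤ (π.length : ℝ))
          atTop (𝓝 1) := by
  refine ⟨fun n A hA => cliqueFamily_isThreeCNF hA, fun ε hε => ?_⟩
  -- Capping keeps the exponent 2 - ε' positive, so that n may be replaced by the larger m * y.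
  set ε' := min ε 1 with hε'
  have hε'0 : 0 < ε' := lt_min hε one_pos
  have hε'1 : ε' ≤ 1 := min_le_right _ _
  -- Then (1 + η)(2 - ε') ≤ 2 - 30η, so n ≤ m * y gives n^(2-ε') ≤ m^2/y^30.
  set η := ε' / 32 with hη
  have hη0 : 0 < η := by positivity
  have hη1 : η ≤ 1 / 32 := by rw [hη]; linarith
  set x := η / 20 with hx
  have hx0 : 0 < x := by positivity
  set b := η / (4 * Real.logb 2 (1 / x)) with hb
  have hb0 : 0 < b := by
    refine div_pos hη0 (mul_pos (by norm_num) (Real.logb_pos (by norm_num) ?_))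
    rw [lt_div_iff₀ hx0]
    linarith
  -- Since log n ≤ 2 log m, squaring costs a factor 4 compared with the constant 128 obtained in
  -- terms of m.
  refine ⟨η * b / 512, by positivity, fun F hF => ?_⟩
  have hlim : Tendsto (fun n => 1 - 3 / (blockSize n : ℝ)) atTop (𝓝 1) := by
    have h1 : Tendsto (fun n => (blockSize n : ℝ)) atTop atTop :=
      tendsto_natCast_atTop_atTop.comp tendsto_blockSize
    simpa using (tendsto_const_nhds (x := (1 : ℝ))).sub (h1.const_div_atTop 3)
  refine tendsto_of_tendsto_of_tendsto_of_le_of_le' hlim tendsto_const_nhds ?_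
    (Eventually.of_forall fun n => uniformProb_le_one _ _)
  have hLlim : Tendsto (fun n => Real.logb 2 (blockSize n)) atTop atTop :=
    (Real.tendsto_logb_atTop (by norm_num)).comp
      (tendsto_natCast_atTop_atTop.comp tendsto_blockSize)
  filter_upwards [hLlim.eventually (eventually_sq_le_two_rpow hη0),
    hLlim.eventually (eventually_ge_atTop 5), hLlim.eventually (eventually_ge_atTop (8 / η)),
    hLlim.eventually (eventually_ge_atTop (32 / (η * b))),
    tendsto_blockSize.eventually (eventually_ge_atTop 1), eventually_ge_atTop 1]
    with n hLy hL5 hηL hbL hm hn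
  rw [div_le_iff₀' (by positivity)] at hηL hbL
  set m := blockSize n
  set L := Real.logb 2 m with hL
  set y : ℝ := 2 ^ (η * L) with hy
  obtain ⟨hk8, hmk, hy256, hym, hky, hd, hlog, hhy, hyx, hyd, hlen⟩ :=
    parameter_bounds hη0 hη1 hx hb hm hL hy hL5 hηL hLy hbL rfl rfl
  have hm' : (1 : ℝ) ≤ m := by exact_mod_cast hm
  have hn' : (1 : ℝ) ≤ n := by exact_mod_cast hn
  have hnm : (n : ℝ) ≤ m * y := by
    have h1 : (n : ℝ) ≤ numVars (m + 1) := by exact_mod_cast le_numVars_succ hm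
    exact h1.trans ((numVars_succ_le hm hL hL5).trans (by gcongr))
  have hmL : (m : ℝ) = 2 ^ L := by
    rw [hL, Real.rpow_logb (by norm_num) (by norm_num) (by linarith)]
  refine one_sub_le_uniformProb hk8 hmk hy256 hym hky hd hlog hhy hx0 (by linarith) hyx hyd ?_ ?_
  · refine log_card_le (hF n) (by positivity) ?_ hy256 hym (by exact_mod_cast (by omega : 1 ≤ cliqueSize m)) hky
    calc (n : ℝ) ^ (2 - ε) ≤ (n : ℝ) ^ (2 - ε') :=
          Real.rpow_le_rpow_of_exponent_le hn' (by linarith [min_le_left ε 1])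
      _ ≤ (m * y) ^ (2 - ε') := Real.rpow_le_rpow (by linarith) hnm (by linarith)
      _ = 2 ^ ((1 + η) * L * (2 - ε')) := by
          rw [hmL, hy, ← Real.rpow_add (by norm_num), ← Real.rpow_mul (by norm_num)]
          ring_nf
      _ ≤ 2 ^ (L * 2 - η * L * 30) := by
          refine Real.rpow_le_rpow_of_exponent_le one_le_two ?_
          have h1 : ε' = 32 * η := by rw [hη]; ring
          rw [h1]
          nlinarith [mul_pos hη0 hη0]
      _ = m ^ 2 / y ^ 30 := by
          rw [Real.rpow_sub (by norm_num), hmL, hy, Real.rpow_mul (by norm_num),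
            Real.rpow_mul (by norm_num) (η * L)]
          norm_cast
  · refine le_trans ?_ hlen
    have h2 : Real.logb 2 n ≤ 2 * L := by
      calc Real.logb 2 n ≤ Real.logb 2 (m * y) :=
            Real.logb_le_logb_of_le (by norm_num) (by linarith) hnm
        _ = L + η * L := by
            rw [hmL, hy, ← Real.rpow_add (by norm_num), Real.logb_rpow (by norm_num) (by norm_num)]
        _ ≤ 2 * L := by nlinarith
    have h0 : 0 ≤ Real.logb 2 n := Real.logb_nonneg (by norm_num) hn'
    calc (n : ℝ) ^ (η * b / 512 * Real.logb 2 n)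
        = 2 ^ (Real.logb 2 n * (η * b / 512 * Real.logb 2 n)) := by
          rw [Real.rpow_mul two_pos.le, Real.rpow_logb (by norm_num) (by norm_num) (by linarith)]
      _ ≤ 2 ^ (η * b / 128 * L ^ 2) := by
          refine Real.rpow_le_rpow_of_exponent_le one_le_two ?_
          calc Real.logb 2 n * (η * b / 512 * Real.logb 2 n)
              = η * b / 512 * Real.logb 2 n ^ 2 := by ring
            _ ≤ η * b / 512 * (2 * L) ^ 2 := by gcongr
            _ = _ := by ring
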